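/- Let $n\ge 2$ and let $\mathbb H^n$ be the hyperbolic space of constant sectional curvature $-1$, with Riemannian volume $dv$. For a bounded domain (bounded connected open set) $\Omega\subset\mathbb H^n$ with $C^1$ boundary let $H^2(\Omega)$ be the completion of the space of smooth functions on $\Omega$ of finite norm with respect to $\|f\|^2=\int_\Omega(|D^2f|^2+|\nabla f|^2+f^2)\,dv$, and let $\mu_1\le\mu_2\le\dots\to+\infty$ be the eigenvalues, repeated according to multiplicity, of the Neumann problem for the biharmonic operator on $\Omega$ in its weak form: find $0\ne u\in H^2(\Omega)$ and $\mu\in\mathbb R$ such that $$\int_\Omega \langle D^2u,D^2\phi\rangle+\mathrm{Ric}(\nabla u,\nabla\phi)\,dv=\mu\int_\Omega u\,\phi\,dv\qquad\text{for all }\phi\in H^2(\Omega).$$ Theorem. For every positive integer $N$ and every real $M>0$ there exists a bounded domain $\Omega\subset\mathbb H^n$ with $C^1$ boundary and with volume $|\Omega|=1$ (for which the eigenvalues are thus defined, with corresponding eigenfunctions forming a Hilbert basis of $L^2(\Omega)$) such that $\mu_j\le -M$ for all $1\le j\le N$. -/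

import Mathlib

open MeasureTheory Filter Topology
open scoped ContDiff Matrix

noncomputable section

namespace BiharmonicNeumann

/-! ### Riemannian geometry in a global chart

Points are coordinate vectors `x : Fin n → ℝ`; a Riemannian metric on an open set of `ℝⁿ` is given
by its Gram matrix `g x = (g_ij(x))`. -/

/-- The coordinate derivative `∂_i f`. -/
def pd {n : ℕ} (i : Fin n) (f : (Fin n → ℝ) → ℝ) (x : Fin n → ℝ) : ℝ :=
  fderiv ℝ f x (Pi.single i 1)

/-- Christoffel symbols
`Γ^k_ij = (1/2) ∑_l g^{kl} (∂_i g_jl + ∂_j g_il - ∂_l g_ij)` of the Levi-Civita connection. -/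
def christoffel {n : ℕ} (g : (Fin n → ℝ) → Matrix (Fin n) (Fin n) ℝ) (k i j : Fin n)
    (x : Fin n → ℝ) : ℝ :=
  (1 / 2) * ∑ l, (g x)⁻¹ k l *
    (pd i (fun y => g y j l) x + pd j (fun y => g y i l) x - pd l (fun y => g y i j) x)

/-- The Ricci tensor
`Ric_ij = ∑_k (∂_k Γ^k_ij - ∂_j Γ^k_ik) + ∑_{k,l} (Γ^k_kl Γ^l_ij - Γ^k_jl Γ^l_ik)`. -/
def ricci {n : ℕ} (g : (Fin n → ℝ) → Matrix (Fin n) (Fin n) ℝ) (x : Fin n → ℝ) :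
    Matrix (Fin n) (Fin n) ℝ :=
  Matrix.of fun i j =>
    ∑ k, (pd k (christoffel g k i j) x - pd j (christoffel g k i k) x) +
      ∑ k, ∑ l, (christoffel g k k l x * christoffel g l i j x -
        christoffel g k j l x * christoffel g l i k x)

/-- The differential `df = (∂_i f)_i`, a covector field. -/
def differential {n : ℕ} (f : (Fin n → ℝ) → ℝ) (x : Fin n → ℝ) : Fin n → ℝ :=
  fun i => pd i f x

/-- The Riemannian Hessian `(D²f)_ij = ∂_i ∂_j f - ∑_k Γ^k_ij ∂_k f`. -/
def hessian {n : ℕ} (g : (Fin n → ℝ) → Matrix (Fin n) (Fin n) ℝ) (f : (Fin n → ℝ) → ℝ)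
    (x : Fin n → ℝ) : Matrix (Fin n) (Fin n) ℝ :=
  Matrix.of fun i j => pd i (pd j f) x - ∑ k, christoffel g k i j x * pd k f x

/-- Inner product of two covectors at a point with Gram matrix `G`: `∑ G^{ij} p_i q_j`.
For `p = df`, `q = dφ` this is `⟨∇f, ∇φ⟩`. -/
def covInner {n : ℕ} (G : Matrix (Fin n) (Fin n) ℝ) (p q : Fin n → ℝ) : ℝ :=
  p ⬝ᵥ (G⁻¹ *ᵥ q)

/-- Inner product of two covariant 2-tensors at a point with Gram matrix `G`:
`∑ G^{ia} G^{jb} H_ij K_ab`. -/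
def tensorInner {n : ℕ} (G H K : Matrix (Fin n) (Fin n) ℝ) : ℝ :=
  ∑ i, ∑ j, ∑ a, ∑ b, G⁻¹ i a * G⁻¹ j b * H i j * K a b

/-- `R(p♯, q♯)` for a covariant 2-tensor `R` and covectors `p`, `q`, where `p♯ = G⁻¹ p`.
For `R = Ric`, `p = df`, `q = dφ` this is `Ric(∇f, ∇φ)`. -/
def evalSharp {n : ℕ} (G R : Matrix (Fin n) (Fin n) ℝ) (p q : Fin n → ℝ) : ℝ :=
  (G⁻¹ *ᵥ p) ⬝ᵥ (R *ᵥ (G⁻¹ *ᵥ q))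

/-- The Riemannian volume `dv = √(det g) dx`. -/
def riemVolume {n : ℕ} (g : (Fin n → ℝ) → Matrix (Fin n) (Fin n) ℝ) : Measure (Fin n → ℝ) :=
  volume.withDensity fun x => ENNReal.ofReal (Real.sqrt (g x).det)

/-- The Riemannian distance on `U` with the metric `g`: the infimum of the lengths of the `C¹` curves
in `U` from `x` to `y`. -/
def riemDist {n : ℕ} (U : Set (Fin n → ℝ)) (g : (Fin n → ℝ) → Matrix (Fin n) (Fin n) ℝ)
    (x y : Fin n → ℝ) : ENNReal :=
  ⨅ (γ : ℝ → Fin n → ℝ) (_ : ContDiff ℝ 1 γ ∧ γ 0 = x ∧ γ 1 = y ∧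
      ∀ t ∈ Set.Icc (0 : ℝ) 1, γ t ∈ U),
    ∫⁻ t in Set.Icc (0 : ℝ) 1, ENNReal.ofReal (Real.sqrt (deriv γ t ⬝ᵥ (g (γ t) *ᵥ deriv γ t)))

/-- `Ω` is a bounded domain of `(U, g)`: a connected open subset of `U` that is bounded for the
Riemannian distance. -/
structure IsBoundedDomain {n : ℕ} (U : Set (Fin n → ℝ))
    (g : (Fin n → ℝ) → Matrix (Fin n) (Fin n) ℝ) (Ω : Set (Fin n → ℝ)) : Prop where
  isOpen : IsOpen Ω
  isConnected : IsConnected Ω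
  subset : Ω ⊆ U
  bounded : ∃ R : NNReal, ∀ x ∈ Ω, ∀ y ∈ Ω, riemDist U g x y ≤ R

/-- `Ω` has boundary of class `C¹`: near each boundary point it is a sublevel set `{F < 0}` of a
`C¹` function with non-vanishing differential. -/
def HasC1Boundary {n : ℕ} (Ω : Set (Fin n → ℝ)) : Prop :=
  ∀ p ∈ frontier Ω, ∃ V : Set (Fin n → ℝ), IsOpen V ∧ p ∈ V ∧ ∃ F : (Fin n → ℝ) → ℝ,
    ContDiffOn ℝ 1 F V ∧ fderiv ℝ F p ≠ 0 ∧ Ω ∩ V = {x ∈ V | F x < 0}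

/-! ### The Sobolev space `H²(Ω)` and the Neumann problem -/

/-- `∫_Ω (|h|² + |p|² + u²) dv` for a function `u`, a covector field `p` and a 2-tensor field `h`. -/
def h2Energy {n : ℕ} (g : (Fin n → ℝ) → Matrix (Fin n) (Fin n) ℝ) (Ω : Set (Fin n → ℝ))
    (u : (Fin n → ℝ) → ℝ) (p : (Fin n → ℝ) → Fin n → ℝ)
    (h : (Fin n → ℝ) → Matrix (Fin n) (Fin n) ℝ) : ENNReal :=
  ∫⁻ x in Ω, ENNReal.ofReal
    (tensorInner (g x) (h x) (h x) + covInner (g x) (p x) (p x) + u x ^ 2) ∂(riemVolume g)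

/-- `u ∈ H²(Ω)` with differential `p` and Hessian `h`. Here `H²(Ω)` is the completion of the smooth
functions on `Ω` with finite norm `(∫_Ω |D²f|² + |∇f|² + f²)^{1/2}`: the triple `(u, p, h)` is the
limit of `(f_k, df_k, D²f_k)` in that norm for a sequence of such functions `f_k`. -/
def MemH2 {n : ℕ} (g : (Fin n → ℝ) → Matrix (Fin n) (Fin n) ℝ) (Ω : Set (Fin n → ℝ))
    (u : (Fin n → ℝ) → ℝ) (p : (Fin n → ℝ) → Fin n → ℝ)
    (h : (Fin n → ℝ) → Matrix (Fin n) (Fin n) ℝ) : Prop :=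
  AEStronglyMeasurable u ((riemVolume g).restrict Ω) ∧
  AEStronglyMeasurable p ((riemVolume g).restrict Ω) ∧
  AEStronglyMeasurable h ((riemVolume g).restrict Ω) ∧
  ∃ f : ℕ → (Fin n → ℝ) → ℝ,
    (∀ k, ContDiffOn ℝ ∞ (f k) Ω ∧
      h2Energy g Ω (f k) (differential (f k)) (hessian g (f k)) < ⊤) ∧
    Tendsto (fun k => h2Energy g Ω (fun x => u x - f k x)
      (fun x => p x - differential (f k) x) (fun x => h x - hessian g (f k) x)) atTop (𝓝 0)

/-- `u ∈ H²(Ω)` solves the weak Neumann problem for the biharmonic operator with parameter `mu`: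
`∫_Ω ⟨D²u, D²φ⟩ + Ric(∇u, ∇φ) dv = mu ∫_Ω u φ dv` for all `φ ∈ H²(Ω)`. -/
def IsNeumannSolution {n : ℕ} (g : (Fin n → ℝ) → Matrix (Fin n) (Fin n) ℝ)
    (Ω : Set (Fin n → ℝ)) (mu : ℝ) (u : (Fin n → ℝ) → ℝ) : Prop :=
  ∃ (p : (Fin n → ℝ) → Fin n → ℝ) (h : (Fin n → ℝ) → Matrix (Fin n) (Fin n) ℝ),
    MemH2 g Ω u p h ∧
    ∀ (φ : (Fin n → ℝ) → ℝ) (q : (Fin n → ℝ) → Fin n → ℝ)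
      (k : (Fin n → ℝ) → Matrix (Fin n) (Fin n) ℝ), MemH2 g Ω φ q k →
      ∫ x in Ω, (tensorInner (g x) (h x) (k x) + evalSharp (g x) (ricci g x) (p x) (q x))
          ∂(riemVolume g)
        = mu * ∫ x in Ω, u x * φ x ∂(riemVolume g)

/-- `mu 0 ≤ mu 1 ≤ ⋯ → +∞` is the sequence of the Neumann eigenvalues of the biharmonic operator on
`Ω`, each repeated according to its multiplicity: there is a Hilbert basis of `L²(Ω)` whose `j`-th
member is an eigenfunction for `mu j`. (As eigenfunctions for different eigenvalues are orthogonal,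
for every real `c` the basis members with `mu j = c` then form a basis of the space of all solutions
with parameter `c`, so that `mu` is determined by `Ω`.) -/
def IsNeumannSpectrum {n : ℕ} (g : (Fin n → ℝ) → Matrix (Fin n) (Fin n) ℝ)
    (Ω : Set (Fin n → ℝ)) (mu : ℕ → ℝ) : Prop :=
  Monotone mu ∧ Tendsto mu atTop atTop ∧
    ∃ b : HilbertBasis ℕ ℝ (Lp ℝ 2 ((riemVolume g).restrict Ω)),
      ∀ j, IsNeumannSolution g Ω (mu j) (b j : (Fin n → ℝ) → ℝ)

/-! ### Hyperbolic space -/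

/-- The upper half-space `{x | x₀ > 0}`. -/
def halfSpace (n : ℕ) [NeZero n] : Set (Fin n → ℝ) := {x | 0 < x 0}

/-- The metric `g = x₀⁻² (dx₀² + ⋯ + dx_{n-1}²)` of constant curvature `-1` on the upper half-space;
`(halfSpace n, hyperbolicMetric n)` is hyperbolic space `ℍⁿ`. -/
def hyperbolicMetric (n : ℕ) [NeZero n] (x : Fin n → ℝ) : Matrix (Fin n) (Fin n) ℝ :=
  ((x 0) ^ 2)⁻¹ • (1 : Matrix (Fin n) (Fin n) ℝ)

end BiharmonicNeumann

end

/-!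
Hyperbolic space is Einstein with `Ric = -(n - 1) g`, so the Neumann form is
`∫ |D²u|² - (n - 1) |∇u|²`, and very negative Rayleigh quotients come from functions which are
small themselves but have a large gradient and a small Hessian. In the upper half-space the
function `y_k / y₀`, `k ≠ 0`, vanishes along the vertical geodesic, where it has unit gradient and
zero Hessian. On a tube of width `d` around that geodesic it is at most `d`, its Hessian is of
order `d` and its gradient is close to `1`, so its Rayleigh quotient is of order `-(n - 1) / d²`.
Cutting it off in the arc length `log y₀` at a large scale `l` costs only `O(l⁻²)`, and a long
tube has room for `N` cutoffs with disjoint supports; these span an `N`-dimensional space on which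
the Rayleigh quotient is at most `-M`, whence `μ_N ≤ -M` by the min-max principle. The volume of a
tube of length `log K` and width `d` is of order `d ^ (n - 1) log K`, so that as `K → ∞` the tubes
of volume `1` have `d → 0`.

The tube is given by `∑_{i ≠ 0} y_i² < (d² / K) y₀ (y₀ - 1) (K - y₀)`, which is smoothly bounded
and Euclidean convex. Convexity gives a Poincaré inequality on the cells of a grid, hence the
compactness of the embedding of `H²` into `H¹`; Ehrling's lemma then makes the form coercive
modulo `L²`, and the spectral theorem for the compact resolvent provides the eigenvalues.
-/

noncomputable section

namespace BiharmonicNeumann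

/-! ### Compact operators and coercive forms -/

section CompactPositive

variable {H : Type*} [NormedAddCommGroup H] [InnerProductSpace ℝ H] {T : H →L[ℝ] H}

theorem norm_mem_spectrum_of_inner_nonneg (hs : T.IsSymmetric)
    (hpos : ∀ x, 0 ≤ inner ℝ (T x) x) (h0 : T ≠ 0) : ‖T‖ ∈ spectrum ℝ T := by
  by_contra hmem
  have : Nontrivial H := by
    by_contra h
    rw [not_nontrivial_iff_subsingleton] at h
    exact h0 (Subsingleton.elim _ _)
  obtain ⟨ε, hε, hq⟩ :=
    T.rayleighQuotient_le_of_norm_mem_resolventSet (spectrum.notMem_iff.1 hmem)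
  have habs : ∀ x, |T.rayleighQuotient x| ≤ ‖T‖ - ε := fun x =>
    abs_le.2 ⟨by linarith [hq x, (div_nonneg (hpos x) (by positivity) : 0 ≤ T.rayleighQuotient x)],
      hq x⟩
  have hle : ‖T‖ ≤ ‖T‖ - ε := (T.norm_eq_iSup_rayleighQuotient hs).trans_le (ciSup_le habs)
  linarith

theorem exists_norm_eq_one_apply_eq_norm_smul [CompleteSpace H] (hc : IsCompactOperator T)
    (hs : T.IsSymmetric) (hpos : ∀ x, 0 ≤ inner ℝ (T x) x) (h0 : T ≠ 0) :
    ∃ x, ‖x‖ = 1 ∧ T x = ‖T‖ • x := by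
  obtain ⟨v, hv⟩ := ((hc.hasEigenvalue_iff_mem_spectrum (norm_ne_zero_iff.2 h0)).2
    (norm_mem_spectrum_of_inner_nonneg hs hpos h0)).exists_hasEigenvector
  have hTv : T v = ‖T‖ • v := hv.apply_eq_smul
  exact ⟨‖v‖⁻¹ • v, norm_smul_inv_norm (𝕜 := ℝ) hv.2, by rw [map_smul, hTv, smul_comm]⟩

theorem orthogonal_ne_bot_of_not_finiteDimensional (hinf : ¬ FiniteDimensional ℝ H)
    (U : Submodule ℝ H) [FiniteDimensional ℝ U] : Uᗮ ≠ ⊥ := fun h => by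
  obtain rfl : U = ⊤ := Submodule.orthogonal_eq_bot_iff.1 h
  exact hinf (Module.Finite.equiv (Submodule.topEquiv (R := ℝ) (M := H)))

theorem exists_eigenvector_mem_orthogonal [CompleteSpace H] (hc : IsCompactOperator T)
    (hs : T.IsSymmetric) (hpos : ∀ x, x ≠ 0 → 0 < inner ℝ (T x) x) {U : Submodule ℝ H}
    (hU : ∀ x ∈ U, T x ∈ U) (hne : Uᗮ ≠ ⊥) :
    ∃ (x : H) (t : ℝ), ‖x‖ = 1 ∧ x ∈ Uᗮ ∧ 0 < t ∧ T x = t • x ∧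
      ∀ y ∈ Uᗮ, inner ℝ (T y) y ≤ t * ‖y‖ ^ 2 := by
  have hinv : ∀ x ∈ Uᗮ, T x ∈ Uᗮ := fun x hx u hu => by
    have hux : inner ℝ (T u) x = inner ℝ u (T x) := hs u x
    rw [← hux]
    exact hx _ (hU u hu)
  let S : Uᗮ →L[ℝ] Uᗮ := T.restrict hinv
  have hSpos : ∀ x : Uᗮ, x ≠ 0 → 0 < inner ℝ (S x) x := fun x hx =>
    hpos x (by simpa using hx)
  obtain ⟨z, hz, hz0⟩ := Submodule.exists_mem_ne_zero_of_ne_bot hne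
  have hS0 : S ≠ 0 := fun h => by
    have := hSpos ⟨z, hz⟩ (by simpa using hz0)
    simp [h] at this
  have hSnonneg : ∀ x : Uᗮ, 0 ≤ inner ℝ (S x) x := fun x => by
    obtain rfl | hx := eq_or_ne x 0
    · simp
    · exact (hSpos x hx).le
  obtain ⟨x, hx1, hx⟩ := exists_norm_eq_one_apply_eq_norm_smul (hc.restrict' hinv)
    (hs.restrict_invariant hinv) hSnonneg hS0
  refine ⟨x, ‖S‖, hx1, x.2, (norm_pos_iff (a := S)).2 hS0, congrArg Subtype.val hx, fun y hy => ?_⟩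
  calc inner ℝ (S ⟨y, hy⟩) (⟨y, hy⟩ : Uᗮ)
      ≤ ‖S ⟨y, hy⟩‖ * ‖(⟨y, hy⟩ : Uᗮ)‖ := real_inner_le_norm _ _
    _ ≤ (‖S‖ * ‖(⟨y, hy⟩ : Uᗮ)‖) * ‖(⟨y, hy⟩ : Uᗮ)‖ := by gcongr; exact S.le_opNorm _
    _ = ‖S‖ * ‖y‖ ^ 2 := by rw [Submodule.coe_norm]; ring

theorem apply_mem_sup_span_singleton {U : Submodule ℝ H} (hU : ∀ y ∈ U, T y ∈ U) {x : H} {t : ℝ}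
    (hx : T x = t • x) : ∀ y ∈ U ⊔ Submodule.span ℝ {x}, T y ∈ U ⊔ Submodule.span ℝ {x} := by
  suffices U ⊔ Submodule.span ℝ {x} ≤ (U ⊔ Submodule.span ℝ {x}).comap T.toLinearMap from this
  refine sup_le (fun y hy => Submodule.mem_sup_left (hU y hy)) ?_
  rw [Submodule.span_singleton_le_iff_mem, Submodule.mem_comap, ContinuousLinearMap.coe_coe, hx]
  exact Submodule.smul_mem _ _ (Submodule.mem_sup_right (Submodule.mem_span_singleton_self _))

theorem exists_orthonormal_eigenvectors [CompleteSpace H] (hc : IsCompactOperator T)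
    (hs : T.IsSymmetric) (hpos : ∀ x, x ≠ 0 → 0 < inner ℝ (T x) x)
    (hinf : ¬ FiniteDimensional ℝ H) :
    ∃ (t : ℕ → ℝ) (b : ℕ → H), Orthonormal ℝ b ∧ (∀ j, 0 < t j) ∧ (∀ j, T (b j) = t j • b j) ∧
      ∀ j y, (∀ i < j, inner ℝ (b i) y = 0) → inner ℝ (T y) y ≤ t j * ‖y‖ ^ 2 := by
  have hnext : ∀ U : Submodule ℝ H, FiniteDimensional ℝ U ∧ (∀ x ∈ U, T x ∈ U) →
      ∃ (x : H) (t : ℝ), ‖x‖ = 1 ∧ x ∈ Uᗮ ∧ 0 < t ∧ T x = t • x ∧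
        ∀ y ∈ Uᗮ, inner ℝ (T y) y ≤ t * ‖y‖ ^ 2 := fun U ⟨_, hU⟩ =>
    exists_eigenvector_mem_orthogonal hc hs hpos hU
      (orthogonal_ne_bot_of_not_finiteDimensional hinf U)
  choose! ξ τ hξ1 hξU hτ hTξ hmax using hnext
  let U : ℕ → Submodule ℝ H := fun k => (fun W => W ⊔ Submodule.span ℝ {ξ W})^[k] ⊥
  have hUsucc : ∀ k, U (k + 1) = U k ⊔ Submodule.span ℝ {ξ (U k)} := fun k =>
    Function.iterate_succ_apply' _ _ _
  have hUinv : ∀ k, FiniteDimensional ℝ (U k) ∧ ∀ x ∈ U k, T x ∈ U k := by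
    intro k
    induction k with
    | zero => exact ⟨inferInstanceAs (FiniteDimensional ℝ (⊥ : Submodule ℝ H)), by simp [U]⟩
    | succ k ih =>
      obtain ⟨_, hTU⟩ := ih
      rw [hUsucc]
      exact ⟨inferInstance, apply_mem_sup_span_singleton hTU (hTξ _ ⟨‹_›, hTU⟩)⟩
  have hmem : ∀ i k, i < k → ξ (U i) ∈ U k := fun i k hik =>
    monotone_nat_of_le_succ (f := U) (fun k => hUsucc k ▸ le_sup_left) (Nat.succ_le_of_lt hik)
      (hUsucc i ▸ Submodule.mem_sup_right (Submodule.mem_span_singleton_self _))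
  have horth : ∀ k y, (∀ i < k, inner ℝ (ξ (U i)) y = 0) → y ∈ (U k)ᗮ := by
    intro k y
    induction k with
    | zero => simp [U]
    | succ k ih =>
      intro h
      rw [hUsucc, ← Submodule.inf_orthogonal]
      exact ⟨ih fun i hi => h i (by lia),
        Submodule.mem_orthogonal_singleton_iff_inner_right.2 (h k (by lia))⟩
  refine ⟨fun k => τ (U k), fun k => ξ (U k), ⟨fun k => hξ1 _ (hUinv k), ?_⟩,
    fun k => hτ _ (hUinv k), fun k => hTξ _ (hUinv k),
    fun k y h => hmax _ (hUinv k) y (horth k y h)⟩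
  intro i k hik
  rcases lt_or_gt_of_ne hik with h | h
  · exact hξU _ (hUinv k) _ (hmem i k h)
  · rw [real_inner_comm]
    exact hξU _ (hUinv i) _ (hmem k i h)

theorem tendsto_eigenvalue_zero_of_orthonormal (hc : IsCompactOperator T) {t : ℕ → ℝ} {b : ℕ → H}
    (hb : Orthonormal ℝ b) (hTb : ∀ j, T (b j) = t j • b j) : Tendsto t atTop (𝓝 0) := by
  refine tendsto_of_subseq_tendsto fun ns hns => ?_
  obtain ⟨Z, hZ, hsub⟩ := hc.image_closedBall_subset_compact (f := T.toLinearMap) 1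
  obtain ⟨φ, -, hnφ⟩ := strictMono_subseq_of_tendsto_atTop hns
  obtain ⟨a, -, ψ, hψ, hconv⟩ :=
    hZ.tendsto_subseq (x := fun k => T (b (ns (φ k)))) fun k => hsub ⟨_, by simp [hb.1], rfl⟩
  refine ⟨φ ∘ ψ, ?_⟩
  have hdiff := ((hconv.comp (tendsto_add_atTop_nat 1)).sub hconv).norm
  rw [sub_self, norm_zero] at hdiff
  refine squeeze_zero_norm (fun k => ?_) hdiff
  have hne : ns (φ (ψ (k + 1))) ≠ ns (φ (ψ k)) := ((hnφ.comp hψ) k.lt_succ_self).ne'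
  simp only [Function.comp_apply, hTb]
  refine le_of_sq_le_sq ?_ (norm_nonneg _)
  rw [@norm_sub_sq_real, inner_smul_left, inner_smul_right, hb.2 hne, norm_smul, norm_smul,
    hb.1, hb.1]
  simp [sq_nonneg]

theorem exists_hilbertBasis_eigenvectors [CompleteSpace H] (hc : IsCompactOperator T)
    (hs : T.IsSymmetric) (hpos : ∀ x, x ≠ 0 → 0 < inner ℝ (T x) x)
    (hinf : ¬ FiniteDimensional ℝ H) :
    ∃ (t : ℕ → ℝ) (b : HilbertBasis ℕ ℝ H), (∀ j, 0 < t j) ∧ Antitone t ∧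
      Tendsto t atTop (𝓝 0) ∧ (∀ j, T (b j) = t j • b j) ∧
      ∀ j y, (∀ i < j, inner ℝ (b i) y = 0) → inner ℝ (T y) y ≤ t j * ‖y‖ ^ 2 := by
  obtain ⟨t, b, hb, ht, hTb, hmax⟩ := exists_orthonormal_eigenvectors hc hs hpos hinf
  have hlim := tendsto_eigenvalue_zero_of_orthonormal hc hb hTb
  have hanti : Antitone t := fun i k hik => by
    have := hmax i (b k) fun j hj => hb.2 (by lia)
    rw [hTb, inner_smul_left, real_inner_self_eq_norm_sq, hb.1] at this
    simpa using this
  have hbot : (Submodule.span ℝ (Set.range b))ᗮ = ⊥ := by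
    rw [eq_bot_iff]
    intro y hy
    by_contra hy0
    have hle : ∀ k, inner ℝ (T y) y ≤ t k * ‖y‖ ^ 2 := fun k => hmax k y fun i _ =>
      hy _ (Submodule.subset_span ⟨i, rfl⟩)
    have := ge_of_tendsto' (hlim.mul_const _) hle
    linarith [hpos y hy0]
  refine ⟨t, HilbertBasis.mkOfOrthogonalEqBot hb hbot, ht, hanti, hlim, ?_⟩
  rw [HilbertBasis.coe_mkOfOrthogonalEqBot]
  exact ⟨hTb, hmax⟩

end CompactPositive

section CoerciveForm

variable {H : Type*} [NormedAddCommGroup H] [InnerProductSpace ℝ H]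
  {V : Type*} [NormedAddCommGroup V] [InnerProductSpace ℝ V]
  {J : V →L[ℝ] H} {a B : V →L[ℝ] V →L[ℝ] ℝ} {mu : ℕ → ℝ} {b : HilbertBasis ℕ ℝ H}

/-- The symmetric form `(v, w) ↦ ⟪J v, J w⟫`. -/
def innerForm (J : V →L[ℝ] H) : V →L[ℝ] V →L[ℝ] ℝ :=
  let inner : H →L[ℝ] H →L[ℝ] ℝ := innerSL ℝ
  inner.bilinearComp J J

theorem innerForm_apply (J : V →L[ℝ] H) (v w : V) : innerForm J v w = inner ℝ (J v) (J w) :=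
  rfl

/-- `mu` and `b` solve the eigenvalue problem `a(v, ·) = mu ⟪J v, J ·⟫` of the form `a` on `V`
relative to `J : V → H`: the eigenvalues increase to infinity, each `b j` is the image of an
eigenvector, and each `mu j` is a minimum of the Rayleigh quotient `a(v, v) / ‖J v‖²`. -/
structure IsFormSpectrum (J : V →L[ℝ] H) (a : V →L[ℝ] V →L[ℝ] ℝ) (mu : ℕ → ℝ)
    (b : HilbertBasis ℕ ℝ H) : Prop where
  monotone : Monotone mu
  tendsto_atTop : Tendsto mu atTop atTop
  exists_eigenvector : ∀ j, ∃ v, J v = b j ∧ ∀ w, a v w = mu j * inner ℝ (b j) (J w)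
  mul_norm_sq_le : ∀ j v, (∀ i < j, inner ℝ (b i) (J v) = 0) → mu j * ‖J v‖ ^ 2 ≤ a v v

theorem IsFormSpectrum.sub_const (c : ℝ)
    (h : IsFormSpectrum J (a + c • innerForm J) mu b) :
    IsFormSpectrum J a (fun j => mu j - c) b where
  monotone i j hij := sub_le_sub_right (h.monotone hij) c
  tendsto_atTop := tendsto_atTop_add_const_right _ _ h.tendsto_atTop
  exists_eigenvector j := by
    obtain ⟨v, hv, hw⟩ := h.exists_eigenvector j
    refine ⟨v, hv, fun w => ?_⟩
    have := hw w
    simp only [_root_.add_apply, _root_.smul_apply, innerForm_apply, smul_eq_mul, hv] at this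
    linarith
  mul_norm_sq_le j v hv := by
    have := h.mul_norm_sq_le j v hv
    simp only [_root_.add_apply, _root_.smul_apply, innerForm_apply, smul_eq_mul,
      real_inner_self_eq_norm_sq] at this
    linarith

theorem IsFormSpectrum.eigenvalue_le_of_linearIndependent (h : IsFormSpectrum J a mu b)
    {ι : Type*} [Fintype ι] {κ : ℝ} {v : ι → V} (hv : LinearIndependent ℝ (J ∘ v))
    (hq : ∀ s : ι → ℝ, a (∑ i, s i • v i) (∑ i, s i • v i) ≤ κ * ‖J (∑ i, s i • v i)‖ ^ 2)
    {j : ℕ} (hj : j < Fintype.card ι) : mu j ≤ κ := by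
  let L : (ι → ℝ) →ₗ[ℝ] (Fin j → ℝ) := LinearMap.pi fun i =>
    innerₗ H (b i) ∘ₗ J.toLinearMap ∘ₗ Fintype.linearCombination ℝ v
  obtain ⟨s, hs, hs0⟩ := Submodule.exists_mem_ne_zero_of_ne_bot
    (LinearMap.ker_ne_bot_of_finrank_lt (f := L) (by simpa using hj))
  have hJw : J (∑ i, s i • v i) ≠ 0 := fun h0 => hs0 <| funext <|
    Fintype.linearIndependent_iff.1 hv s (by simpa using h0)
  have horth : ∀ i < j, inner ℝ (b i) (J (∑ i, s i • v i)) = 0 := fun i hi => by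
    simpa [L, Fintype.linearCombination_apply, inner_sum, inner_smul_right] using
      congrFun (LinearMap.mem_ker.1 hs) ⟨i, hi⟩
  exact le_of_mul_le_mul_right ((h.mul_norm_sq_le j _ horth).trans (hq s)) (by positivity)

theorem IsFormSpectrum.eigenvalue_le_of_orthogonal (h : IsFormSpectrum J a mu b)
    {ι : Type*} [Fintype ι] {κ : ℝ} {v : ι → V} (hne : ∀ i, J (v i) ≠ 0)
    (horth : ∀ i j, i ≠ j → inner ℝ (J (v i)) (J (v j)) = 0)
    (hform : ∀ i j, i ≠ j → a (v i) (v j) = 0)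
    (hq : ∀ i, a (v i) (v i) ≤ κ * ‖J (v i)‖ ^ 2) {j : ℕ} (hj : j < Fintype.card ι) :
    mu j ≤ κ := by
  classical
  refine h.eigenvalue_le_of_linearIndependent
    (linearIndependent_of_ne_zero_of_inner_eq_zero (𝕜 := ℝ) hne horth) (fun s => ?_) hj
  have hdiag : ∀ B : V →L[ℝ] V →L[ℝ] ℝ, (∀ i j, i ≠ j → B (v i) (v j) = 0) →
      B (∑ i, s i • v i) (∑ i, s i • v i) = ∑ i, s i ^ 2 * B (v i) (v i) := fun B hB => by
    simp only [map_sum, map_smul, _root_.sum_apply, _root_.smul_apply, smul_eq_mul,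
      Finset.mul_sum]
    refine Finset.sum_congr rfl fun i _ => (Finset.sum_eq_single i (fun j _ hji => ?_) ?_).trans ?_
    · simp [hB _ _ hji]
    · simp
    · ring
  have hnorm := hdiag (innerForm J) horth
  simp only [innerForm_apply, real_inner_self_eq_norm_sq] at hnorm
  rw [hdiag a hform, hnorm, Finset.mul_sum]
  refine Finset.sum_le_sum fun i _ => ?_
  linarith [mul_le_mul_of_nonneg_left (hq i) (sq_nonneg (s i))]

theorem apply_self_pos_of_isCoercive (hB : IsCoercive B) {v : V} (hv : v ≠ 0) : 0 < B v v := by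
  obtain ⟨c, hc, h⟩ := hB
  have : 0 < ‖v‖ := norm_pos_iff.2 hv
  exact lt_of_lt_of_le (by positivity) (h v)

variable [CompleteSpace V] [CompleteSpace H]

/-- The solution operator `R : H → V` of `B(R y, w) = ⟪y, J w⟫` given by the Lax–Milgram theorem. -/
def formResolvent (hB : IsCoercive B) (J : V →L[ℝ] H) : H →L[ℝ] V :=
  hB.continuousLinearEquivOfBilin.symm.toContinuousLinearMap ∘L ContinuousLinearMap.adjoint J

theorem form_formResolvent_apply (hB : IsCoercive B) (y : H) (w : V) :
    B (formResolvent hB J y) w = inner ℝ y (J w) := by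
  rw [← hB.continuousLinearEquivOfBilin_apply]
  simp [formResolvent, ContinuousLinearMap.adjoint_inner_left]

theorem inner_comp_formResolvent (hB : IsCoercive B) (hsymm : ∀ v w, B v w = B w v) (y z : H) :
    inner ℝ ((J ∘L formResolvent hB J) y) z = B (formResolvent hB J y) (formResolvent hB J z) := by
  rw [hsymm, form_formResolvent_apply, real_inner_comm]
  rfl

theorem inner_comp_formResolvent_pos (hB : IsCoercive B) (hsymm : ∀ v w, B v w = B w v)
    (hJ : DenseRange J) {y : H} (hy : y ≠ 0) :
    0 < inner ℝ ((J ∘L formResolvent hB J) y) y := by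
  rw [inner_comp_formResolvent hB hsymm]
  refine apply_self_pos_of_isCoercive hB fun h0 => hy ?_
  refine hJ.eq_zero_of_inner_left ℝ fun w => ?_
  simp [← form_formResolvent_apply hB, h0]

-- Expand `0 ≤ B (v - t⁻¹ R J v, v - t⁻¹ R J v)`.
theorem norm_sq_le_mul_form (hB : IsCoercive B) (hsymm : ∀ v w, B v w = B w v) {t : ℝ} (ht : 0 < t)
    {v : V} (h : inner ℝ ((J ∘L formResolvent hB J) (J v)) (J v) ≤ t * ‖J v‖ ^ 2) :
    t⁻¹ * ‖J v‖ ^ 2 ≤ B v v := by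
  set r := formResolvent hB J (J v) with hr
  have hrv : B r v = ‖J v‖ ^ 2 := by
    rw [hr, form_formResolvent_apply, real_inner_self_eq_norm_sq]
  have hnonneg : 0 ≤ B (v - t⁻¹ • r) (v - t⁻¹ • r) := by
    obtain h0 | h0 := eq_or_ne (v - t⁻¹ • r) 0
    · simp [h0]
    · exact (apply_self_pos_of_isCoercive hB h0).le
  rw [inner_comp_formResolvent hB hsymm, ← hr, ← inv_mul_le_iff₀ ht] at h
  have hle := mul_le_mul_of_nonneg_left h (inv_pos.2 ht).le
  simp only [map_sub, map_smul, _root_.sub_apply, _root_.smul_apply, hsymm v r, hrv,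
    smul_eq_mul] at hnonneg
  linarith

theorem exists_isFormSpectrum_of_isCoercive (hinf : ¬ FiniteDimensional ℝ H)
    (hJc : IsCompactOperator J) (hJd : DenseRange J) (hB : IsCoercive B)
    (hsymm : ∀ v w, B v w = B w v) : ∃ mu b, IsFormSpectrum J B mu b := by
  set R := formResolvent hB J
  obtain ⟨t, b, ht, hanti, hlim, heig, hmax⟩ :=
    exists_hilbertBasis_eigenvectors (T := J ∘L R) (hJc.comp_clm R)
      (fun y z => by
        change inner ℝ ((J ∘L R) y) z = inner ℝ y ((J ∘L R) z)
        rw [inner_comp_formResolvent hB hsymm, hsymm, ← inner_comp_formResolvent hB hsymm,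
          real_inner_comm])
      (fun y hy => inner_comp_formResolvent_pos hB hsymm hJd hy) hinf
  refine ⟨fun j => (t j)⁻¹, b, fun i j hij => inv_anti₀ (ht j) (hanti hij), ?_, fun j => ?_,
    fun j v hv => norm_sq_le_mul_form hB hsymm (ht j) (hmax j (J v) hv)⟩
  · exact (tendsto_nhdsWithin_iff.2 ⟨hlim, Eventually.of_forall ht⟩).inv_tendsto_nhdsGT_zero
  · refine ⟨(t j)⁻¹ • R (b j), ?_, fun w => ?_⟩
    · rw [map_smul, ← ContinuousLinearMap.comp_apply, heig, smul_smul,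
        inv_mul_cancel₀ (ht j).ne', one_smul]
    · rw [map_smul, _root_.smul_apply, form_formResolvent_apply, smul_eq_mul]

theorem exists_isFormSpectrum (hinf : ¬ FiniteDimensional ℝ H) (hJc : IsCompactOperator J)
    (hJd : DenseRange J) (hsymm : ∀ v w, a v w = a w v) {lam c : ℝ} (hc : 0 < c)
    (hcoer : ∀ v, c * ‖v‖ ^ 2 ≤ a v v + lam * ‖J v‖ ^ 2) : ∃ mu b, IsFormSpectrum J a mu b := by
  obtain ⟨mu, b, h⟩ := exists_isFormSpectrum_of_isCoercive
    (B := a + lam • innerForm J) hinf hJc hJd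
    ⟨c, hc, fun v => by
      simpa [innerForm_apply, real_inner_self_eq_norm_sq, ← sq, mul_assoc] using hcoer v⟩
    fun v w => by simp [innerForm_apply, hsymm v w, real_inner_comm (J v)]
  exact ⟨_, b, h.sub_const lam⟩

end CoerciveForm

section CompactApproximation

variable {H : Type*} [NormedAddCommGroup H] [InnerProductSpace ℝ H]
  {V : Type*} [NormedAddCommGroup V] [NormedSpace ℝ V]

theorem isCompactOperator_of_approx [CompleteSpace H] (K : V →L[ℝ] H) {S : Set V} (hS : Dense S)
    (h : ∀ ε > 0, ∃ U : Submodule ℝ H, FiniteDimensional ℝ U ∧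
      ∀ v ∈ S, ∃ w ∈ U, ‖K v - w‖ ≤ ε * ‖v‖) : IsCompactOperator K := by
  have hclosed := isClosed_setOfPred_isCompactOperator (σ₁₂ := RingHom.id ℝ) (M₁ := V) (M₂ := H)
  refine hclosed.closure_subset (Metric.mem_closure_iff.2 fun ε hε => ?_)
  obtain ⟨U, hU, happrox⟩ := h (ε / 2) (by positivity)
  refine ⟨U.starProjection ∘L K, ?_, ?_⟩
  · exact ((isCompactOperator_of_locallyCompactSpace_dom
      U.orthogonalProjectionOnto).comp_clm K).clm_comp U.subtypeL
  · rw [dist_eq_norm]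
    refine lt_of_le_of_lt (ContinuousLinearMap.opNorm_le_bound _ (by positivity : 0 ≤ ε / 2) ?_)
      (half_lt_self hε)
    refine fun v => isClosed_property hS.denseRange_val
      (p := fun v => ‖(K - U.starProjection ∘L K) v‖ ≤ ε / 2 * ‖v‖)
      (isClosed_le (by fun_prop) (by fun_prop)) (fun ⟨v, hv⟩ => ?_) v
    obtain ⟨w, hw, hvw⟩ := happrox v hv
    calc ‖K v - U.starProjection (K v)‖ = ⨅ w : U, ‖K v - w‖ := U.starProjection_minimal (K v)
      _ ≤ ‖K v - w‖ := ciInf_le ⟨0, by rintro _ ⟨w, rfl⟩; positivity⟩ (⟨w, hw⟩ : U)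
      _ ≤ ε / 2 * ‖v‖ := hvw

variable {W : Type*} [SeminormedAddCommGroup W] [NormedSpace ℝ W]

theorem norm_sq_le_add_of_forall_norm_le_one (K : V →L[ℝ] H) (J : V →L[ℝ] W) {ε C : ℝ} (hε : 0 < ε)
    (h : ∀ v, ‖v‖ ≤ 1 → ‖K v‖ ^ 2 ≤ ε / 2 + C * ‖J v‖) (v : V) :
    ‖K v‖ ^ 2 ≤ ε * ‖v‖ ^ 2 + C ^ 2 / (2 * ε) * ‖J v‖ ^ 2 := by
  obtain rfl | hv := eq_or_ne v 0
  · simp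
  have : 0 < ‖v‖ := norm_pos_iff.2 hv
  have hscaled := h (‖v‖⁻¹ • v) (norm_smul_inv_norm (𝕜 := ℝ) hv).le
  rw [map_smul, map_smul, norm_smul, norm_smul, norm_inv, norm_norm, mul_pow, inv_pow,
    inv_mul_le_iff₀ (by positivity)] at hscaled
  calc ‖K v‖ ^ 2 ≤ ‖v‖ ^ 2 * (ε / 2 + C * (‖v‖⁻¹ * ‖J v‖)) := hscaled
    _ = ε * ‖v‖ ^ 2 + C ^ 2 / (2 * ε) * ‖J v‖ ^ 2 - (ε * ‖v‖ - C * ‖J v‖) ^ 2 / (2 * ε) := by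
      field_simp
      ring
    _ ≤ _ := sub_le_self _ (by positivity)

/-- Ehrling's inequality. The density hypothesis on `D` replaces the injectivity of the embedding
`J`: it says that `K v` is determined by `J v`. -/
theorem exists_norm_sq_le_add_of_isCompactOperator (K : V →L[ℝ] H) (hK : IsCompactOperator K)
    (J : V →L[ℝ] W) {D : Set H} (hD : Dense D)
    (h : ∀ φ ∈ D, ∃ C, ∀ v, |inner ℝ φ (K v)| ≤ C * ‖J v‖) {ε : ℝ} (hε : 0 < ε) :
    ∃ C, ∀ v, ‖K v‖ ^ 2 ≤ ε * ‖v‖ ^ 2 + C * ‖J v‖ ^ 2 := by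
  choose! C hC using h
  obtain ⟨δ, hδ0, hδK⟩ : ∃ δ > 0, δ * ‖K‖ ≤ ε / 4 := by
    refine ⟨ε / (4 * (‖K‖ + 1)), by positivity, ?_⟩
    rw [div_mul_eq_mul_div, div_le_div_iff₀ (by positivity) (by norm_num)]
    nlinarith [norm_nonneg K]
  obtain ⟨Z, hZ, hsub⟩ := hK.image_closedBall_subset_compact (f := K.toLinearMap) 1
  obtain ⟨t, -, ht, hcov⟩ := hZ.finite_cover_balls hδ0
  choose φ hφD hφ using fun y : H => hD.exists_dist_lt y hδ0
  obtain ⟨C₀, hC₀⟩ := (ht.image fun y => C (φ y)).bddAbove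
  refine ⟨_, norm_sq_le_add_of_forall_norm_le_one K J (C := C₀) hε fun v hv => ?_⟩
  obtain ⟨y, hy, hyv⟩ := Set.mem_iUnion₂.1 (hcov (hsub ⟨v, by simpa using hv, rfl⟩))
  have hKn : ‖K v‖ ≤ ‖K‖ := K.unit_le_opNorm v hv
  have hcenter : inner ℝ (K v - y) (K v) ≤ δ * ‖K‖ :=
    (real_inner_le_norm _ _).trans
      (mul_le_mul (mem_ball_iff_norm.1 hyv).le hKn (norm_nonneg _) hδ0.le)
  have happrox : inner ℝ (y - φ y) (K v) ≤ δ * ‖K‖ :=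
    (real_inner_le_norm _ _).trans
      (mul_le_mul (dist_eq_norm y (φ y) ▸ (hφ y).le) hKn (norm_nonneg _) hδ0.le)
  have htest : inner ℝ (φ y) (K v) ≤ C₀ * ‖J v‖ :=
    (le_abs_self _).trans <| (hC _ (hφD y) v).trans <|
      mul_le_mul_of_nonneg_right (hC₀ ⟨y, hy, rfl⟩) (norm_nonneg _)
  calc ‖K v‖ ^ 2
      = inner ℝ (K v - y) (K v) + inner ℝ (y - φ y) (K v) + inner ℝ (φ y) (K v) := by
        rw [← inner_add_left, ← inner_add_left, ← real_inner_self_eq_norm_sq]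
        congr 1
        abel
    _ ≤ ε / 2 + C₀ * ‖J v‖ := by linarith

end CompactApproximation

/-! ### Poincaré's inequality on convex sets and approximation by step functions -/

section Poincare

theorem sq_lintegral_le {α : Type*} [MeasurableSpace α] (μ : Measure α) {f : α → ENNReal}
    (hf : AEMeasurable f μ) : (∫⁻ x, f x ∂μ) ^ 2 ≤ μ Set.univ * ∫⁻ x, f x ^ 2 ∂μ := by
  have hHolder := ENNReal.lintegral_mul_le_Lp_mul_Lq μ Real.HolderConjugate.two_two
    (aemeasurable_const (b := (1 : ENNReal))) hf
  simp only [Pi.mul_apply, one_mul, ENNReal.one_rpow, lintegral_const] at hHolder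
  calc (∫⁻ x, f x ∂μ) ^ 2
      ≤ ((μ Set.univ) ^ (1 / 2 : ℝ) * (∫⁻ x, f x ^ (2 : ℝ) ∂μ) ^ (1 / 2 : ℝ)) ^ 2 := by gcongr
    _ = μ Set.univ * ∫⁻ x, f x ^ 2 ∂μ := by
      rw [mul_pow, ← ENNReal.rpow_natCast, ← ENNReal.rpow_natCast, ← ENNReal.rpow_mul,
        ← ENNReal.rpow_mul]
      simp

variable {E F : Type*} [NormedAddCommGroup E] [NormedSpace ℝ E]
  [NormedAddCommGroup F] [NormedSpace ℝ F] [CompleteSpace F]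

theorem integral_fderiv_segment {Ω : Set E} (hΩ : IsOpen Ω) {g : E → F} (hg : ContDiffOn ℝ 1 g Ω)
    {x y : E} (hseg : ∀ s ∈ Set.Icc (0 : ℝ) 1, y + s • (x - y) ∈ Ω) :
    ∫ s in (0 : ℝ)..1, fderiv ℝ g (y + s • (x - y)) (x - y) = g x - g y := by
  have hcont : ContinuousOn (fun s : ℝ => fderiv ℝ g (y + s • (x - y)) (x - y)) (Set.Icc 0 1) :=
    ((hg.continuousOn_fderiv_of_isOpen hΩ le_rfl).comp (by fun_prop) hseg).clm_apply
      continuousOn_const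
  rw [intervalIntegral.integral_eq_sub_of_hasDerivAt (f := fun s => g (y + s • (x - y)))]
  · simp
  · intro s hs
    rw [Set.uIcc_of_le zero_le_one] at hs
    have hgderiv : HasFDerivAt g (fderiv ℝ g (y + s • (x - y))) (y + s • (x - y)) :=
      ((hg.contDiffAt (hΩ.mem_nhds (hseg s hs))).differentiableAt one_ne_zero).hasFDerivAt
    have hline : HasDerivAt (fun s : ℝ => y + s • (x - y)) (x - y) s := by
      simpa using ((hasDerivAt_id s).smul_const (x - y)).const_add y
    exact hgderiv.comp_hasDerivAt s hline
  · exact ContinuousOn.intervalIntegrable (by rwa [Set.uIcc_of_le zero_le_one])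

variable [MeasurableSpace E] [BorelSpace E]

theorem enorm_sub_sq_le_lintegral_segment {Ω : Set E} (hΩ : IsOpen Ω) {g : E → F}
    (hg : ContDiffOn ℝ 1 g Ω) {x y : E}
    (hseg : ∀ s ∈ Set.Icc (0 : ℝ) 1, y + s • (x - y) ∈ Ω) :
    ‖g x - g y‖ₑ ^ 2 ≤
      ‖x - y‖ₑ ^ 2 * ∫⁻ s in Set.Icc (0 : ℝ) 1, ‖fderiv ℝ g (y + s • (x - y))‖ₑ ^ 2 := by
  have hmeas : Measurable fun s : ℝ => ‖fderiv ℝ g (y + s • (x - y))‖ₑ :=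
    ((measurable_fderiv ℝ g).comp (by fun_prop)).enorm
  rw [← integral_fderiv_segment hΩ hg hseg, intervalIntegral.integral_of_le zero_le_one,
    ← integral_Icc_eq_integral_Ioc]
  calc ‖∫ s in Set.Icc (0 : ℝ) 1, fderiv ℝ g (y + s • (x - y)) (x - y)‖ₑ ^ 2
      ≤ (∫⁻ s in Set.Icc (0 : ℝ) 1, ‖fderiv ℝ g (y + s • (x - y)) (x - y)‖ₑ) ^ 2 := by
        gcongr
        exact enorm_integral_le_lintegral_enorm _
    _ ≤ (∫⁻ s in Set.Icc (0 : ℝ) 1, ‖fderiv ℝ g (y + s • (x - y))‖ₑ * ‖x - y‖ₑ) ^ 2 := by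
        gcongr
        exact ContinuousLinearMap.le_opENorm _ _
    _ = ‖x - y‖ₑ ^ 2 * (∫⁻ s in Set.Icc (0 : ℝ) 1, ‖fderiv ℝ g (y + s • (x - y))‖ₑ) ^ 2 := by
        rw [lintegral_mul_const _ hmeas, mul_pow, mul_comm]
    _ ≤ _ := by
        gcongr
        exact (sq_lintegral_le _ hmeas.aemeasurable).trans (by simp)

variable [FiniteDimensional ℝ E] (μ : Measure E) [μ.IsAddHaarMeasure]

local notation "dim" => Module.finrank ℝ E

theorem lintegral_comp_add_smul {G : E → ENNReal} (hG : Measurable G) (c : E) {r : ℝ}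
    (hr : r ≠ 0) :
    ∫⁻ y, G (c + r • y) ∂μ = ENNReal.ofReal |(r ^ dim)⁻¹| * ∫⁻ y, G y ∂μ := by
  calc ∫⁻ y, G (c + r • y) ∂μ = ∫⁻ z, G (c + z) ∂(μ.map (r • ·)) := by
        rw [lintegral_map (by fun_prop) (by fun_prop)]
    _ = _ := by
        rw [Measure.map_addHaar_smul μ hr, lintegral_smul_measure, lintegral_add_left_eq_self,
          smul_eq_mul]

theorem setLIntegral_comp_add_smul_le {G : E → ENNReal} (hG : Measurable G) (Q : Set E) (c : E)
    {r : ℝ} (hr : 1 / 2 ≤ r) :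
    ∫⁻ y in Q, G (c + r • y) ∂μ ≤ 2 ^ dim * ∫⁻ z, G z ∂μ := by
  have hr0 : 0 < r := by linarith
  refine (lintegral_mono' Measure.restrict_le_self le_rfl).trans ?_
  rw [lintegral_comp_add_smul μ hG c hr0.ne', abs_of_nonneg (by positivity), ← inv_pow]
  gcongr
  have hinv : r⁻¹ ≤ 2 := by
    rw [inv_le_comm₀ hr0 two_pos]
    linarith
  calc ENNReal.ofReal (r⁻¹ ^ dim) ≤ ENNReal.ofReal (2 ^ dim) := by gcongr
    _ = 2 ^ dim := by rw [ENNReal.ofReal_pow two_pos.le, ENNReal.ofReal_ofNat]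

/-- One of the two weights `s`, `1 - s` is at least `1 / 2`; integrating first in the variable that
carries it costs at most the factor `2 ^ dim`. -/
theorem lintegral_convexCombination_le {G : E → ENNReal} (hG : Measurable G) (Q : Set E) (s : ℝ) :
    ∫⁻ x in Q, ∫⁻ y in Q, G (y + s • (x - y)) ∂μ ∂μ ≤ 2 ^ dim * μ Q * ∫⁻ z, G z ∂μ := by
  rcases le_total s (1 / 2) with h | h
  · have hcomb (x y : E) : y + s • (x - y) = s • x + (1 - s) • y := by module
    simp_rw [hcomb]
    calc ∫⁻ x in Q, ∫⁻ y in Q, G (s • x + (1 - s) • y) ∂μ ∂μ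
        ≤ ∫⁻ _ in Q, 2 ^ dim * ∫⁻ z, G z ∂μ ∂μ :=
          lintegral_mono fun x => setLIntegral_comp_add_smul_le μ hG Q _ (by linarith)
      _ = _ := by
          rw [setLIntegral_const]
          ring
  · have hcomb (x y : E) : y + s • (x - y) = (1 - s) • y + s • x := by module
    simp_rw [hcomb]
    calc ∫⁻ x in Q, ∫⁻ y in Q, G ((1 - s) • y + s • x) ∂μ ∂μ
        = ∫⁻ y in Q, ∫⁻ x in Q, G ((1 - s) • y + s • x) ∂μ ∂μ :=
          lintegral_lintegral_swap (hG.comp (by fun_prop)).aemeasurable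
      _ ≤ ∫⁻ _ in Q, 2 ^ dim * ∫⁻ z, G z ∂μ ∂μ :=
          lintegral_mono fun y => setLIntegral_comp_add_smul_le μ hG Q _ h
      _ = _ := by
          rw [setLIntegral_const]
          ring

theorem lintegral_lintegral_convexCombination_swap {G : E → ENNReal} (hG : Measurable G)
    (Q : Set E) :
    ∫⁻ x in Q, ∫⁻ y in Q, (∫⁻ s in Set.Icc (0 : ℝ) 1, G (y + s • (x - y))) ∂μ ∂μ =
      ∫⁻ s in Set.Icc (0 : ℝ) 1, (∫⁻ x in Q, ∫⁻ y in Q, G (y + s • (x - y)) ∂μ ∂μ) := by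
  calc ∫⁻ x in Q, ∫⁻ y in Q, (∫⁻ s in Set.Icc (0 : ℝ) 1, G (y + s • (x - y))) ∂μ ∂μ
      = ∫⁻ x in Q, (∫⁻ s in Set.Icc (0 : ℝ) 1, (∫⁻ y in Q, G (y + s • (x - y)) ∂μ)) ∂μ := by
        congr! 2 with x
        exact lintegral_lintegral_swap (hG.comp (by fun_prop)).aemeasurable
    _ = _ := by
        refine lintegral_lintegral_swap (Measurable.aemeasurable ?_)
        exact Measurable.lintegral_prod_right'
          (f := fun p : (E × ℝ) × E => G (p.2 + p.1.2 • (p.1.1 - p.2))) (hG.comp (by fun_prop))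

variable {Ω Q : Set E} {g : E → F} {d : ℝ}

theorem lintegral_lintegral_sub_sq_le (hΩ : IsOpen Ω) (hQ : Convex ℝ Q) (hQm : MeasurableSet Q)
    (hQΩ : Q ⊆ Ω) (hd : ∀ x ∈ Q, ∀ y ∈ Q, ‖x - y‖ ≤ d) (hg : ContDiffOn ℝ 1 g Ω) :
    ∫⁻ x in Q, ∫⁻ y in Q, ‖g x - g y‖ₑ ^ 2 ∂μ ∂μ ≤
      ENNReal.ofReal d ^ 2 * (2 ^ dim * μ Q * ∫⁻ z in Q, ‖fderiv ℝ g z‖ₑ ^ 2 ∂μ) := by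
  set G : E → ENNReal := Q.indicator (fun z => ‖fderiv ℝ g z‖ₑ ^ 2)
  have hG : Measurable G := ((measurable_fderiv ℝ g).enorm.pow_const 2).indicator hQm
  have hpair : ∀ x ∈ Q, ∀ y ∈ Q, ‖g x - g y‖ₑ ^ 2 ≤
      ENNReal.ofReal d ^ 2 * ∫⁻ s in Set.Icc (0 : ℝ) 1, G (y + s • (x - y)) := by
    intro x hx y hy
    have hseg (s) (hs : s ∈ Set.Icc (0 : ℝ) 1) : y + s • (x - y) ∈ Q :=
      hQ.add_smul_sub_mem hy hx hs
    refine (enorm_sub_sq_le_lintegral_segment hΩ hg fun s hs => hQΩ (hseg s hs)).trans ?_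
    rw [setLIntegral_congr_fun measurableSet_Icc fun s hs =>
      (Set.indicator_of_mem (hseg s hs) _ : G (y + s • (x - y)) = _), ← ofReal_norm]
    gcongr
    exact hd x hx y hy
  have hd2 : ENNReal.ofReal d ^ 2 ≠ ⊤ := ENNReal.pow_ne_top ENNReal.ofReal_ne_top
  calc ∫⁻ x in Q, ∫⁻ y in Q, ‖g x - g y‖ₑ ^ 2 ∂μ ∂μ
      ≤ ∫⁻ x in Q, ∫⁻ y in Q, ENNReal.ofReal d ^ 2 *
          (∫⁻ s in Set.Icc (0 : ℝ) 1, G (y + s • (x - y))) ∂μ ∂μ :=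
        setLIntegral_mono' hQm fun x hx => setLIntegral_mono' hQm fun y hy => hpair x hx y hy
    _ = ENNReal.ofReal d ^ 2 * ∫⁻ s in Set.Icc (0 : ℝ) 1, (∫⁻ x in Q, ∫⁻ y in Q,
          G (y + s • (x - y)) ∂μ ∂μ) := by
        simp_rw [lintegral_const_mul' _ _ hd2, lintegral_lintegral_convexCombination_swap μ hG]
    _ ≤ ENNReal.ofReal d ^ 2 * ∫⁻ _ in Set.Icc (0 : ℝ) 1, (2 ^ dim * μ Q * ∫⁻ z, G z ∂μ) := by
        gcongr with s
        exact lintegral_convexCombination_le μ hG Q s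
    _ = _ := by simp [G, lintegral_indicator hQm]

/-- The constant is a value of `g` rather than its mean: the double integral of `|g x - g y|²`
is controlled, so some `y` does at least as well as the average. -/
theorem exists_lintegral_sub_sq_le (hΩ : IsOpen Ω) (hQ : Convex ℝ Q) (hQm : MeasurableSet Q)
    (hQΩ : Q ⊆ Ω) (hQfin : μ Q ≠ ⊤) (hd : ∀ x ∈ Q, ∀ y ∈ Q, ‖x - y‖ ≤ d)
    (hg : ContDiffOn ℝ 1 g Ω) :
    ∃ c, ∫⁻ x in Q, ‖g x - c‖ₑ ^ 2 ∂μ ≤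
      ENNReal.ofReal d ^ 2 * 2 ^ dim * ∫⁻ z in Q, ‖fderiv ℝ g z‖ₑ ^ 2 ∂μ := by
  by_cases h0 : μ Q = 0
  · exact ⟨0, by simp [Measure.restrict_eq_zero.2 h0]⟩
  have hcont : ContinuousOn (fun p : E × E => ‖g p.1 - g p.2‖ₑ ^ 2) (Q ×ˢ Q) := by
    have hgQ : ContinuousOn g Q := hg.continuousOn.mono hQΩ
    exact (ENNReal.continuous_pow 2).comp_continuousOn
      ((hgQ.comp continuousOn_fst fun _ hp => hp.1).sub
        (hgQ.comp continuousOn_snd fun _ hp => hp.2)).enorm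
  have hmeas : AEMeasurable (fun y => ∫⁻ x in Q, ‖g y - g x‖ₑ ^ 2 ∂μ) (μ.restrict Q) := by
    refine AEMeasurable.lintegral_prod_right' (f := fun p : E × E => ‖g p.1 - g p.2‖ₑ ^ 2) ?_
    rw [Measure.prod_restrict]
    exact hcont.aemeasurable (hQm.prod hQm)
  obtain ⟨y, -, hle⟩ := exists_le_setLAverage h0 hQfin hmeas
  refine ⟨g y, ?_⟩
  simp_rw [fun x => enorm_sub_rev (g x) (g y)]
  refine hle.trans ?_
  rw [setLAverage_eq]
  refine ENNReal.div_le_of_le_mul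
    ((lintegral_lintegral_sub_sq_le μ hΩ hQ hQm hQΩ hd hg).trans (le_of_eq ?_))
  ring

end Poincare

section StepFunctions

theorem enorm_Lp_two_sq {α E : Type*} [MeasurableSpace α] [NormedAddCommGroup E] {μ : Measure α}
    (f : Lp E 2 μ) : ‖f‖ₑ ^ 2 = ∫⁻ x, ‖f x‖ₑ ^ 2 ∂μ := by
  rw [Lp.enorm_def, eLpNorm_eq_lintegral_rpow_enorm_toReal (by norm_num) (by norm_num),
    ← ENNReal.rpow_natCast, ← ENNReal.rpow_mul]
  simp

theorem enorm_sub_sum_indicatorConstLp_sq {α ι : Type*} [MeasurableSpace α] {μ : Measure α}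
    {t : Finset ι} {Q : ι → Set α} (hQm : ∀ z, MeasurableSet (Q z)) (hQfin : ∀ z, μ (Q z) ≠ ⊤)
    (hdisj : Pairwise (Function.onFun Disjoint Q)) (hcover : ∀ᵐ x ∂μ, x ∈ ⋃ z ∈ t, Q z)
    {f : Lp ℝ 2 μ} {g : α → ℝ} (hf : f =ᵐ[μ] g) (c : ι → ℝ) :
    ‖f - ∑ z ∈ t, c z • indicatorConstLp 2 (hQm z) (hQfin z) (1 : ℝ)‖ₑ ^ 2 =
      ∑ z ∈ t, ∫⁻ x in Q z, ‖g x - c z‖ₑ ^ 2 ∂μ := by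
  set e : ι → Lp ℝ 2 μ := fun z => indicatorConstLp 2 (hQm z) (hQfin z) 1
  have he : ∀ᵐ x ∂μ, ∀ z ∈ t, e z x = (Q z).indicator (fun _ => (1 : ℝ)) x :=
    (Finset.eventually_all t).2 fun z _ => indicatorConstLp_coeFn
  have hce : ∀ᵐ x ∂μ, ∀ z ∈ t, (c z • e z : Lp ℝ 2 μ) x = c z * e z x :=
    (Finset.eventually_all t).2 fun z _ => Lp.coeFn_smul _ _
  have hval : ∀ᵐ x ∂μ, ∀ z ∈ t, x ∈ Q z → (f - ∑ z ∈ t, c z • e z) x = g x - c z := by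
    filter_upwards [he, hce, hf, Lp.coeFn_sub f (∑ z ∈ t, c z • e z),
      Lp.coeFn_finsetSum t fun z => c z • e z] with x he hce hf hsub hsum z hz hx
    rw [hsub, Pi.sub_apply, hf, hsum, Finset.sum_apply, Finset.sum_eq_single z]
    · rw [hce z hz, he z hz, Set.indicator_of_mem hx, mul_one]
    · intro z' hz' hne
      rw [hce z' hz', he z' hz', Set.indicator_of_notMem, mul_zero]
      exact fun hx' => (hdisj hne).ne_of_mem hx' hx rfl
    · exact fun hz' => absurd hz hz'
  calc ‖f - ∑ z ∈ t, c z • e z‖ₑ ^ 2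
      = ∫⁻ x in ⋃ z ∈ t, Q z, ‖(f - ∑ z ∈ t, c z • e z) x‖ₑ ^ 2 ∂μ := by
        rw [enorm_Lp_two_sq, Measure.restrict_eq_self_of_ae_mem hcover]
    _ = ∑ z ∈ t, ∫⁻ x in Q z, ‖(f - ∑ z ∈ t, c z • e z) x‖ₑ ^ 2 ∂μ :=
        lintegral_biUnion_finset (hdisj.set_pairwise _) (fun z _ => hQm z) _
    _ = _ := Finset.sum_congr rfl fun z hz => setLIntegral_congr_fun_ae (hQm z) <| by
        filter_upwards [hval] with x hx hxz
        rw [hx z hz hxz]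

variable {ι : Type*} {Ω : Set (ι → ℝ)} {r : ℝ}

/-- The cells into which the cubical grid of mesh `r` with vertices in `r ℤⁿ` divides `Ω`. -/
def gridCell (Ω : Set (ι → ℝ)) (r : ℝ) (z : ι → ℤ) : Set (ι → ℝ) :=
  {x ∈ Ω | ∀ i, ⌊x i / r⌋ = z i}

theorem gridCell_subset (z : ι → ℤ) : gridCell Ω r z ⊆ Ω := fun _ hx => hx.1

theorem pairwise_disjoint_gridCell : Pairwise (Function.onFun Disjoint (gridCell Ω r)) :=
  fun _ _ hne => Set.disjoint_left.2 fun _ hx hx' =>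
    hne (funext fun i => (hx.2 i).symm.trans (hx'.2 i))

theorem gridCell_eq (hr : 0 < r) (z : ι → ℤ) :
    gridCell Ω r z = Ω ∩ Set.univ.pi fun i => Set.Ico (z i * r) ((z i + 1) * r) := by
  ext x
  simp only [gridCell, Set.mem_ofPred_eq, Set.mem_inter_iff, Set.mem_univ_pi, Set.mem_Ico]
  refine and_congr_right fun _ => forall_congr' fun i => ?_
  rw [Int.floor_eq_iff, le_div_iff₀ hr, div_lt_iff₀ hr]

theorem convex_gridCell (hΩ : Convex ℝ Ω) (hr : 0 < r) (z : ι → ℤ) :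
    Convex ℝ (gridCell Ω r z) := by
  rw [gridCell_eq hr]
  exact hΩ.inter (convex_pi fun i _ => convex_Ico _ _)

theorem measurableSet_gridCell [Countable ι] (hΩ : MeasurableSet Ω) (hr : 0 < r) (z : ι → ℤ) :
    MeasurableSet (gridCell Ω r z) := by
  rw [gridCell_eq hr]
  exact hΩ.inter (MeasurableSet.univ_pi fun i => measurableSet_Ico)

theorem norm_sub_le_of_mem_gridCell [Fintype ι] (hr : 0 < r) {z : ι → ℤ} {x y : ι → ℝ}
    (hx : x ∈ gridCell Ω r z) (hy : y ∈ gridCell Ω r z) : ‖x - y‖ ≤ r := by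
  rw [gridCell_eq hr] at hx hy
  refine (pi_norm_le_iff_of_nonneg hr.le).2 fun i => ?_
  obtain ⟨hxl, hxu⟩ := hx.2 i (Set.mem_univ i)
  obtain ⟨hyl, hyu⟩ := hy.2 i (Set.mem_univ i)
  rw [Pi.sub_apply, Real.norm_eq_abs, abs_le]
  constructor <;> linarith

theorem exists_finset_gridCell_cover [Finite ι] (hΩ : Bornology.IsBounded Ω) (hr : 0 < r) :
    ∃ t : Finset (ι → ℤ), Ω = ⋃ z ∈ t, gridCell Ω r z := by
  classical
  have := Fintype.ofFinite ι
  obtain ⟨R, hR⟩ := hΩ.exists_norm_le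
  refine ⟨Fintype.piFinset fun _ => Finset.Icc ⌊-R / r⌋ ⌊R / r⌋, subset_antisymm (fun x hx => ?_)
    (Set.iUnion₂_subset fun z _ => gridCell_subset z)⟩
  refine Set.mem_biUnion (x := fun i => ⌊x i / r⌋) (Fintype.mem_piFinset.2 fun i => ?_)
    ⟨hx, fun i => rfl⟩
  obtain ⟨hl, hu⟩ := abs_le.1 ((norm_le_pi_norm x i).trans (hR x hx))
  exact Finset.mem_Icc.2 ⟨Int.floor_le_floor (by gcongr), Int.floor_le_floor (by gcongr)⟩

theorem exists_mesh (n : ℕ) {ε : ℝ} (hε : 0 < ε) :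
    ∃ r > 0, ENNReal.ofReal r ^ 2 * 2 ^ n ≤ ENNReal.ofReal ε ^ 2 := by
  refine ⟨ε / 2 ^ n, by positivity, ?_⟩
  have hpow : (1 : ℝ) ≤ 2 ^ n := one_le_pow₀ one_le_two
  calc ENNReal.ofReal (ε / 2 ^ n) ^ 2 * 2 ^ n
      = ENNReal.ofReal ((ε / 2 ^ n) ^ 2 * 2 ^ n) := by
        rw [ENNReal.ofReal_mul (by positivity), ENNReal.ofReal_pow (by positivity),
          ENNReal.ofReal_pow two_pos.le, ENNReal.ofReal_ofNat]
    _ = ENNReal.ofReal (ε ^ 2 / 2 ^ n) := by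
        congr 1
        field_simp
    _ ≤ ENNReal.ofReal (ε ^ 2) := ENNReal.ofReal_le_ofReal (div_le_self (sq_nonneg ε) hpow)
    _ = ENNReal.ofReal ε ^ 2 := ENNReal.ofReal_pow hε.le 2

/-- The approximants are the step functions on a sufficiently fine grid. -/
theorem exists_finiteDimensional_approx [Fintype ι] (hΩ : IsOpen Ω) (hconv : Convex ℝ Ω)
    (hb : Bornology.IsBounded Ω) {μ : Measure (ι → ℝ)} (hμ : μ ≤ volume.restrict Ω) {ε : ℝ}
    (hε : 0 < ε) :
    ∃ U : Submodule ℝ (Lp ℝ 2 μ), FiniteDimensional ℝ U ∧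
      ∀ g : (ι → ℝ) → ℝ, ContDiffOn ℝ 1 g Ω → ∀ f : Lp ℝ 2 μ, f =ᵐ[μ] g →
        ∃ w ∈ U, ‖f - w‖ₑ ^ 2 ≤ ENNReal.ofReal ε ^ 2 * ∫⁻ x in Ω, ‖fderiv ℝ g x‖ₑ ^ 2 := by
  obtain ⟨r, hr, hrε⟩ := exists_mesh (Module.finrank ℝ (ι → ℝ)) hε
  obtain ⟨t, ht⟩ := exists_finset_gridCell_cover hb hr
  have hQm (z) : MeasurableSet (gridCell Ω r z) := measurableSet_gridCell hΩ.measurableSet hr z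
  have hvol (z) : volume (gridCell Ω r z) ≠ ⊤ := (hb.subset (gridCell_subset z)).measure_lt_top.ne
  have hμ' : μ ≤ volume := hμ.trans Measure.restrict_le_self
  have hQfin (z) : μ (gridCell Ω r z) ≠ ⊤ := ne_top_of_le_ne_top (hvol z) (hμ' _)
  have hcover : ∀ᵐ x ∂μ, x ∈ ⋃ z ∈ t, gridCell Ω r z := by
    rw [← ht]
    exact Measure.absolutelyContinuous_of_le hμ (ae_restrict_mem hΩ.measurableSet)
  let e : (ι → ℤ) → Lp ℝ 2 μ := fun z => indicatorConstLp 2 (hQm z) (hQfin z) 1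
  refine ⟨Submodule.span ℝ (e '' t), FiniteDimensional.span_of_finite ℝ (t.finite_toSet.image e),
    fun g hg f hf => ?_⟩
  choose c hc using fun z => exists_lintegral_sub_sq_le volume hΩ (convex_gridCell hconv hr z)
    (hQm z) (gridCell_subset z) (hvol z)
    (fun x hx y hy => norm_sub_le_of_mem_gridCell hr hx hy) hg
  refine ⟨∑ z ∈ t, c z • e z, Submodule.sum_mem _ fun z hz =>
    Submodule.smul_mem _ _ (Submodule.subset_span ⟨z, hz, rfl⟩), ?_⟩
  calc ‖f - ∑ z ∈ t, c z • e z‖ₑ ^ 2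
      = ∑ z ∈ t, ∫⁻ x in gridCell Ω r z, ‖g x - c z‖ₑ ^ 2 ∂μ :=
        enorm_sub_sum_indicatorConstLp_sq hQm hQfin pairwise_disjoint_gridCell hcover hf c
    _ ≤ ∑ z ∈ t, ENNReal.ofReal ε ^ 2 * ∫⁻ x in gridCell Ω r z, ‖fderiv ℝ g x‖ₑ ^ 2 := by
        gcongr with z
        calc ∫⁻ x in gridCell Ω r z, ‖g x - c z‖ₑ ^ 2 ∂μ
            ≤ ∫⁻ x in gridCell Ω r z, ‖g x - c z‖ₑ ^ 2 :=
              lintegral_mono' (Measure.restrict_mono_measure hμ' _) le_rfl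
          _ ≤ _ := (hc z).trans (by gcongr)
    _ = ENNReal.ofReal ε ^ 2 * ∫⁻ x in Ω, ‖fderiv ℝ g x‖ₑ ^ 2 := by
        rw [← Finset.mul_sum, ← lintegral_biUnion_finset
          (pairwise_disjoint_gridCell.set_pairwise _) (fun z _ => hQm z), ← ht]

end StepFunctions

/-! ### Curvature of the hyperbolic metric -/

section Curvature

theorem pd_congr {n : ℕ} {i : Fin n} {f g : (Fin n → ℝ) → ℝ} {x : Fin n → ℝ} (h : f =ᶠ[𝓝 x] g) :
    pd i f x = pd i g x := by
  rw [pd, pd, h.fderiv_eq]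

theorem pd_comp_apply {n : ℕ} {i k : Fin n} {f : ℝ → ℝ} {f' : ℝ} {x : Fin n → ℝ}
    (h : HasDerivAt f f' (x k)) :
    pd i (fun y => f (y k)) x = (1 : Matrix (Fin n) (Fin n) ℝ) i k * f' := by
  have hcomp := h.comp_hasFDerivAt x (hasFDerivAt_apply (𝕜 := ℝ) k x)
  rw [pd, show (fun y : Fin n → ℝ => f (y k)) = f ∘ (fun y => y k) from rfl, hcomp.fderiv]
  simp [Matrix.one_apply, Pi.single_apply, mul_comm, eq_comm]

variable {n : ℕ} [NeZero n]

local notation "δ" => (1 : Matrix (Fin n) (Fin n) ℝ)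

theorem hyperbolicMetric_inv {x : Fin n → ℝ} (hx : x 0 ≠ 0) :
    (hyperbolicMetric n x)⁻¹ = (x 0) ^ 2 • δ := by
  apply Matrix.inv_eq_right_inv
  rw [hyperbolicMetric, Matrix.smul_mul, Matrix.one_mul, smul_smul, inv_mul_cancel₀ (by positivity),
    one_smul]

theorem pd_hyperbolicMetric {x : Fin n → ℝ} (hx : x 0 ≠ 0) (i j l : Fin n) :
    pd i (fun y => hyperbolicMetric n y j l) x = -2 * (x 0)⁻¹ ^ 3 * (δ i 0 * δ j l) := by
  have hpow : HasDerivAt (fun t : ℝ => t ^ 2) (2 * x 0) (x 0) := by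
    simpa using hasDerivAt_pow 2 (x 0)
  have hderiv : HasDerivAt (fun t : ℝ => (t ^ 2)⁻¹ * δ j l)
      (-(2 * x 0) / (x 0 ^ 2) ^ 2 * δ j l) (x 0) :=
    (hpow.fun_inv (by positivity)).mul_const _
  calc pd i (fun y => hyperbolicMetric n y j l) x = δ i 0 * (-(2 * x 0) / (x 0 ^ 2) ^ 2 * δ j l) :=
        pd_comp_apply hderiv
    _ = _ := by field_simp

/-- The constants `c^k_ij` in the Christoffel symbols `Γ^k_ij = -c^k_ij / x₀` of the hyperbolic
metric. -/
def christoffelCoeff (k i j : Fin n) : ℝ :=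
  δ j 0 * δ k i + δ i 0 * δ k j - δ k 0 * δ i j

theorem christoffel_hyperbolicMetric {x : Fin n → ℝ} (hx : x 0 ≠ 0) (k i j : Fin n) :
    christoffel (hyperbolicMetric n) k i j x = -(x 0)⁻¹ * christoffelCoeff k i j := by
  have hcontract (v : Fin n → ℝ) : ∑ l, (x 0 ^ 2 • δ) k l * v l = x 0 ^ 2 * v k := by
    simp [Matrix.one_apply]
  have hsymm (i : Fin n) : δ k i = δ i k := by simp [Matrix.one_apply, eq_comm]
  rw [christoffel, hyperbolicMetric_inv hx, hcontract, pd_hyperbolicMetric hx,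
    pd_hyperbolicMetric hx, pd_hyperbolicMetric hx, christoffelCoeff, hsymm i, hsymm j]
  field_simp
  ring

theorem pd_christoffel_hyperbolicMetric {x : Fin n → ℝ} (hx : x 0 ≠ 0) (l k i j : Fin n) :
    pd l (christoffel (hyperbolicMetric n) k i j) x =
      (x 0 ^ 2)⁻¹ * (δ l 0 * christoffelCoeff k i j) := by
  have hev : christoffel (hyperbolicMetric n) k i j =ᶠ[𝓝 x]
      fun y => -(y 0)⁻¹ * christoffelCoeff k i j := by
    filter_upwards [(continuous_apply (0 : Fin n)).continuousAt.eventually_ne hx] with y hy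
    exact christoffel_hyperbolicMetric hy k i j
  rw [pd_congr hev, pd_comp_apply (((hasDerivAt_inv hx).fun_neg).mul_const _)]
  ring

theorem sum_christoffelCoeff_mul (v : Fin n → ℝ) (i j : Fin n) :
    ∑ k, christoffelCoeff k i j * v k = δ j 0 * v i + δ i 0 * v j - δ i j * v 0 := by
  simp [christoffelCoeff, Matrix.one_apply, sub_mul, add_mul, Finset.sum_add_distrib,
    Finset.sum_sub_distrib]

theorem sum_christoffelCoeff_contract_left (l : Fin n) :
    ∑ k, christoffelCoeff k k l = n * δ l 0 := by
  simp [christoffelCoeff, Matrix.one_apply]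

theorem sum_christoffelCoeff_contract_right (i : Fin n) :
    ∑ k, christoffelCoeff k i k = n * δ i 0 := by
  simp [christoffelCoeff, Matrix.one_apply, Finset.sum_add_distrib, Finset.sum_sub_distrib]

theorem sum_christoffelCoeff_mul_christoffelCoeff (i j : Fin n) :
    ∑ k, ∑ l, christoffelCoeff k j l * christoffelCoeff l i k =
      (n + 2) * (δ i 0 * δ j 0) - 2 * δ i j := by
  simp only [christoffelCoeff, Matrix.one_apply, mul_ite, mul_one, mul_zero, mul_sub, mul_add,
    Finset.sum_sub_distrib, Finset.sum_add_distrib, Finset.sum_ite_eq', Finset.mem_univ, ↓reduceIte,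
    Finset.sum_ite_irrel, Finset.sum_const_zero, Finset.sum_const, Finset.card_univ,
    Fintype.card_fin, nsmul_eq_mul, Finset.sum_ite_eq, add_sub_cancel_left]
  grind

theorem ricci_hyperbolicMetric {x : Fin n → ℝ} (hx : x 0 ≠ 0) :
    ricci (hyperbolicMetric n) x = -((n : ℝ) - 1) • hyperbolicMetric n x := by
  ext i j
  have hdiv : ∑ k, δ k 0 * christoffelCoeff k i j = 2 * (δ i 0 * δ j 0) - δ i j := by
    rw [Finset.sum_congr rfl fun k _ => mul_comm _ _, sum_christoffelCoeff_mul, Matrix.one_apply_eq]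
    ring
  calc ricci (hyperbolicMetric n) x i j
      = (x 0 ^ 2)⁻¹ * (∑ k, δ k 0 * christoffelCoeff k i j -
          δ j 0 * ∑ k, christoffelCoeff k i k +
          (∑ l, (∑ k, christoffelCoeff k k l) * christoffelCoeff l i j -
            ∑ k, ∑ l, christoffelCoeff k j l * christoffelCoeff l i k)) := by
        simp_rw [Finset.sum_mul]
        rw [Finset.sum_comm (f := fun l k => christoffelCoeff k k l * christoffelCoeff l i j)]
        simp only [ricci, Matrix.of_apply, pd_christoffel_hyperbolicMetric hx,
          christoffel_hyperbolicMetric hx, Finset.mul_sum, ← Finset.sum_sub_distrib, mul_add,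
          mul_sub, ← Finset.sum_add_distrib]
        refine Finset.sum_congr rfl fun k _ => congrArg₂ _ rfl (Finset.sum_congr rfl fun l _ => ?_)
        field_simp
    _ = (-((n : ℝ) - 1) • hyperbolicMetric n x) i j := by
        simp_rw [sum_christoffelCoeff_contract_left, sum_christoffelCoeff_contract_right,
          mul_assoc, ← Finset.mul_sum, hdiv, sum_christoffelCoeff_mul_christoffelCoeff,
          hyperbolicMetric, Matrix.smul_apply, smul_eq_mul]
        ring

theorem covInner_hyperbolicMetric {x : Fin n → ℝ} (hx : x 0 ≠ 0) (p q : Fin n → ℝ) :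
    covInner (hyperbolicMetric n x) p q = ∑ i, (x 0 * p i) * (x 0 * q i) := by
  rw [covInner, hyperbolicMetric_inv hx, Matrix.smul_mulVec, Matrix.one_mulVec]
  simp only [dotProduct, Pi.smul_apply, smul_eq_mul]
  exact Finset.sum_congr rfl fun i _ => by ring

theorem tensorInner_hyperbolicMetric {x : Fin n → ℝ} (hx : x 0 ≠ 0)
    (h k : Matrix (Fin n) (Fin n) ℝ) :
    tensorInner (hyperbolicMetric n x) h k =
      ∑ ij : Fin n × Fin n, (x 0 ^ 2 * h ij.1 ij.2) * (x 0 ^ 2 * k ij.1 ij.2) := by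
  rw [tensorInner, hyperbolicMetric_inv hx, Fintype.sum_prod_type]
  refine Finset.sum_congr rfl fun i _ => Finset.sum_congr rfl fun j _ => ?_
  simp only [Matrix.smul_apply, Matrix.one_apply, smul_eq_mul, mul_ite, mul_one, mul_zero, ite_mul,
    zero_mul, Finset.sum_ite_eq, Finset.mem_univ, if_true]
  ring

theorem evalSharp_ricci_hyperbolicMetric {x : Fin n → ℝ} (hx : x 0 ≠ 0) (p q : Fin n → ℝ) :
    evalSharp (hyperbolicMetric n x) (ricci (hyperbolicMetric n) x) p q =
      -((n : ℝ) - 1) * ∑ i, (x 0 * p i) * (x 0 * q i) := by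
  rw [evalSharp, hyperbolicMetric_inv hx, ricci_hyperbolicMetric hx, hyperbolicMetric]
  simp only [Matrix.smul_mulVec, Matrix.one_mulVec, dotProduct, Pi.smul_apply, smul_eq_mul]
  rw [Finset.mul_sum]
  refine Finset.sum_congr rfl fun i _ => ?_
  field_simp

theorem hessian_hyperbolicMetric {x : Fin n → ℝ} (hx : x 0 ≠ 0) (f : (Fin n → ℝ) → ℝ)
    (i j : Fin n) :
    hessian (hyperbolicMetric n) f x i j = pd i (pd j f) x + (x 0)⁻¹ *
      (δ j 0 * pd i f x + δ i 0 * pd j f x - δ i j * pd 0 f x) := by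
  simp only [hessian, Matrix.of_apply, christoffel_hyperbolicMetric hx, mul_assoc,
    ← Finset.mul_sum, sum_christoffelCoeff_mul fun k => pd k f x]
  ring

theorem sqrt_det_hyperbolicMetric {x : Fin n → ℝ} (hx : 0 < x 0) :
    Real.sqrt (hyperbolicMetric n x).det = ((x 0) ^ n)⁻¹ := by
  rw [hyperbolicMetric, Matrix.det_smul, Matrix.det_one, mul_one, Fintype.card_fin, inv_pow,
    ← pow_mul, mul_comm 2 n, pow_mul, Real.sqrt_inv, Real.sqrt_sq (by positivity)]

end Curvature

/-! ### The Sobolev space as a Hilbert space of jets -/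

section Jets

variable {n : ℕ}

theorem contDiffOn_pd {f : (Fin n → ℝ) → ℝ} {U : Set (Fin n → ℝ)} (hU : IsOpen U)
    (hf : ContDiffOn ℝ ∞ f U) (i : Fin n) : ContDiffOn ℝ ∞ (pd i f) U :=
  (hf.fderiv_of_isOpen hU (by simp)).clm_apply contDiffOn_const

theorem differentiableAt_of_contDiffOn {f : (Fin n → ℝ) → ℝ} {U : Set (Fin n → ℝ)}
    (hU : IsOpen U) (hf : ContDiffOn ℝ ∞ f U) {x : Fin n → ℝ} (hx : x ∈ U) :
    DifferentiableAt ℝ f x :=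
  (hf.contDiffAt (hU.mem_nhds hx)).differentiableAt (by simp)

theorem pd_add {f g : (Fin n → ℝ) → ℝ} {x : Fin n → ℝ} (hf : DifferentiableAt ℝ f x)
    (hg : DifferentiableAt ℝ g x) (i : Fin n) :
    pd i (fun y => f y + g y) x = pd i f x + pd i g x := by
  rw [pd, fderiv_fun_add hf hg]; rfl

theorem pd_const_mul {f : (Fin n → ℝ) → ℝ} {x : Fin n → ℝ} (hf : DifferentiableAt ℝ f x) (c : ℝ)
    (i : Fin n) : pd i (fun y => c * f y) x = c * pd i f x := by
  rw [pd, fderiv_const_mul hf]; rfl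

theorem pd_pd_add {f g : (Fin n → ℝ) → ℝ} {U : Set (Fin n → ℝ)} (hU : IsOpen U)
    (hf : ContDiffOn ℝ ∞ f U) (hg : ContDiffOn ℝ ∞ g U) {x : Fin n → ℝ} (hx : x ∈ U)
    (i j : Fin n) : pd i (pd j fun y => f y + g y) x = pd i (pd j f) x + pd i (pd j g) x := by
  rw [pd_congr (g := fun y => pd j f y + pd j g y),
    pd_add (differentiableAt_of_contDiffOn hU (contDiffOn_pd hU hf j) hx)
      (differentiableAt_of_contDiffOn hU (contDiffOn_pd hU hg j) hx)]
  filter_upwards [hU.mem_nhds hx] with y hy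
  exact pd_add (differentiableAt_of_contDiffOn hU hf hy) (differentiableAt_of_contDiffOn hU hg hy) j

theorem pd_pd_const_mul {f : (Fin n → ℝ) → ℝ} {U : Set (Fin n → ℝ)} (hU : IsOpen U)
    (hf : ContDiffOn ℝ ∞ f U) (c : ℝ) {x : Fin n → ℝ} (hx : x ∈ U) (i j : Fin n) :
    pd i (pd j fun y => c * f y) x = c * pd i (pd j f) x := by
  rw [pd_congr (g := fun y => c * pd j f y),
    pd_const_mul (differentiableAt_of_contDiffOn hU (contDiffOn_pd hU hf j) hx)]
  filter_upwards [hU.mem_nhds hx] with y hy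
  exact pd_const_mul (differentiableAt_of_contDiffOn hU hf hy) c j

variable [NeZero n] {Ω : Set (Fin n → ℝ)} {K : ℝ}

/-- A nonempty bounded convex open set of the half-space model contained in the horizontal strip
`1 < x₀ < K`. There the hyperbolic metric is comparable with the Euclidean one, and convexity gives
a Poincaré inequality. -/
structure IsStripDomain (Ω : Set (Fin n → ℝ)) (K : ℝ) : Prop where
  isOpen : IsOpen Ω
  convex : Convex ℝ Ω
  isBounded : Bornology.IsBounded Ω
  nonempty : Ω.Nonempty
  one_lt : ∀ x ∈ Ω, 1 < x 0
  lt : ∀ x ∈ Ω, x 0 < K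

/-- The hyperbolic volume on `Ω`. -/
abbrev hypMeasure (Ω : Set (Fin n → ℝ)) : Measure (Fin n → ℝ) :=
  (riemVolume (hyperbolicMetric n)).restrict Ω

theorem hypMeasure_eq_withDensity (hΩ : MeasurableSet Ω) (hpos : ∀ x ∈ Ω, 0 < x 0) :
    hypMeasure Ω = (volume.restrict Ω).withDensity fun x => ENNReal.ofReal ((x 0 ^ n)⁻¹) := by
  rw [hypMeasure, riemVolume, restrict_withDensity hΩ]
  refine withDensity_congr_ae ?_
  filter_upwards [ae_restrict_mem hΩ] with x hx
  rw [sqrt_det_hyperbolicMetric (hpos x hx)]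

theorem integral_hypMeasure (hΩ : MeasurableSet Ω) (hpos : ∀ x ∈ Ω, 0 < x 0)
    (f : (Fin n → ℝ) → ℝ) :
    ∫ x, f x ∂(hypMeasure Ω) = ∫ x in Ω, (x 0 ^ n)⁻¹ * f x := by
  rw [hypMeasure_eq_withDensity hΩ hpos,
    integral_withDensity_eq_integral_toReal_smul (by fun_prop) (by simp)]
  refine setIntegral_congr_fun hΩ fun x hx => ?_
  have := hpos x hx
  rw [ENNReal.toReal_ofReal (by positivity), smul_eq_mul]

namespace IsStripDomain

theorem pos (h : IsStripDomain Ω K) : ∀ x ∈ Ω, 0 < x 0 :=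
  fun x hx => one_pos.trans (h.one_lt x hx)

theorem bound_pos (h : IsStripDomain Ω K) : 0 < K := by
  obtain ⟨x, hx⟩ := h.nonempty
  exact (h.pos x hx).trans (h.lt x hx)

theorem hypMeasure_le (h : IsStripDomain Ω K) : hypMeasure Ω ≤ volume.restrict Ω := by
  rw [hypMeasure_eq_withDensity h.isOpen.measurableSet h.pos]
  calc _ ≤ (volume.restrict Ω).withDensity 1 := by
        refine withDensity_mono ?_
        filter_upwards [ae_restrict_mem h.isOpen.measurableSet] with x hx
        rw [Pi.one_apply, ENNReal.ofReal_le_one]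
        exact inv_le_one_of_one_le₀ (one_le_pow₀ (h.one_lt x hx).le)
    _ = _ := withDensity_one

theorem lintegral_le (h : IsStripDomain Ω K) (f : (Fin n → ℝ) → ENNReal) :
    ∫⁻ x in Ω, f x ≤ ENNReal.ofReal (K ^ n) * ∫⁻ x, f x ∂(hypMeasure Ω) := by
  rw [hypMeasure_eq_withDensity h.isOpen.measurableSet h.pos,
    lintegral_withDensity_eq_lintegral_mul_non_measurable _ (by fun_prop) (by simp),
    ← lintegral_const_mul' _ _ ENNReal.ofReal_ne_top]
  refine setLIntegral_mono' h.isOpen.measurableSet fun x hx => ?_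
  have hx0 := h.pos x hx
  have hxK := h.lt x hx
  have hK := h.bound_pos
  rw [Pi.mul_apply, ← mul_assoc, ← ENNReal.ofReal_mul (by positivity)]
  refine le_mul_of_one_le_left (by positivity) ?_
  rw [ENNReal.one_le_ofReal, ← div_eq_mul_inv, one_le_div (by positivity)]
  gcongr

theorem ae_mem (h : IsStripDomain Ω K) : ∀ᵐ x ∂(hypMeasure Ω), x ∈ Ω :=
  ae_restrict_mem h.isOpen.measurableSet

theorem isFiniteMeasure (h : IsStripDomain Ω K) : IsFiniteMeasure (hypMeasure Ω) :=
  ⟨(h.hypMeasure_le _).trans_lt (by simpa using h.isBounded.measure_lt_top)⟩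

end IsStripDomain

/-- Indices of the components of a second order jet: the value, the first and the second
derivatives. -/
abbrev JetIndex (n : ℕ) : Type := Unit ⊕ Fin n ⊕ Fin n × Fin n

/-- The components of the jet `(u, p, h)` in the orthonormal frame `x₀ ∂_i`, so that the hyperbolic
norm of a jet is the Euclidean norm of its components. -/
def jetComp (u : (Fin n → ℝ) → ℝ) (p : (Fin n → ℝ) → Fin n → ℝ)
    (h : (Fin n → ℝ) → Matrix (Fin n) (Fin n) ℝ) : JetIndex n → (Fin n → ℝ) → ℝ
  | .inl _ => u
  | .inr (.inl i) => fun x => x 0 * p x i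
  | .inr (.inr ij) => fun x => x 0 ^ 2 * h x ij.1 ij.2

/-- The components of the second order jet `(f, df, D²f)` of a function. -/
def jetOf (f : (Fin n → ℝ) → ℝ) : JetIndex n → (Fin n → ℝ) → ℝ :=
  jetComp f (differential f) (hessian (hyperbolicMetric n) f)

/-- Square integrable second order jets on `Ω`. -/
abbrev JetSpace (Ω : Set (Fin n → ℝ)) : Type :=
  PiLp 2 fun _ : JetIndex n => Lp ℝ 2 (hypMeasure Ω)

theorem jetComp_sub (u u' : (Fin n → ℝ) → ℝ) (p p' : (Fin n → ℝ) → Fin n → ℝ)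
    (h h' : (Fin n → ℝ) → Matrix (Fin n) (Fin n) ℝ) (a : JetIndex n) (x : Fin n → ℝ) :
    jetComp (fun x => u x - u' x) (fun x => p x - p' x) (fun x => h x - h' x) a x =
      jetComp u p h a x - jetComp u' p' h' a x := by
  rcases a with _ | i | ij
  · rfl
  · simp [jetComp, mul_sub]
  · simp [jetComp, mul_sub]

theorem sum_jetComp_mul {x : Fin n → ℝ} (hx : x 0 ≠ 0) (u u' : (Fin n → ℝ) → ℝ)
    (p p' : (Fin n → ℝ) → Fin n → ℝ) (h h' : (Fin n → ℝ) → Matrix (Fin n) (Fin n) ℝ) :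
    tensorInner (hyperbolicMetric n x) (h x) (h' x) +
        covInner (hyperbolicMetric n x) (p x) (p' x) + u x * u' x =
      ∑ a, jetComp u p h a x * jetComp u' p' h' a x := by
  rw [tensorInner_hyperbolicMetric hx, covInner_hyperbolicMetric hx, Fintype.sum_sum_type,
    Fintype.sum_sum_type]
  simp only [jetComp, Finset.univ_unique, Finset.sum_singleton]
  ring

theorem continuousOn_jetOf {f : (Fin n → ℝ) → ℝ} {U : Set (Fin n → ℝ)} (hU : IsOpen U)
    (hpos : ∀ x ∈ U, 0 < x 0) (hf : ContDiffOn ℝ ∞ f U) (a : JetIndex n) :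
    ContinuousOn (jetOf f a) U := by
  have hcoord : ContinuousOn (fun x : Fin n → ℝ => x 0) U := (continuous_apply 0).continuousOn
  have hpd : ∀ i, ContinuousOn (pd i f) U := fun i => (contDiffOn_pd hU hf i).continuousOn
  rcases a with _ | i | ⟨i, j⟩
  · exact hf.continuousOn
  · exact hcoord.mul (hpd i)
  · have hpd2 : ContinuousOn (pd i (pd j f)) U :=
      (contDiffOn_pd hU (contDiffOn_pd hU hf j) i).continuousOn
    refine (hcoord.pow 2).mul (ContinuousOn.congr ?_ fun x hx =>
      hessian_hyperbolicMetric (hpos x hx).ne' f i j)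
    exact hpd2.add ((hcoord.inv₀ fun x hx => (hpos x hx).ne').mul
      (((continuousOn_const.mul (hpd i)).add (continuousOn_const.mul (hpd j))).sub
        (continuousOn_const.mul (hpd 0))))

theorem jetOf_add {f g : (Fin n → ℝ) → ℝ} {U : Set (Fin n → ℝ)} (hU : IsOpen U)
    (hpos : ∀ x ∈ U, 0 < x 0) (hf : ContDiffOn ℝ ∞ f U) (hg : ContDiffOn ℝ ∞ g U)
    {x : Fin n → ℝ} (hx : x ∈ U) (a : JetIndex n) :
    jetOf (fun y => f y + g y) a x = jetOf f a x + jetOf g a x := by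
  have hpd := pd_add (differentiableAt_of_contDiffOn hU hf hx)
    (differentiableAt_of_contDiffOn hU hg hx)
  rcases a with _ | i | ⟨i, j⟩
  · rfl
  · simp only [jetOf, jetComp, differential, hpd, mul_add]
  · simp only [jetOf, jetComp, hessian_hyperbolicMetric (hpos x hx).ne', hpd,
      pd_pd_add hU hf hg hx]
    ring

theorem jetOf_const_mul {f : (Fin n → ℝ) → ℝ} {U : Set (Fin n → ℝ)} (hU : IsOpen U)
    (hpos : ∀ x ∈ U, 0 < x 0) (hf : ContDiffOn ℝ ∞ f U) (c : ℝ)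
    {x : Fin n → ℝ} (hx : x ∈ U) (a : JetIndex n) :
    jetOf (fun y => c * f y) a x = c * jetOf f a x := by
  have hpd := pd_const_mul (differentiableAt_of_contDiffOn hU hf hx) c
  rcases a with _ | i | ⟨i, j⟩
  · rfl
  · simp only [jetOf, jetComp, differential, hpd]
    ring
  · simp only [jetOf, jetComp, hessian_hyperbolicMetric (hpos x hx).ne', hpd,
      pd_pd_const_mul hU hf c hx]
    ring

/-- The square integrable jets of smooth functions on `Ω`. -/
def smoothJets (hΩ : IsStripDomain Ω K) : Submodule ℝ (JetSpace Ω) where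
  carrier := {F | ∃ f, ContDiffOn ℝ ∞ f Ω ∧ ∀ a, F a =ᵐ[hypMeasure Ω] jetOf f a}
  zero_mem' := by
    refine ⟨fun _ => 0 * 0, contDiffOn_const, fun a => ?_⟩
    filter_upwards [Lp.coeFn_zero ℝ 2 (hypMeasure Ω), hΩ.ae_mem] with x hzero hx
    rw [jetOf_const_mul hΩ.isOpen hΩ.pos contDiffOn_const 0 hx, PiLp.zero_apply, hzero, zero_mul,
      Pi.zero_apply]
  add_mem' := by
    rintro F G ⟨f, hf, hF⟩ ⟨g, hg, hG⟩
    refine ⟨fun x => f x + g x, hf.add hg, fun a => ?_⟩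
    filter_upwards [Lp.coeFn_add (F a) (G a), hΩ.ae_mem, hF a, hG a] with x hadd hx hFx hGx
    rw [jetOf_add hΩ.isOpen hΩ.pos hf hg hx, PiLp.add_apply, hadd, Pi.add_apply, hFx, hGx]
  smul_mem' := by
    rintro c F ⟨f, hf, hF⟩
    refine ⟨fun x => c * f x, contDiffOn_const.mul hf, fun a => ?_⟩
    filter_upwards [Lp.coeFn_smul c (F a), hΩ.ae_mem, hF a] with x hsmul hx hFx
    rw [jetOf_const_mul hΩ.isOpen hΩ.pos hf c hx, PiLp.smul_apply, hsmul, Pi.smul_apply, hFx,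
      smul_eq_mul]

/-- The Sobolev space `H²(Ω)`, realised as the closure of the smooth jets: an element is the triple
`(u, ∇u, D²u)`, read in the frame `x₀ ∂_i`. -/
def sobolevH2 (hΩ : IsStripDomain Ω K) : Submodule ℝ (JetSpace Ω) :=
  (smoothJets hΩ).topologicalClosure

theorem isClosed_sobolevH2 (hΩ : IsStripDomain Ω K) :
    IsClosed (sobolevH2 hΩ : Set (JetSpace Ω)) :=
  Submodule.isClosed_topologicalClosure _

theorem dense_smoothJets (hΩ : IsStripDomain Ω K) :
    Dense {v : sobolevH2 hΩ | (v : JetSpace Ω) ∈ smoothJets hΩ} := by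
  rw [Topology.IsInducing.subtypeVal.dense_iff]
  rintro ⟨v, hv⟩
  refine closure_mono (fun w (hw : w ∈ smoothJets hΩ) => ?_) hv
  exact ⟨⟨w, Submodule.le_topologicalClosure _ hw⟩, hw, rfl⟩

theorem h2Energy_eq_lintegral (hΩ : IsStripDomain Ω K) (u : (Fin n → ℝ) → ℝ)
    (p : (Fin n → ℝ) → Fin n → ℝ) (h : (Fin n → ℝ) → Matrix (Fin n) (Fin n) ℝ) :
    h2Energy (hyperbolicMetric n) Ω u p h =
      ∫⁻ x, ∑ a, ‖jetComp u p h a x‖ₑ ^ 2 ∂(hypMeasure Ω) := by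
  rw [h2Energy]
  refine lintegral_congr_ae ?_
  filter_upwards [hΩ.ae_mem] with x hx
  rw [sq (u x), sum_jetComp_mul (hΩ.pos x hx).ne',
    ENNReal.ofReal_sum_of_nonneg fun a _ => mul_self_nonneg _]
  refine Finset.sum_congr rfl fun a _ => ?_
  rw [← sq, ← sq_abs, ENNReal.ofReal_pow (abs_nonneg _), ← Real.norm_eq_abs, ofReal_norm]

variable {u : (Fin n → ℝ) → ℝ} {p : (Fin n → ℝ) → Fin n → ℝ}
  {h : (Fin n → ℝ) → Matrix (Fin n) (Fin n) ℝ}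

theorem h2Energy_eq_sum (hΩ : IsStripDomain Ω K)
    (hm : ∀ a, AEStronglyMeasurable (jetComp u p h a) (hypMeasure Ω)) :
    h2Energy (hyperbolicMetric n) Ω u p h =
      ∑ a, ∫⁻ x, ‖jetComp u p h a x‖ₑ ^ 2 ∂(hypMeasure Ω) := by
  rw [h2Energy_eq_lintegral hΩ, lintegral_finsetSum' _ fun a _ => (hm a).enorm.pow_const 2]

theorem h2Energy_eq_norm_sq (hΩ : IsStripDomain Ω K) {F : JetSpace Ω}
    (hF : ∀ a, F a =ᵐ[hypMeasure Ω] jetComp u p h a) :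
    h2Energy (hyperbolicMetric n) Ω u p h = ENNReal.ofReal (‖F‖ ^ 2) := by
  rw [h2Energy_eq_sum hΩ fun a => (Lp.aestronglyMeasurable (F a)).congr (hF a),
    PiLp.norm_sq_eq_of_L2, ENNReal.ofReal_sum_of_nonneg fun a _ => by positivity]
  refine Finset.sum_congr rfl fun a _ => ?_
  rw [ENNReal.ofReal_pow (norm_nonneg _), ofReal_norm, enorm_Lp_two_sq]
  refine lintegral_congr_ae ?_
  filter_upwards [hF a] with x hx
  rw [hx]

theorem tendsto_h2Energy_sub_iff (hΩ : IsStripDomain Ω K) {f : ℕ → (Fin n → ℝ) → ℝ}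
    {F : JetSpace Ω} {G : ℕ → JetSpace Ω} (hF : ∀ a, F a =ᵐ[hypMeasure Ω] jetComp u p h a)
    (hG : ∀ k a, G k a =ᵐ[hypMeasure Ω] jetOf (f k) a) :
    Tendsto (fun k => h2Energy (hyperbolicMetric n) Ω (fun x => u x - f k x)
        (fun x => p x - differential (f k) x)
        (fun x => h x - hessian (hyperbolicMetric n) (f k) x)) atTop (𝓝 0) ↔
      Tendsto G atTop (𝓝 F) := by
  have henergy : ∀ k, h2Energy (hyperbolicMetric n) Ω (fun x => u x - f k x)
      (fun x => p x - differential (f k) x)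
      (fun x => h x - hessian (hyperbolicMetric n) (f k) x) = ENNReal.ofReal (‖F - G k‖ ^ 2) :=
    fun k => h2Energy_eq_norm_sq hΩ fun a => by
      filter_upwards [Lp.coeFn_sub (F a) (G k a), hF a, hG k a] with x hsub hFx hGx
      rw [PiLp.sub_apply, hsub, Pi.sub_apply, hFx, hGx, jetComp_sub, jetOf]
  rw [tendsto_iff_norm_sub_tendsto_zero]
  simp_rw [henergy, norm_sub_rev F]
  refine ⟨fun hlim => ?_, fun hlim => by simpa using ENNReal.tendsto_ofReal (hlim.pow 2)⟩
  have hsq : Tendsto (fun k => ‖G k - F‖ ^ 2) atTop (𝓝 0) := by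
    simpa [Function.comp_def] using (ENNReal.tendsto_toReal ENNReal.zero_ne_top).comp hlim
  simpa [Real.sqrt_sq (norm_nonneg _)] using hsq.sqrt

theorem exists_jet_of_h2Energy_lt_top (hΩ : IsStripDomain Ω K)
    (hm : ∀ a, AEStronglyMeasurable (jetComp u p h a) (hypMeasure Ω))
    (hfin : h2Energy (hyperbolicMetric n) Ω u p h < ⊤) :
    ∃ F : JetSpace Ω, ∀ a, F a =ᵐ[hypMeasure Ω] jetComp u p h a := by
  rw [h2Energy_eq_sum hΩ hm, ENNReal.sum_lt_top] at hfin
  have hmem : ∀ a, MemLp (jetComp u p h a) 2 (hypMeasure Ω) := fun a => by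
    refine ⟨hm a, ?_⟩
    rw [eLpNorm_lt_top_iff_lintegral_rpow_enorm_lt_top (by norm_num) (by norm_num)]
    simpa using hfin a (Finset.mem_univ a)
  exact ⟨WithLp.toLp 2 fun a => (hmem a).toLp _, fun a => (hmem a).coeFn_toLp⟩

theorem aestronglyMeasurable_jetComp (hu : AEStronglyMeasurable u (hypMeasure Ω))
    (hp : AEStronglyMeasurable p (hypMeasure Ω)) (hh : AEStronglyMeasurable h (hypMeasure Ω))
    (a : JetIndex n) : AEStronglyMeasurable (jetComp u p h a) (hypMeasure Ω) := by
  have hcoord : AEStronglyMeasurable (fun x : Fin n → ℝ => x 0) (hypMeasure Ω) :=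
    (continuous_apply (0 : Fin n)).aestronglyMeasurable
  rcases a with _ | i | ⟨i, j⟩
  · exact hu
  · exact hcoord.mul ((continuous_apply i).comp_aestronglyMeasurable hp)
  · exact (hcoord.pow 2).mul ((continuous_id.matrix_elem i j).comp_aestronglyMeasurable hh)

theorem aestronglyMeasurable_jetOf (hΩ : IsStripDomain Ω K) {f : (Fin n → ℝ) → ℝ}
    (hf : ContDiffOn ℝ ∞ f Ω) (a : JetIndex n) :
    AEStronglyMeasurable (jetOf f a) (hypMeasure Ω) :=
  (continuousOn_jetOf hΩ.isOpen hΩ.pos hf a).aestronglyMeasurable hΩ.isOpen.measurableSet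

theorem exists_jet_of_h2Energy_sub_lt_top (hΩ : IsStripDomain Ω K) {f : (Fin n → ℝ) → ℝ}
    {G : JetSpace Ω} (hG : ∀ a, G a =ᵐ[hypMeasure Ω] jetOf f a)
    (hm : ∀ a, AEStronglyMeasurable (jetComp u p h a) (hypMeasure Ω))
    (hfin : h2Energy (hyperbolicMetric n) Ω (fun x => u x - f x)
      (fun x => p x - differential f x) (fun x => h x - hessian (hyperbolicMetric n) f x) < ⊤) :
    ∃ F : JetSpace Ω, ∀ a, F a =ᵐ[hypMeasure Ω] jetComp u p h a := by
  obtain ⟨D, hD⟩ := exists_jet_of_h2Energy_lt_top hΩ (fun a =>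
    ((hm a).sub ((Lp.aestronglyMeasurable (G a)).congr (hG a))).congr
      (Eventually.of_forall fun x => (jetComp_sub _ _ _ _ _ _ a x).symm)) hfin
  refine ⟨D + G, fun a => ?_⟩
  filter_upwards [Lp.coeFn_add (D a) (G a), hD a, hG a] with x hadd hDx hGx
  rw [PiLp.add_apply, hadd, Pi.add_apply, hDx, hGx, jetComp_sub, jetOf, sub_add_cancel]

theorem exists_mem_sobolevH2_of_memH2 (hΩ : IsStripDomain Ω K)
    (hu : MemH2 (hyperbolicMetric n) Ω u p h) :
    ∃ F ∈ sobolevH2 hΩ, ∀ a, F a =ᵐ[hypMeasure Ω] jetComp u p h a := by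
  obtain ⟨hum, hpm, hhm, f, hf, hlim⟩ := hu
  choose G hG using fun k => exists_jet_of_h2Energy_lt_top hΩ
    (aestronglyMeasurable_jetOf hΩ (hf k).1) (hf k).2
  obtain ⟨k, hk⟩ := (hlim.eventually_lt_const ENNReal.zero_lt_top).exists
  obtain ⟨F, hF⟩ := exists_jet_of_h2Energy_sub_lt_top hΩ (hG k)
    (aestronglyMeasurable_jetComp hum hpm hhm) hk
  exact ⟨F, mem_closure_of_tendsto ((tendsto_h2Energy_sub_iff hΩ hF hG).1 hlim)
    (Eventually.of_forall fun k => ⟨f k, (hf k).1, hG k⟩), hF⟩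

theorem memH2_of_forall_ae_eq_jetComp (hΩ : IsStripDomain Ω K) {F : JetSpace Ω}
    (hF : F ∈ sobolevH2 hΩ) (hp : AEStronglyMeasurable p (hypMeasure Ω))
    (hh : AEStronglyMeasurable h (hypMeasure Ω))
    (hFc : ∀ a, F a =ᵐ[hypMeasure Ω] jetComp u p h a) :
    MemH2 (hyperbolicMetric n) Ω u p h := by
  obtain ⟨G, hGs, hG⟩ := mem_closure_iff_seq_limit.1 hF
  choose f hf hGf using hGs
  refine ⟨(Lp.aestronglyMeasurable (F (.inl ()))).congr (hFc (.inl ())), hp, hh, f,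
    fun k => ⟨hf k, ?_⟩, (tendsto_h2Energy_sub_iff hΩ hFc hGf).2 hG⟩
  rw [h2Energy_eq_norm_sq hΩ (F := G k) (hGf k)]
  exact ENNReal.ofReal_lt_top

theorem exists_memH2_of_mem_sobolevH2 (hΩ : IsStripDomain Ω K) {F : JetSpace Ω}
    (hF : F ∈ sobolevH2 hΩ) (hu : F (.inl ()) =ᵐ[hypMeasure Ω] u) :
    ∃ p h, MemH2 (hyperbolicMetric n) Ω u p h ∧
      ∀ a, F a =ᵐ[hypMeasure Ω] jetComp u p h a := by
  let p : (Fin n → ℝ) → Fin n → ℝ := fun x i => (x 0)⁻¹ * F (.inr (.inl i)) x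
  let h : (Fin n → ℝ) → Matrix (Fin n) (Fin n) ℝ :=
    fun x => Matrix.of fun i j => (x 0 ^ 2)⁻¹ * F (.inr (.inr (i, j))) x
  have hFc : ∀ a, F a =ᵐ[hypMeasure Ω] jetComp u p h a := by
    rintro (_ | i | ⟨i, j⟩)
    · exact hu
    · filter_upwards [hΩ.ae_mem] with x hx
      exact (mul_inv_cancel_left₀ (hΩ.pos x hx).ne' _).symm
    · filter_upwards [hΩ.ae_mem] with x hx
      exact (mul_inv_cancel_left₀ (pow_pos (hΩ.pos x hx) 2).ne' _).symm
  have hpm : AEMeasurable p (hypMeasure Ω) := aemeasurable_pi_lambda _ fun i =>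
    (show Measurable fun x : Fin n → ℝ => (x 0)⁻¹ by fun_prop).aemeasurable.mul
      (Lp.aestronglyMeasurable _).aemeasurable
  have hhm : AEMeasurable (fun x i j => h x i j) (hypMeasure Ω) :=
    aemeasurable_pi_lambda _ fun i => aemeasurable_pi_lambda _ fun j =>
      (show Measurable fun x : Fin n → ℝ => (x 0 ^ 2)⁻¹ by fun_prop).aemeasurable.mul
        (Lp.aestronglyMeasurable _).aemeasurable
  exact ⟨p, h, memH2_of_forall_ae_eq_jetComp hΩ hF hpm.aestronglyMeasurable
    hhm.aestronglyMeasurable hFc, hFc⟩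

end Jets

/-! ### The Neumann form on `H²(Ω)` -/

section Form

theorem inner_eq_integral_of_ae_eq {α : Type*} [MeasurableSpace α] {μ : Measure α} {F G : Lp ℝ 2 μ}
    {f g : α → ℝ} (hF : F =ᵐ[μ] f) (hG : G =ᵐ[μ] g) :
    inner ℝ F G = ∫ x, f x * g x ∂μ := by
  rw [L2.inner_def]
  refine integral_congr_ae ?_
  filter_upwards [hF, hG] with x hFx hGx
  rw [hFx, hGx, RCLike.inner_apply, conj_trivial, mul_comm]

theorem integrable_mul_of_ae_eq {α : Type*} [MeasurableSpace α] {μ : Measure α} {F G : Lp ℝ 2 μ}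
    {f g : α → ℝ} (hF : F =ᵐ[μ] f) (hG : G =ᵐ[μ] g) :
    Integrable (fun x => f x * g x) μ :=
  ((memLp_congr_ae hF).1 (Lp.memLp F)).integrable_mul ((memLp_congr_ae hG).1 (Lp.memLp G))

variable {n : ℕ} [NeZero n] {Ω : Set (Fin n → ℝ)} {K : ℝ}

/-- The component of index `a` of a jet in `H²(Ω)`; for `a = .inl ()` this is the embedding of
`H²(Ω)` into `L²(Ω)`. -/
def jetProj (hΩ : IsStripDomain Ω K) (a : JetIndex n) :
    sobolevH2 hΩ →L[ℝ] Lp ℝ 2 (hypMeasure Ω) :=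
  (PiLp.proj 2 (𝕜 := ℝ) (fun _ : JetIndex n => Lp ℝ 2 (hypMeasure Ω)) a) ∘L (sobolevH2 hΩ).subtypeL

/-- The form `∫ ⟨D²u, D²φ⟩ + Ric(∇u, ∇φ)` on `H²(Ω)`, where `Ric = -(n - 1) g`. -/
def neumannForm (hΩ : IsStripDomain Ω K) : sobolevH2 hΩ →L[ℝ] sobolevH2 hΩ →L[ℝ] ℝ :=
  let I : Lp ℝ 2 (hypMeasure Ω) →L[ℝ] Lp ℝ 2 (hypMeasure Ω) →L[ℝ] ℝ := innerSL ℝ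
  (∑ ij, I.bilinearComp (jetProj hΩ (.inr (.inr ij))) (jetProj hΩ (.inr (.inr ij)))) -
    ((n : ℝ) - 1) • ∑ i, I.bilinearComp (jetProj hΩ (.inr (.inl i))) (jetProj hΩ (.inr (.inl i)))

theorem neumannForm_apply (hΩ : IsStripDomain Ω K) (v w : sobolevH2 hΩ) :
    neumannForm hΩ v w =
      ∑ ij, inner ℝ (jetProj hΩ (.inr (.inr ij)) v) (jetProj hΩ (.inr (.inr ij)) w) -
        ((n : ℝ) - 1) *
          ∑ i, inner ℝ (jetProj hΩ (.inr (.inl i)) v) (jetProj hΩ (.inr (.inl i)) w) := by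
  simp only [neumannForm, _root_.sub_apply, _root_.smul_apply, _root_.sum_apply, smul_eq_mul]
  rfl

theorem neumannForm_symm (hΩ : IsStripDomain Ω K) (v w : sobolevH2 hΩ) :
    neumannForm hΩ v w = neumannForm hΩ w v := by
  simp only [neumannForm_apply, real_inner_comm]

theorem neumannForm_eq_integral (hΩ : IsStripDomain Ω K) {v w : sobolevH2 hΩ}
    {u u' : (Fin n → ℝ) → ℝ} {p p' : (Fin n → ℝ) → Fin n → ℝ}
    {h h' : (Fin n → ℝ) → Matrix (Fin n) (Fin n) ℝ}
    (hv : ∀ a, (v : JetSpace Ω) a =ᵐ[hypMeasure Ω] jetComp u p h a)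
    (hw : ∀ a, (w : JetSpace Ω) a =ᵐ[hypMeasure Ω] jetComp u' p' h' a) :
    neumannForm hΩ v w = ∫ x in Ω, (tensorInner (hyperbolicMetric n x) (h x) (h' x) +
      evalSharp (hyperbolicMetric n x) (ricci (hyperbolicMetric n) x) (p x) (p' x))
        ∂(riemVolume (hyperbolicMetric n)) := by
  have hint : ∀ a, Integrable (fun x => jetComp u p h a x * jetComp u' p' h' a x) (hypMeasure Ω) :=
    fun a => integrable_mul_of_ae_eq (hv a) (hw a)
  have hinner : ∀ a, inner ℝ (jetProj hΩ a v) (jetProj hΩ a w) =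
      ∫ x, jetComp u p h a x * jetComp u' p' h' a x ∂(hypMeasure Ω) := fun a =>
    inner_eq_integral_of_ae_eq (hv a) (hw a)
  rw [neumannForm_apply]
  simp_rw [hinner]
  rw [← integral_finsetSum _ fun a _ => hint _, ← integral_finsetSum _ fun a _ => hint _,
    ← integral_const_mul, ← integral_sub (integrable_finsetSum _ fun a _ => hint _)
      ((integrable_finsetSum _ fun a _ => hint _).const_mul _)]
  refine setIntegral_congr_fun hΩ.isOpen.measurableSet fun x hx => ?_
  have hx0 := (hΩ.pos x hx).ne'
  simp only [tensorInner_hyperbolicMetric hx0, evalSharp_ricci_hyperbolicMetric hx0, jetComp]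
  ring

theorem norm_fderiv_le_sum_abs_pd {n : ℕ} (g : (Fin n → ℝ) → ℝ) (x : Fin n → ℝ) :
    ‖fderiv ℝ g x‖ ≤ ∑ j, |pd j g x| := by
  refine ContinuousLinearMap.opNorm_le_bound _ (by positivity) fun v => ?_
  have hv : fderiv ℝ g x v = ∑ j, v j * pd j g x := by
    conv_lhs => rw [pi_eq_sum_univ' v]
    simp [pd]
  rw [hv, Finset.sum_mul]
  refine (norm_sum_le _ _).trans (Finset.sum_le_sum fun j _ => ?_)
  rw [norm_mul, mul_comm]
  exact mul_le_mul_of_nonneg_left (norm_le_pi_norm v j) (norm_nonneg _)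

theorem norm_fderiv_le_of_abs_pd_le {n : ℕ} {g : (Fin n → ℝ) → ℝ} {x : Fin n → ℝ} {c : ℝ}
    (h : ∀ j, |pd j g x| ≤ c) : ‖fderiv ℝ g x‖ ≤ n * c :=
  calc ‖fderiv ℝ g x‖ ≤ ∑ j, |pd j g x| := norm_fderiv_le_sum_abs_pd g x
    _ ≤ ∑ _j : Fin n, c := Finset.sum_le_sum fun j _ => h j
    _ = n * c := by simp

theorem pd_coord_mul {n : ℕ} {f : (Fin n → ℝ) → ℝ} {x : Fin n → ℝ} (hf : DifferentiableAt ℝ f x)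
    (j k : Fin n) : pd j (fun y => y k * f y) x =
      (1 : Matrix (Fin n) (Fin n) ℝ) j k * f x + x k * pd j f x := by
  have hmul := (hasFDerivAt_apply (𝕜 := ℝ) k x).fun_mul hf.hasFDerivAt
  rw [pd, hmul.fderiv]
  simp [pd, Matrix.one_apply, Pi.single_apply, eq_comm, add_comm]

theorem abs_jetOf_le_sum (f : (Fin n → ℝ) → ℝ) (x : Fin n → ℝ) (a : JetIndex n) :
    |jetOf f a x| ≤ ∑ b, |jetOf f b x| :=
  Finset.single_le_sum (f := fun b => |jetOf f b x|) (fun _ _ => abs_nonneg _) (Finset.mem_univ a)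

theorem abs_pd_le_sum_abs_jetOf {x : Fin n → ℝ} (hx : 1 ≤ x 0) (f : (Fin n → ℝ) → ℝ) (i : Fin n) :
    |pd i f x| ≤ ∑ b, |jetOf f b x| :=
  calc |pd i f x| ≤ |x 0 * pd i f x| := by
        rw [abs_mul, abs_of_pos (by linarith : 0 < x 0)]
        exact le_mul_of_one_le_left (abs_nonneg _) hx
    _ ≤ _ := abs_jetOf_le_sum f x (.inr (.inl i))

theorem abs_coord_mul_hessian_le_sum_abs_jetOf {x : Fin n → ℝ} (hx : 1 ≤ x 0)
    (f : (Fin n → ℝ) → ℝ) (i j : Fin n) :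
    |x 0 * hessian (hyperbolicMetric n) f x i j| ≤ ∑ b, |jetOf f b x| :=
  calc |x 0 * hessian (hyperbolicMetric n) f x i j|
      ≤ |x 0 ^ 2 * hessian (hyperbolicMetric n) f x i j| := by
        rw [abs_mul, abs_mul, abs_of_pos (by linarith : 0 < x 0), abs_pow,
          abs_of_pos (by linarith : 0 < x 0)]
        gcongr
        exact le_self_pow₀ hx two_ne_zero
    _ ≤ _ := abs_jetOf_le_sum f x (.inr (.inr (i, j)))

theorem norm_fderiv_le_sum_abs_jetOf {x : Fin n → ℝ} (hx : 1 ≤ x 0) (f : (Fin n → ℝ) → ℝ) :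
    ‖fderiv ℝ f x‖ ≤ n * ∑ b, |jetOf f b x| :=
  norm_fderiv_le_of_abs_pd_le (abs_pd_le_sum_abs_jetOf hx f)

local notation "δ" => (1 : Matrix (Fin n) (Fin n) ℝ)

theorem norm_fderiv_coord_mul_pd_le {f : (Fin n → ℝ) → ℝ} {x : Fin n → ℝ} {i : Fin n}
    (hx : 1 ≤ x 0) (hf : DifferentiableAt ℝ (pd i f) x) :
    ‖fderiv ℝ (fun y => y 0 * pd i f y) x‖ ≤ 3 * n * ∑ b, |jetOf f b x| := by
  have hx0 : x 0 ≠ 0 := by positivity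
  set S := ∑ b, |jetOf f b x|
  have hδ : ∀ j k l : Fin n, |δ j k * pd l f x| ≤ S := fun j k l => by
    rw [Matrix.one_apply]
    split_ifs
    · rw [one_mul]
      exact abs_pd_le_sum_abs_jetOf hx f l
    · rw [zero_mul, abs_zero]
      exact Finset.sum_nonneg fun b _ => abs_nonneg (jetOf f b x)
  have hpd : ∀ j, |pd j (fun y => y 0 * pd i f y) x| ≤ 3 * S := fun j => by
    rw [pd_coord_mul hf]
    have hcancel : δ j 0 * pd i f x + x 0 * pd j (pd i f) x =
        x 0 * hessian (hyperbolicMetric n) f x j i - δ i 0 * pd j f x + δ j i * pd 0 f x := by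
      rw [hessian_hyperbolicMetric hx0]
      field_simp
      ring
    rw [hcancel]
    linarith [abs_add_le (x 0 * hessian (hyperbolicMetric n) f x j i - δ i 0 * pd j f x)
        (δ j i * pd 0 f x),
      abs_sub (x 0 * hessian (hyperbolicMetric n) f x j i) (δ i 0 * pd j f x),
      abs_coord_mul_hessian_le_sum_abs_jetOf hx f j i, hδ i 0 j, hδ j i 0]
  calc _ ≤ n * (3 * S) := norm_fderiv_le_of_abs_pd_le hpd
    _ = 3 * n * S := by ring

theorem enorm_sq_le_of_norm_le_sum {E ι : Type*} [SeminormedAddCommGroup E] [Fintype ι] {y : E}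
    {g : ι → ℝ} {c : ℝ} (hy : ‖y‖ ≤ c * ∑ i, |g i|) :
    ‖y‖ₑ ^ 2 ≤ ENNReal.ofReal (c ^ 2 * Fintype.card ι) * ∑ i, ‖g i‖ₑ ^ 2 := by
  have hsum : ∑ i, ‖g i‖ₑ ^ 2 = ENNReal.ofReal (∑ i, |g i| ^ 2) := by
    rw [ENNReal.ofReal_sum_of_nonneg fun i _ => by positivity]
    refine Finset.sum_congr rfl fun i _ => ?_
    rw [ENNReal.ofReal_pow (abs_nonneg _), ← Real.norm_eq_abs, ofReal_norm]
  rw [hsum, ← ENNReal.ofReal_mul (by positivity), ← ofReal_norm,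
    ← ENNReal.ofReal_pow (norm_nonneg _)]
  apply ENNReal.ofReal_le_ofReal
  calc ‖y‖ ^ 2 ≤ (c * ∑ i, |g i|) ^ 2 := by gcongr
    _ = c ^ 2 * (∑ i, |g i|) ^ 2 := by ring
    _ ≤ c ^ 2 * (Fintype.card ι * ∑ i, |g i| ^ 2) := by
        gcongr
        exact sq_sum_le_card_mul_sum_sq
    _ = _ := by ring

theorem lintegral_enorm_fderiv_sq_le (hΩ : IsStripDomain Ω K) {f g : (Fin n → ℝ) → ℝ}
    {F : JetSpace Ω} {c : ℝ} (hF : ∀ a, F a =ᵐ[hypMeasure Ω] jetOf f a)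
    (hg : ∀ x ∈ Ω, ‖fderiv ℝ g x‖ ≤ c * ∑ b, |jetOf f b x|) :
    ∫⁻ x in Ω, ‖fderiv ℝ g x‖ₑ ^ 2 ≤
      ENNReal.ofReal (c ^ 2 * Fintype.card (JetIndex n) * K ^ n * ‖F‖ ^ 2) := by
  have hK := hΩ.bound_pos
  set A : ℝ := c ^ 2 * Fintype.card (JetIndex n)
  have hnorm : ∫⁻ x, ∑ b, ‖jetOf f b x‖ₑ ^ 2 ∂(hypMeasure Ω) = ENNReal.ofReal (‖F‖ ^ 2) :=
    (h2Energy_eq_lintegral hΩ _ _ _).symm.trans (h2Energy_eq_norm_sq hΩ hF)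
  calc ∫⁻ x in Ω, ‖fderiv ℝ g x‖ₑ ^ 2
      ≤ ∫⁻ x in Ω, ENNReal.ofReal A * ∑ b, ‖jetOf f b x‖ₑ ^ 2 :=
        setLIntegral_mono' hΩ.isOpen.measurableSet fun x hx => enorm_sq_le_of_norm_le_sum (hg x hx)
    _ = ENNReal.ofReal A * ∫⁻ x in Ω, ∑ b, ‖jetOf f b x‖ₑ ^ 2 :=
        lintegral_const_mul' _ _ ENNReal.ofReal_ne_top
    _ ≤ ENNReal.ofReal A * (ENNReal.ofReal (K ^ n) * ENNReal.ofReal (‖F‖ ^ 2)) := by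
        gcongr
        rw [← hnorm]
        exact hΩ.lintegral_le _
    _ = _ := by
        rw [← ENNReal.ofReal_mul (by positivity), ← ENNReal.ofReal_mul (by positivity),
          ← mul_assoc]

theorem isCompactOperator_jetProj_of_norm_fderiv_le (hΩ : IsStripDomain Ω K) {a : JetIndex n}
    {c : ℝ} (hreg : ∀ f : (Fin n → ℝ) → ℝ, ContDiffOn ℝ ∞ f Ω → ContDiffOn ℝ 1 (jetOf f a) Ω)
    (hbound : ∀ f : (Fin n → ℝ) → ℝ, ContDiffOn ℝ ∞ f Ω →
      ∀ x ∈ Ω, ‖fderiv ℝ (jetOf f a) x‖ ≤ c * ∑ b, |jetOf f b x|) :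
    IsCompactOperator (jetProj hΩ a) := by
  have hK := hΩ.bound_pos
  set C : ℝ := c ^ 2 * Fintype.card (JetIndex n) * K ^ n
  refine isCompactOperator_of_approx _ (dense_smoothJets hΩ) fun ε hε => ?_
  set η : ℝ := ε / (C + 1) with hη
  have hηC : η ^ 2 * C ≤ ε ^ 2 := by
    rw [hη, div_pow, div_mul_eq_mul_div, div_le_iff₀ (by positivity)]
    have : C ≤ (C + 1) ^ 2 := by nlinarith [sq_nonneg C]
    gcongr
  obtain ⟨U, hU, happrox⟩ := exists_finiteDimensional_approx hΩ.isOpen hΩ.convex hΩ.isBounded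
    hΩ.hypMeasure_le (show 0 < η by positivity)
  refine ⟨U, hU, ?_⟩
  rintro v ⟨f, hf, hv⟩
  obtain ⟨w, hw, hle⟩ := happrox (jetOf f a) (hreg f hf) (jetProj hΩ a v) (hv a)
  refine ⟨w, hw, ?_⟩
  have hsq := hle.trans
    (mul_le_mul_right (lintegral_enorm_fderiv_sq_le hΩ hv (hbound f hf)) _)
  rw [← ofReal_norm, ← ENNReal.ofReal_pow (norm_nonneg _), ← ENNReal.ofReal_pow (by positivity),
    ← ENNReal.ofReal_mul (by positivity), ENNReal.ofReal_le_ofReal_iff (by positivity)] at hsq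
  refine (abs_le_of_sq_le_sq' (hsq.trans ?_) (by positivity)).2
  calc η ^ 2 * (C * ‖(v : JetSpace Ω)‖ ^ 2) = η ^ 2 * C * ‖v‖ ^ 2 := by
        rw [Submodule.coe_norm]; ring
    _ ≤ ε ^ 2 * ‖v‖ ^ 2 := by gcongr
    _ = _ := by ring

theorem isCompactOperator_jetProj_value (hΩ : IsStripDomain Ω K) :
    IsCompactOperator (jetProj hΩ (.inl ())) :=
  isCompactOperator_jetProj_of_norm_fderiv_le hΩ (fun _ hf => hf.of_le (by simp))
    fun f _ x hx => norm_fderiv_le_sum_abs_jetOf (hΩ.one_lt x hx).le f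

theorem isCompactOperator_jetProj_gradient (hΩ : IsStripDomain Ω K) (i : Fin n) :
    IsCompactOperator (jetProj hΩ (.inr (.inl i))) :=
  isCompactOperator_jetProj_of_norm_fderiv_le hΩ
    (fun _ hf => ((contDiff_apply ℝ ℝ (0 : Fin n)).contDiffOn.mul
      ((contDiffOn_pd hΩ.isOpen hf i).of_le (by simp))))
    fun _ hf x hx => norm_fderiv_coord_mul_pd_le (hΩ.one_lt x hx).le
      (differentiableAt_of_contDiffOn hΩ.isOpen (contDiffOn_pd hΩ.isOpen hf i) hx)

end Form

/-! ### Existence of the Neumann spectrum -/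

section Existence

/-- Smooth functions with compact support in `Ω`. -/
structure IsTestFunction {n : ℕ} (Ω : Set (Fin n → ℝ)) (Φ : (Fin n → ℝ) → ℝ) : Prop where
  contDiff : ContDiff ℝ ∞ Φ
  hasCompactSupport : HasCompactSupport Φ
  tsupport_subset : tsupport Φ ⊆ Ω

namespace IsTestFunction

variable {n : ℕ} {Ω : Set (Fin n → ℝ)} {Φ f : (Fin n → ℝ) → ℝ}

theorem pd (h : IsTestFunction Ω Φ) (i : Fin n) : IsTestFunction Ω (pd i Φ) :=
  ⟨(h.contDiff.fderiv_right (by simp)).clm_apply contDiff_const,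
    h.hasCompactSupport.fderiv_apply ℝ _,
    (tsupport_fderiv_apply_subset ℝ _).trans h.tsupport_subset⟩

theorem mul_left (h : IsTestFunction Ω Φ) (hf : ContDiff ℝ ∞ f) :
    IsTestFunction Ω fun x => f x * Φ x :=
  ⟨hf.mul h.contDiff, h.hasCompactSupport.mul_left,
    tsupport_mul_subset_right.trans h.tsupport_subset⟩

theorem integrable_mul (h : IsTestFunction Ω Φ) (hΩ : IsOpen Ω) (hf : ContinuousOn f Ω) :
    Integrable fun x => Φ x * f x := by
  refine Continuous.integrable_of_hasCompactSupport ?_ h.hasCompactSupport.mul_right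
  exact (h.contDiff.continuous.continuousOn.mul hf).continuous_of_tsupport_subset hΩ
    (tsupport_mul_subset_left.trans h.tsupport_subset)

theorem integral_mul_pd (h : IsTestFunction Ω Φ) (hΩ : IsOpen Ω) (hf : ContDiffOn ℝ ∞ f Ω)
    (i : Fin n) :
    ∫ x, Φ x * BiharmonicNeumann.pd i f x = -∫ x, BiharmonicNeumann.pd i Φ x * f x :=
  integral_mul_fderiv_eq_neg_fderiv_mul_of_integrable
    ((h.pd i).integrable_mul hΩ hf.continuousOn)
    (h.integrable_mul hΩ (contDiffOn_pd hΩ hf i).continuousOn)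
    (h.integrable_mul hΩ hf.continuousOn)
    (fun x _ => h.contDiff.differentiable (by simp) x)
    (fun _ hx => differentiableAt_of_contDiffOn hΩ hf (h.tsupport_subset hx))

end IsTestFunction

variable {n : ℕ} [NeZero n] {Ω : Set (Fin n → ℝ)} {K : ℝ} {Φ : (Fin n → ℝ) → ℝ}

theorem isOpen_halfSpace : IsOpen (halfSpace n) :=
  isOpen_lt continuous_const (continuous_apply 0)

namespace IsStripDomain

theorem closure_subset (hΩ : IsStripDomain Ω K) : closure Ω ⊆ halfSpace n := by
  have hclosure : closure Ω ⊆ {x : Fin n → ℝ | 1 ≤ x 0} :=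
    closure_minimal (fun x hx => (hΩ.one_lt x hx).le)
      (isClosed_le continuous_const (continuous_apply 0))
  intro x hx
  have hx1 : 1 ≤ x 0 := hclosure hx
  exact show 0 < x 0 by linarith

theorem volume_restrict_le (hΩ : IsStripDomain Ω K) :
    volume.restrict Ω ≤ ENNReal.ofReal (K ^ n) • hypMeasure Ω := by
  refine Measure.le_iff.2 fun s hs => ?_
  have hle := hΩ.lintegral_le (s.indicator 1)
  rwa [lintegral_indicator_one hs, lintegral_indicator_one hs] at hle

theorem volume_restrict_absolutelyContinuous (hΩ : IsStripDomain Ω K) :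
    volume.restrict Ω ≪ hypMeasure Ω :=
  (Measure.absolutelyContinuous_of_le hΩ.volume_restrict_le).trans
    Measure.smul_absolutelyContinuous

theorem eqOn_of_ae_eq (hΩ : IsStripDomain Ω K) {f g : (Fin n → ℝ) → ℝ}
    (h : f =ᵐ[hypMeasure Ω] g) (hf : ContinuousOn f Ω) (hg : ContinuousOn g Ω) : Set.EqOn f g Ω :=
  Measure.eqOn_open_of_ae_eq (hΩ.volume_restrict_absolutelyContinuous h) hΩ.isOpen hf hg

theorem memLp (hΩ : IsStripDomain Ω K) {f : (Fin n → ℝ) → ℝ}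
    (hf : ContinuousOn f (halfSpace n)) : MemLp f 2 (hypMeasure Ω) := by
  have := hΩ.isFiniteMeasure
  obtain ⟨C, hC⟩ := hΩ.isBounded.isCompact_closure.exists_bound_of_continuousOn
    (hf.mono hΩ.closure_subset)
  refine MemLp.of_bound ?_ C ?_
  · exact (hf.mono (subset_closure.trans hΩ.closure_subset)).aestronglyMeasurable
      hΩ.isOpen.measurableSet
  · filter_upwards [hΩ.ae_mem] with x hx using hC x (subset_closure hx)

theorem memLp_jetOf (hΩ : IsStripDomain Ω K) {f : (Fin n → ℝ) → ℝ}
    (hf : ContDiffOn ℝ ∞ f (halfSpace n)) (a : JetIndex n) :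
    MemLp (jetOf f a) 2 (hypMeasure Ω) :=
  hΩ.memLp (continuousOn_jetOf isOpen_halfSpace (fun _ hx => hx) hf a)

theorem exists_sobolevH2_ae_eq_jetOf (hΩ : IsStripDomain Ω K) {f : (Fin n → ℝ) → ℝ}
    (hf : ContDiffOn ℝ ∞ f (halfSpace n)) :
    ∃ v : sobolevH2 hΩ, ∀ a, (v : JetSpace Ω) a =ᵐ[hypMeasure Ω] jetOf f a := by
  let F : JetSpace Ω := WithLp.toLp 2 fun a => (hΩ.memLp_jetOf hf a).toLp _
  have hF : ∀ a, F a =ᵐ[hypMeasure Ω] jetOf f a := fun a => (hΩ.memLp_jetOf hf a).coeFn_toLp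
  exact ⟨⟨F, Submodule.le_topologicalClosure _ ⟨f, hf.mono hΩ.pos, hF⟩⟩, hF⟩

theorem exists_Lp_ae_eq_testFunction (hΩ : IsStripDomain Ω K) (hΦ : IsTestFunction Ω Φ) :
    ∃ φ : Lp ℝ 2 (hypMeasure Ω), φ =ᵐ[hypMeasure Ω] fun x => x 0 ^ n * Φ x :=
  ⟨(hΩ.memLp (((continuous_apply (0 : Fin n)).pow n).mul
    hΦ.contDiff.continuous).continuousOn).toLp _, MemLp.coeFn_toLp _⟩

theorem inner_testFunction (hΩ : IsStripDomain Ω K) (hΦ : IsTestFunction Ω Φ)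
    {φ G : Lp ℝ 2 (hypMeasure Ω)} {g : (Fin n → ℝ) → ℝ}
    (hφ : φ =ᵐ[hypMeasure Ω] fun x => x 0 ^ n * Φ x) (hG : G =ᵐ[hypMeasure Ω] g) :
    inner ℝ φ G = ∫ x, Φ x * g x := by
  rw [inner_eq_integral_of_ae_eq hφ hG, integral_hypMeasure hΩ.isOpen.measurableSet hΩ.pos]
  refine Eq.trans ?_ (setIntegral_eq_integral_of_forall_compl_eq_zero (s := Ω) ?_)
  · refine setIntegral_congr_fun hΩ.isOpen.measurableSet fun x hx => ?_
    have := hΩ.pos x hx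
    field_simp
  · intro x hx
    rw [image_eq_zero_of_notMem_tsupport fun h => hx (hΦ.tsupport_subset h), zero_mul]

end IsStripDomain

/-- The span in `L²(Ω)` of the test functions, weighted by `x₀ⁿ` so that pairing with them in
`L²(Ω)` is integration against an unweighted test function for Lebesgue measure. -/
def testSpan (Ω : Set (Fin n → ℝ)) : Submodule ℝ (Lp ℝ 2 (hypMeasure Ω)) :=
  Submodule.span ℝ {φ | ∃ Φ, IsTestFunction Ω Φ ∧ φ =ᵐ[hypMeasure Ω] fun x => x 0 ^ n * Φ x}

theorem dense_testSpan (hΩ : IsStripDomain Ω K) :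
    Dense (testSpan Ω : Set (Lp ℝ 2 (hypMeasure Ω))) := by
  have := hΩ.isFiniteMeasure
  rw [Submodule.dense_iff_topologicalClosure_eq_top, Submodule.topologicalClosure_eq_top_iff,
    eq_bot_iff]
  intro G hG
  have hint : IntegrableOn G Ω volume :=
    (((Lp.memLp G).integrable (by norm_num)).smul_measure ENNReal.ofReal_ne_top).mono_measure
      hΩ.volume_restrict_le
  have hzero : ∀ᵐ x, x ∈ Ω → G x = 0 :=
    hΩ.isOpen.ae_eq_zero_of_integral_contDiff_smul_eq_zero hint.locallyIntegrableOn
      fun Φ hsmooth hcompact hsupp => by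
        have hΦ : IsTestFunction Ω Φ := ⟨hsmooth, hcompact, hsupp⟩
        obtain ⟨φ, hφ⟩ := hΩ.exists_Lp_ae_eq_testFunction hΦ
        simp only [smul_eq_mul]
        rw [← hΩ.inner_testFunction hΦ hφ (ae_eq_refl _)]
        exact hG φ (Submodule.subset_span ⟨Φ, hΦ, hφ⟩)
  have hzero' : ∀ᵐ x ∂(hypMeasure Ω), G x = 0 :=
    (Measure.absolutelyContinuous_of_le hΩ.hypMeasure_le).ae_le
      ((ae_restrict_iff' hΩ.isOpen.measurableSet).2 hzero)
  exact (Submodule.mem_bot ℝ).2 (Lp.eq_zero_iff_ae_eq_zero.2 hzero')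

theorem denseRange_jetProj_value (hΩ : IsStripDomain Ω K) :
    DenseRange (jetProj hΩ (.inl ())) := by
  have hle : testSpan Ω ≤ LinearMap.range (jetProj hΩ (.inl ())).toLinearMap := by
    rw [testSpan, Submodule.span_le]
    rintro φ ⟨Φ, hΦ, hφ⟩
    have hsmooth : ContDiff ℝ ∞ fun x : Fin n → ℝ => x 0 ^ n * Φ x :=
      ((contDiff_apply ℝ ℝ (0 : Fin n)).pow n).mul hΦ.contDiff
    obtain ⟨v, hv⟩ := hΩ.exists_sobolevH2_ae_eq_jetOf hsmooth.contDiffOn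
    exact ⟨v, Lp.ext ((hv (.inl ())).trans hφ.symm)⟩
  exact (dense_testSpan hΩ).mono hle

theorem inner_jetProj_gradient (hΩ : IsStripDomain Ω K) (i : Fin n) (hΦ : IsTestFunction Ω Φ)
    {φ ψ : Lp ℝ 2 (hypMeasure Ω)} (hφ : φ =ᵐ[hypMeasure Ω] fun x => x 0 ^ n * Φ x)
    (hψ : ψ =ᵐ[hypMeasure Ω] fun x => x 0 ^ n * pd i (fun y => y 0 * Φ y) x) (v : sobolevH2 hΩ) :
    inner ℝ φ (jetProj hΩ (.inr (.inl i)) v) = -inner ℝ ψ (jetProj hΩ (.inl ()) v) := by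
  have hΨ : IsTestFunction Ω fun x => x 0 * Φ x := hΦ.mul_left (contDiff_apply ℝ ℝ (0 : Fin n))
  refine isClosed_property (dense_smoothJets hΩ).denseRange_val
    (p := fun v => inner ℝ φ (jetProj hΩ (.inr (.inl i)) v) =
      -inner ℝ ψ (jetProj hΩ (.inl ()) v))
    (isClosed_eq (by fun_prop) (by fun_prop)) ?_ v
  rintro ⟨v, f, hf, hv⟩
  calc inner ℝ φ (jetProj hΩ (.inr (.inl i)) v)
      = ∫ x, Φ x * (x 0 * pd i f x) := hΩ.inner_testFunction hΦ hφ (hv (.inr (.inl i)))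
    _ = ∫ x, x 0 * Φ x * pd i f x := by simp only [mul_assoc, mul_left_comm]
    _ = -∫ x, pd i (fun y => y 0 * Φ y) x * f x := hΨ.integral_mul_pd hΩ.isOpen hf i
    _ = -inner ℝ ψ (jetProj hΩ (.inl ()) v) :=
      congrArg _ (hΩ.inner_testFunction (hΨ.pd i) hψ (hv (.inl ()))).symm

theorem exists_abs_inner_jetProj_gradient_le (hΩ : IsStripDomain Ω K) (i : Fin n)
    {φ : Lp ℝ 2 (hypMeasure Ω)} (hφ : φ ∈ testSpan Ω) :
    ∃ C, ∀ v, |inner ℝ φ (jetProj hΩ (.inr (.inl i)) v)| ≤ C * ‖jetProj hΩ (.inl ()) v‖ := by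
  induction hφ using Submodule.span_induction with
  | mem φ h =>
    obtain ⟨Φ, hΦ, hφ⟩ := h
    obtain ⟨ψ, hψ⟩ := hΩ.exists_Lp_ae_eq_testFunction
      ((hΦ.mul_left (contDiff_apply ℝ ℝ (0 : Fin n))).pd i)
    refine ⟨‖ψ‖, fun v => ?_⟩
    rw [inner_jetProj_gradient hΩ i hΦ hφ hψ, abs_neg]
    exact abs_real_inner_le_norm _ _
  | zero => exact ⟨0, fun v => by simp⟩
  | add φ ψ _ _ hφ hψ =>
    obtain ⟨C, hC⟩ := hφ
    obtain ⟨D, hD⟩ := hψ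
    refine ⟨C + D, fun v => ?_⟩
    rw [inner_add_left, add_mul]
    exact (abs_add_le _ _).trans (add_le_add (hC v) (hD v))
  | smul c φ _ hφ =>
    obtain ⟨C, hC⟩ := hφ
    refine ⟨|c| * C, fun v => ?_⟩
    rw [real_inner_smul_left, abs_mul, mul_assoc]
    exact mul_le_mul_of_nonneg_left (hC v) (abs_nonneg c)

theorem norm_sq_sobolevH2 (hΩ : IsStripDomain Ω K) (v : sobolevH2 hΩ) :
    ‖v‖ ^ 2 = ‖jetProj hΩ (.inl ()) v‖ ^ 2 + (∑ i, ‖jetProj hΩ (.inr (.inl i)) v‖ ^ 2 +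
      ∑ ij, ‖jetProj hΩ (.inr (.inr ij)) v‖ ^ 2) := by
  rw [Submodule.coe_norm, PiLp.norm_sq_eq_of_L2, Fintype.sum_sum_type, Fintype.sum_sum_type,
    Fintype.sum_unique]
  rfl

theorem exists_sum_norm_sq_gradient_le (hΩ : IsStripDomain Ω K) {ε : ℝ} (hε : 0 < ε) :
    ∃ C, ∀ v, ∑ i, ‖jetProj hΩ (.inr (.inl i)) v‖ ^ 2 ≤
      n * (ε * ‖v‖ ^ 2) + C * ‖jetProj hΩ (.inl ()) v‖ ^ 2 := by
  have hcomp : ∀ i, ∃ C, ∀ v, ‖jetProj hΩ (.inr (.inl i)) v‖ ^ 2 ≤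
      ε * ‖v‖ ^ 2 + C * ‖jetProj hΩ (.inl ()) v‖ ^ 2 := fun i =>
    exists_norm_sq_le_add_of_isCompactOperator _ (isCompactOperator_jetProj_gradient hΩ i) _
      (dense_testSpan hΩ) (fun _ hφ => exists_abs_inner_jetProj_gradient_le hΩ i hφ) hε
  choose C hC using hcomp
  refine ⟨∑ i, C i, fun v => (Finset.sum_le_sum fun i _ => hC i v).trans_eq ?_⟩
  rw [Finset.sum_add_distrib, Finset.sum_const, Finset.card_univ, Fintype.card_fin, nsmul_eq_mul,
    Finset.sum_mul]

/-- Gårding's inequality. -/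
theorem exists_norm_sq_le_neumannForm_add (hΩ : IsStripDomain Ω K) :
    ∃ lam : ℝ, ∀ v, 1 / 2 * ‖v‖ ^ 2 ≤
      neumannForm hΩ v v + lam * ‖jetProj hΩ (.inl ()) v‖ ^ 2 := by
  have hn : (0 : ℝ) < n := by exact_mod_cast Nat.pos_of_ne_zero (NeZero.ne n)
  obtain ⟨C, hC⟩ := exists_sum_norm_sq_gradient_le hΩ (ε := 1 / (2 * (n : ℝ) ^ 2)) (by positivity)
  refine ⟨1 + n * C, fun v => ?_⟩
  have hgrad := mul_le_mul_of_nonneg_left (hC v) hn.le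
  have hhalf : (n : ℝ) * (n * (1 / (2 * (n : ℝ) ^ 2) * ‖v‖ ^ 2)) = 1 / 2 * ‖v‖ ^ 2 := by
    field_simp
  rw [mul_add, hhalf] at hgrad
  have hnorm := norm_sq_sobolevH2 hΩ v
  rw [neumannForm_apply]
  simp only [real_inner_self_eq_norm_sq]
  linarith

theorem IsStripDomain.eq_zero_of_eval_ae_eq_zero (hΩ : IsStripDomain Ω K) {P : Polynomial ℝ}
    (hP : (fun x : Fin n → ℝ => P.eval (x 0)) =ᵐ[hypMeasure Ω] fun _ => 0) : P = 0 := by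
  have heq := hΩ.eqOn_of_ae_eq hP (P.continuous.comp (continuous_apply 0)).continuousOn
    continuousOn_const
  have hopen : IsOpen ((fun x : Fin n → ℝ => x 0) '' Ω) := isOpenMap_eval 0 _ hΩ.isOpen
  obtain ⟨x, hx⟩ := hΩ.nonempty
  refine Polynomial.eq_zero_of_infinite_isRoot P
    ((infinite_of_mem_nhds (x 0) (hopen.mem_nhds ⟨x, hx, rfl⟩)).mono ?_)
  rintro _ ⟨y, hy, rfl⟩
  exact heq hy

theorem not_finiteDimensional_Lp_hypMeasure (hΩ : IsStripDomain Ω K) :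
    ¬ FiniteDimensional ℝ (Lp ℝ 2 (hypMeasure Ω)) := by
  intro hfin
  have hmem : ∀ P : Polynomial ℝ, MemLp (fun x : Fin n → ℝ => P.eval (x 0)) 2 (hypMeasure Ω) :=
    fun P => hΩ.memLp (P.continuous.comp (continuous_apply 0)).continuousOn
  let L : Polynomial ℝ →ₗ[ℝ] Lp ℝ 2 (hypMeasure Ω) :=
    { toFun := fun P => (hmem P).toLp _
      map_add' := fun P Q => by
        rw [← MemLp.toLp_add]
        congr 1
        ext x
        simp
      map_smul' := fun c P => by
        rw [RingHom.id_apply, ← MemLp.toLp_const_smul]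
        congr 1
        ext x
        simp }
  have hinj : Function.Injective L := by
    rw [← LinearMap.ker_eq_bot, LinearMap.ker_eq_bot']
    intro P hP
    refine hΩ.eq_zero_of_eval_ae_eq_zero ((hmem P).coeFn_toLp.symm.trans ?_)
    change (L P : (Fin n → ℝ) → ℝ) =ᵐ[hypMeasure Ω] _
    rw [hP]
    exact Lp.coeFn_zero _ _ _
  exact Polynomial.not_finite (R := ℝ) (Module.Finite.of_injective L hinj)

theorem exists_isFormSpectrum_neumannForm (hΩ : IsStripDomain Ω K) :
    ∃ mu b, IsFormSpectrum (jetProj hΩ (.inl ())) (neumannForm hΩ) mu b := by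
  have : CompleteSpace (sobolevH2 hΩ) := (isClosed_sobolevH2 hΩ).completeSpace_coe
  obtain ⟨lam, hlam⟩ := exists_norm_sq_le_neumannForm_add hΩ
  exact exists_isFormSpectrum (not_finiteDimensional_Lp_hypMeasure hΩ)
    (isCompactOperator_jetProj_value hΩ) (denseRange_jetProj_value hΩ) (neumannForm_symm hΩ)
    (by norm_num) hlam

theorem isNeumannSolution_of_neumannForm_eq {hΩ : IsStripDomain Ω K}
    {c : ℝ} {u : Lp ℝ 2 (hypMeasure Ω)} {v : sobolevH2 hΩ} (hv : jetProj hΩ (.inl ()) v = u)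
    (heq : ∀ w, neumannForm hΩ v w = c * inner ℝ u (jetProj hΩ (.inl ()) w)) :
    IsNeumannSolution (hyperbolicMetric n) Ω c u := by
  obtain ⟨p, h, hmem, hcomp⟩ := exists_memH2_of_mem_sobolevH2 hΩ v.2 (u := u) (by rw [← hv]; rfl)
  refine ⟨p, h, hmem, fun φ q k hφ => ?_⟩
  obtain ⟨w, hw, hwc⟩ := exists_mem_sobolevH2_of_memH2 hΩ hφ
  have hinner : inner ℝ u (jetProj hΩ (.inl ()) ⟨w, hw⟩) = ∫ x, u x * φ x ∂(hypMeasure Ω) :=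
    inner_eq_integral_of_ae_eq (ae_eq_refl _) (hwc (.inl ()))
  rw [← neumannForm_eq_integral hΩ hcomp (w := ⟨w, hw⟩) hwc, heq, hinner]

theorem IsFormSpectrum.isNeumannSpectrum {hΩ : IsStripDomain Ω K} {mu : ℕ → ℝ}
    {b : HilbertBasis ℕ ℝ (Lp ℝ 2 (hypMeasure Ω))}
    (h : IsFormSpectrum (jetProj hΩ (.inl ())) (neumannForm hΩ) mu b) :
    IsNeumannSpectrum (hyperbolicMetric n) Ω mu := by
  refine ⟨h.monotone, h.tendsto_atTop, b, fun j => ?_⟩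
  obtain ⟨v, hv, heq⟩ := h.exists_eigenvector j
  exact isNeumannSolution_of_neumannForm_eq hv heq

/-- The integrand `|D²f|² + Ric(∇f, ∇f)` of the Neumann form in hyperbolic space, where
`Ric = -(n - 1) g`. -/
def neumannDensity (f : (Fin n → ℝ) → ℝ) (x : Fin n → ℝ) : ℝ :=
  ∑ ij, jetOf f (.inr (.inr ij)) x ^ 2 - ((n : ℝ) - 1) * ∑ i, jetOf f (.inr (.inl i)) x ^ 2

theorem integrable_neumannDensity (hΩ : IsStripDomain Ω K) {f : (Fin n → ℝ) → ℝ}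
    (hf : ContDiffOn ℝ ∞ f (halfSpace n)) : Integrable (neumannDensity f) (hypMeasure Ω) :=
  (integrable_finsetSum _ fun _ _ => (hΩ.memLp_jetOf hf _).integrable_sq).sub
    ((integrable_finsetSum _ fun _ _ => (hΩ.memLp_jetOf hf _).integrable_sq).const_mul _)

theorem neumannForm_self_eq_integral (hΩ : IsStripDomain Ω K) {f : (Fin n → ℝ) → ℝ}
    (hf : ContDiffOn ℝ ∞ f (halfSpace n)) {v : sobolevH2 hΩ}
    (hv : ∀ a, (v : JetSpace Ω) a =ᵐ[hypMeasure Ω] jetOf f a) :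
    neumannForm hΩ v v = ∫ x, neumannDensity f x ∂(hypMeasure Ω) := by
  have hint : ∀ a, Integrable (fun x => jetOf f a x ^ 2) (hypMeasure Ω) :=
    fun a => (hΩ.memLp_jetOf hf a).integrable_sq
  have hinner : ∀ a, inner ℝ (jetProj hΩ a v) (jetProj hΩ a v) =
      ∫ x, jetOf f a x ^ 2 ∂(hypMeasure Ω) := fun a => by
    simp_rw [sq]
    exact inner_eq_integral_of_ae_eq (hv a) (hv a)
  simp only [neumannForm_apply, hinner, neumannDensity]
  rw [integral_sub (integrable_finsetSum _ fun _ _ => hint _)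
      ((integrable_finsetSum _ fun _ _ => hint _).const_mul _), integral_const_mul,
    integral_finsetSum _ fun _ _ => hint _, integral_finsetSum _ fun _ _ => hint _]

theorem exists_isNeumannSpectrum_le (hΩ : IsStripDomain Ω K) {ι : Type*} [Fintype ι] {κ : ℝ}
    {u : ι → (Fin n → ℝ) → ℝ} (hu : ∀ i, ContDiffOn ℝ ∞ (u i) (halfSpace n))
    (hdisj : ∀ i j, i ≠ j → ∀ x ∈ Ω, ∀ a, jetOf (u i) a x * jetOf (u j) a x = 0)
    (hne : ∀ i, ∫ x, u i x ^ 2 ∂(hypMeasure Ω) ≠ 0)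
    (hle : ∀ i, ∫ x, neumannDensity (u i) x ∂(hypMeasure Ω) ≤
      κ * ∫ x, u i x ^ 2 ∂(hypMeasure Ω)) :
    ∃ mu, IsNeumannSpectrum (hyperbolicMetric n) Ω mu ∧ ∀ j < Fintype.card ι, mu j ≤ κ := by
  obtain ⟨mu, b, hmu⟩ := exists_isFormSpectrum_neumannForm hΩ
  choose v hv using fun i => hΩ.exists_sobolevH2_ae_eq_jetOf (hu i)
  have horth : ∀ i j, i ≠ j → ∀ a, inner ℝ (jetProj hΩ a (v i)) (jetProj hΩ a (v j)) = 0 :=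
    fun i j hij a => (inner_eq_integral_of_ae_eq (hv i a) (hv j a)).trans
      (setIntegral_eq_zero_of_forall_eq_zero fun x hx => hdisj i j hij x hx a)
  have hnorm : ∀ i, ‖jetProj hΩ (.inl ()) (v i)‖ ^ 2 = ∫ x, u i x ^ 2 ∂(hypMeasure Ω) := fun i => by
    simp_rw [← real_inner_self_eq_norm_sq, sq]
    exact inner_eq_integral_of_ae_eq (hv i (.inl ())) (hv i (.inl ()))
  refine ⟨mu, hmu.isNeumannSpectrum, fun j hj => hmu.eigenvalue_le_of_orthogonal (v := v)
    (fun i hzero => hne i ?_) (fun i j hij => horth i j hij _) (fun i j hij => ?_) (fun i => ?_) hj⟩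
  · rw [← hnorm, hzero, norm_zero, zero_pow two_ne_zero]
  · simp [neumannForm_apply, horth i j hij]
  · rw [neumannForm_self_eq_integral hΩ (hu i) (hv i), hnorm]
    exact hle i

end Existence

/-! ### Slim convex domains around a geodesic -/

section AxisDistance

variable {n : ℕ} [NeZero n]

/-- The squared Euclidean distance to the vertical axis, which is a geodesic of the half-space. -/
def axisDistSq (x : Fin n → ℝ) : ℝ := ∑ i ∈ Finset.univ.erase 0, x i ^ 2

theorem axisDistSq_nonneg (x : Fin n → ℝ) : 0 ≤ axisDistSq x :=
  Finset.sum_nonneg fun _ _ => sq_nonneg _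

theorem contDiff_axisDistSq : ContDiff ℝ ∞ (axisDistSq (n := n)) := by
  unfold axisDistSq
  fun_prop

theorem sq_le_axisDistSq (x : Fin n → ℝ) {i : Fin n} (hi : i ≠ 0) : x i ^ 2 ≤ axisDistSq x :=
  Finset.single_le_sum (f := fun i => x i ^ 2) (fun _ _ => sq_nonneg _)
    (Finset.mem_erase.2 ⟨hi, Finset.mem_univ i⟩)

theorem pd_axisDistSq (x : Fin n → ℝ) (i : Fin n) :
    pd i axisDistSq x = if i = 0 then 0 else 2 * x i := by
  have hsum : HasFDerivAt (axisDistSq (n := n))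
      (∑ k ∈ Finset.univ.erase 0,
        (2 * x k) • ContinuousLinearMap.proj (R := ℝ) (φ := fun _ : Fin n => ℝ) k) x := by
    refine HasFDerivAt.fun_sum fun k _ => ?_
    simpa using (hasFDerivAt_apply (𝕜 := ℝ) (F' := fun _ : Fin n => ℝ) k x).pow 2
  rw [pd, hsum.fderiv]
  rcases eq_or_ne i 0 with rfl | hi
  · simp [_root_.sum_apply, Pi.single_apply]
  · simp [_root_.sum_apply, Pi.single_apply, hi, hi.symm]

theorem axisDistSq_eq_zero_of_pd_eq_zero {x : Fin n → ℝ}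
    (h : ∀ i ≠ 0, pd i axisDistSq x = 0) : axisDistSq x = 0 := by
  refine Finset.sum_eq_zero fun i hi => ?_
  have hi0 : i ≠ 0 := (Finset.mem_erase.1 hi).1
  have hxi : 2 * x i = 0 := by simpa [pd_axisDistSq, hi0] using h i hi0
  simp [(mul_eq_zero.1 hxi).resolve_left two_ne_zero]

theorem add_sq_le_perspective {a b s t u v : ℝ} (ha : 0 ≤ a) (hb : 0 ≤ b) (hs : 0 < s)
    (ht : 0 < t) : (a * u + b * v) ^ 2 ≤ (a * (u ^ 2 / s) + b * (v ^ 2 / t)) * (a * s + b * t) := by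
  have hdiff : (a * (u ^ 2 / s) + b * (v ^ 2 / t)) * (a * s + b * t) - (a * u + b * v) ^ 2 =
      a * b * (u * t - v * s) ^ 2 / (s * t) := by
    field_simp
    ring
  have hnonneg : 0 ≤ a * b * (u * t - v * s) ^ 2 / (s * t) := by positivity
  linarith

theorem convex_halfSpace : Convex ℝ (halfSpace n) :=
  convex_halfSpace_gt (LinearMap.proj (R := ℝ) (φ := fun _ : Fin n => ℝ) 0).isLinear 0

theorem convexOn_axisDistSq_div :
    ConvexOn ℝ (halfSpace n) fun x : Fin n → ℝ => axisDistSq x / x 0 := by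
  refine ⟨convex_halfSpace, fun x hx y hy a b ha hb hab => ?_⟩
  have hz : 0 < a * x 0 + b * y 0 := convex_halfSpace hx hy ha hb hab
  change axisDistSq (a • x + b • y) / (a * x 0 + b * y 0) ≤
    a * (axisDistSq x / x 0) + b * (axisDistSq y / y 0)
  rw [div_le_iff₀ hz]
  simp only [axisDistSq, Finset.sum_div, Finset.mul_sum]
  rw [← Finset.sum_add_distrib, Finset.sum_mul]
  exact Finset.sum_le_sum fun i _ => add_sq_le_perspective ha hb hx hy

end AxisDistance

section SlimDomain

variable {n : ℕ} [NeZero n] {c K : ℝ} {x : Fin n → ℝ}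

/-- The function defining `slimDomain`. It vanishes on the vertical axis precisely at the heights
`0`, `1` and `K`. -/
def slimDefining (c K : ℝ) (x : Fin n → ℝ) : ℝ :=
  axisDistSq x - c * (x 0 * (x 0 - 1) * (K - x 0))

/-- A domain around the geodesic segment joining the points of height `1` and `K` on the vertical
axis; it is slim when `c` is small. -/
def slimDomain (n : ℕ) [NeZero n] (c K : ℝ) : Set (Fin n → ℝ) :=
  {x ∈ halfSpace n | slimDefining c K x < 0}

theorem mem_slimDomain : x ∈ slimDomain n c K ↔
    0 < x 0 ∧ axisDistSq x < c * (x 0 * (x 0 - 1) * (K - x 0)) :=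
  and_congr_right fun _ => sub_neg

theorem contDiff_slimDefining : ContDiff ℝ ∞ (slimDefining (n := n) c K) :=
  contDiff_axisDistSq.sub (by fun_prop)

theorem mem_Ioo_of_mem_slimDomain (hc : 0 < c) (hK : 1 < K) (hx : x ∈ slimDomain n c K) :
    x 0 ∈ Set.Ioo 1 K := by
  obtain ⟨hx0, hlt⟩ := mem_slimDomain.1 hx
  have hprofile : 0 < x 0 * ((x 0 - 1) * (K - x 0)) := by
    rw [← mul_assoc]
    exact pos_of_mul_pos_right ((axisDistSq_nonneg x).trans_lt hlt) hc.le
  rcases mul_pos_iff.1 (pos_of_mul_pos_right hprofile hx0.le) with ⟨hlow, hhigh⟩ | ⟨hlow, hhigh⟩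
  · exact ⟨by linarith, by linarith⟩
  · linarith

theorem isOpen_slimDomain : IsOpen (slimDomain n c K) :=
  isOpen_halfSpace.inter (isOpen_lt contDiff_slimDefining.continuous continuous_const)

theorem convexOn_quadratic (hc : 0 ≤ c) :
    ConvexOn ℝ Set.univ fun t : ℝ => -(c * ((t - 1) * (K - t))) := by
  refine ⟨convex_univ, fun s _ t _ a b ha hb hab => ?_⟩
  obtain rfl : b = 1 - a := by linarith
  have hnonneg : 0 ≤ c * (a * (1 - a) * (s - t) ^ 2) := by positivity
  simp only [smul_eq_mul]
  linarith

-- Divided by the height, the defining inequality is a sublevel condition for a convex function.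
theorem convex_slimDomain (hc : 0 ≤ c) : Convex ℝ (slimDomain n c K) := by
  have hconvexOn : ConvexOn ℝ (halfSpace n) fun x : Fin n → ℝ =>
      axisDistSq x / x 0 + -(c * ((x 0 - 1) * (K - x 0))) :=
    convexOn_axisDistSq_div.add (((convexOn_quadratic hc).comp_linearMap
      (LinearMap.proj (R := ℝ) (φ := fun _ : Fin n => ℝ) 0)).subset (Set.subset_univ _)
        convex_halfSpace)
  have hsublevel : slimDomain n c K =
      {x ∈ halfSpace n | axisDistSq x / x 0 + -(c * ((x 0 - 1) * (K - x 0))) < 0} := by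
    ext x
    refine and_congr_right fun hx : 0 < x 0 => ?_
    have hfactor : slimDefining c K x =
        x 0 * (axisDistSq x / x 0 + -(c * ((x 0 - 1) * (K - x 0)))) := by
      rw [slimDefining]
      field_simp
      ring
    rw [hfactor]
    simp [mul_neg_iff, hx, hx.not_gt]
  rw [hsublevel]
  exact hconvexOn.convex_lt 0

theorem axisDistSq_le_of_mem_slimDomain (hc : 0 < c) (hK : 1 < K) (hx : x ∈ slimDomain n c K) :
    axisDistSq x ≤ c * K * x 0 ^ 2 := by
  obtain ⟨hlow, hhigh⟩ := mem_Ioo_of_mem_slimDomain hc hK hx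
  have hprofile : x 0 * (x 0 - 1) * (K - x 0) ≤ x 0 * x 0 * K := by
    gcongr <;> linarith
  calc axisDistSq x ≤ c * (x 0 * (x 0 - 1) * (K - x 0)) := (mem_slimDomain.1 hx).2.le
    _ ≤ c * (x 0 * x 0 * K) := by gcongr
    _ = c * K * x 0 ^ 2 := by ring

theorem norm_le_of_mem_slimDomain (hc : 0 < c) (hK : 1 < K) (hx : x ∈ slimDomain n c K) :
    ‖x‖ ≤ K + c * K ^ 3 := by
  obtain ⟨hlow, hhigh⟩ := mem_Ioo_of_mem_slimDomain hc hK hx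
  have hbound : 0 < c * K ^ 3 := by positivity
  rw [pi_norm_le_iff_of_nonneg (by positivity)]
  intro i
  rw [Real.norm_eq_abs]
  rcases eq_or_ne i 0 with rfl | hi
  · rw [abs_of_pos (by linarith)]
    linarith
  · have hsq : x i ^ 2 ≤ c * K ^ 3 :=
      calc x i ^ 2 ≤ c * K * x 0 ^ 2 :=
            (sq_le_axisDistSq x hi).trans (axisDistSq_le_of_mem_slimDomain hc hK hx)
        _ ≤ c * K * K ^ 2 := by gcongr
        _ = c * K ^ 3 := by ring
    exact abs_le_of_sq_le_sq (by nlinarith) (by positivity)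

theorem exists_mem_slimDomain (hc : 0 < c) {t : ℝ} (ht : t ∈ Set.Ioo 1 K) {k : Fin n}
    (hk : k ≠ 0) : ∃ x ∈ slimDomain n c K, x 0 = t ∧ x k ≠ 0 := by
  have hprofile : 0 < c * (t * (t - 1) * (K - t)) := by
    have : 0 < t - 1 := sub_pos.2 ht.1
    have : 0 < K - t := sub_pos.2 ht.2
    have : 0 < t := by linarith
    positivity
  obtain ⟨s, hs, hs_lt⟩ : ∃ s > 0, s ^ 2 < c * (t * (t - 1) * (K - t)) :=
    ⟨√(c * (t * (t - 1) * (K - t)) / 2), by positivity, by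
      rw [Real.sq_sqrt (by positivity)]; linarith⟩
  let x : Fin n → ℝ := Pi.single 0 t + Pi.single k s
  have hx0 : x 0 = t := by simp [x, hk.symm]
  have hxk : x k = s := by simp [x, hk]
  have haxis : axisDistSq x = s ^ 2 := by
    rw [axisDistSq, Finset.sum_eq_single k, hxk]
    · intro i hi hik
      simp [x, hik, (Finset.mem_erase.1 hi).1]
    · simp [hk]
  exact ⟨x, mem_slimDomain.2 ⟨by linarith [ht.1], by rwa [haxis, hx0]⟩, hx0, hxk ▸ hs.ne'⟩

theorem isStripDomain_slimDomain (hn : 2 ≤ n) (hc : 0 < c) (hK : 1 < K) :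
    IsStripDomain (slimDomain n c K) K where
  isOpen := isOpen_slimDomain
  convex := convex_slimDomain hc.le
  isBounded := isBounded_iff_forall_norm_le.2
    ⟨_, fun _ hx => norm_le_of_mem_slimDomain hc hK hx⟩
  nonempty := by
    obtain ⟨x, hx, -⟩ := exists_mem_slimDomain (n := n) (K := K) (t := (1 + K) / 2) hc
      ⟨by linarith, by linarith⟩ (k := ⟨1, hn⟩) (by simp [Fin.ext_iff])
    exact ⟨x, hx⟩
  one_lt _ hx := (mem_Ioo_of_mem_slimDomain hc hK hx).1
  lt _ hx := (mem_Ioo_of_mem_slimDomain hc hK hx).2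

end SlimDomain

section BoundedDomain

variable {n : ℕ} [NeZero n] {K : ℝ}

theorem hyperbolicMetric_quadraticForm_le {x : Fin n → ℝ} (hx : 1 ≤ x 0) (v : Fin n → ℝ) :
    v ⬝ᵥ (hyperbolicMetric n x *ᵥ v) ≤ v ⬝ᵥ v := by
  rw [hyperbolicMetric, Matrix.smul_mulVec, Matrix.one_mulVec, dotProduct_smul, smul_eq_mul]
  exact mul_le_of_le_one_left (Finset.sum_nonneg fun _ _ => mul_self_nonneg _)
    (inv_le_one_of_one_le₀ (one_le_pow₀ hx))

theorem riemDist_hyperbolicMetric_le {x y : Fin n → ℝ} (hx : 1 ≤ x 0) (hy : 1 ≤ y 0) :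
    riemDist (halfSpace n) (hyperbolicMetric n) x y ≤
      ENNReal.ofReal (√((y - x) ⬝ᵥ (y - x))) := by
  have hsegment : ∀ t ∈ Set.Icc (0 : ℝ) 1, 1 ≤ (x + t • (y - x)) 0 := fun t ht =>
    (convex_halfSpace_ge (LinearMap.proj (R := ℝ) (φ := fun _ : Fin n => ℝ) 0).isLinear
      1).add_smul_sub_mem hx hy ht
  have hderiv : ∀ t : ℝ, deriv (fun t : ℝ => x + t • (y - x)) t = y - x := fun t => by
    simpa using (((hasDerivAt_id t).smul_const (y - x)).const_add x).deriv
  refine (iInf₂_le (fun t : ℝ => x + t • (y - x)) ⟨by fun_prop, by simp, by simp,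
    fun t ht => one_pos.trans_le (hsegment t ht)⟩).trans ?_
  calc _ ≤ ∫⁻ _ in Set.Icc (0 : ℝ) 1, ENNReal.ofReal (√((y - x) ⬝ᵥ (y - x))) := by
        refine setLIntegral_mono' measurableSet_Icc fun t ht => ?_
        rw [hderiv]
        gcongr
        exact hyperbolicMetric_quadraticForm_le (hsegment t ht) _
    _ = ENNReal.ofReal (√((y - x) ⬝ᵥ (y - x))) := by simp

theorem IsStripDomain.isBoundedDomain {Ω : Set (Fin n → ℝ)} (hΩ : IsStripDomain Ω K) :
    IsBoundedDomain (halfSpace n) (hyperbolicMetric n) Ω where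
  isOpen := hΩ.isOpen
  isConnected := ⟨hΩ.nonempty, hΩ.convex.isPreconnected⟩
  subset := hΩ.pos
  bounded := by
    obtain ⟨R, hR⟩ := hΩ.isBounded.exists_norm_le
    refine ⟨Real.toNNReal √(∑ _i : Fin n, (2 * R) ^ 2), fun x hx y hy =>
      (riemDist_hyperbolicMetric_le (hΩ.one_lt x hx).le (hΩ.one_lt y hy).le).trans ?_⟩
    refine ENNReal.ofReal_le_ofReal (Real.sqrt_le_sqrt (Finset.sum_le_sum fun i _ => ?_))
    have hcoord : |(y - x) i| ≤ 2 * R :=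
      calc |(y - x) i| ≤ ‖y - x‖ := norm_le_pi_norm (y - x) i
        _ ≤ ‖y‖ + ‖x‖ := norm_sub_le y x
        _ ≤ 2 * R := by linarith [hR x hx, hR y hy]
    rw [← sq]
    exact sq_le_sq.2 (hcoord.trans (le_abs_self _))

end BoundedDomain

section Boundary

variable {n : ℕ} [NeZero n] {c K : ℝ} {p : Fin n → ℝ}

theorem pd_slimDefining (p : Fin n → ℝ) (i : Fin n) :
    pd i (slimDefining c K) p = pd i axisDistSq p -
      (1 : Matrix (Fin n) (Fin n) ℝ) i 0 * (c * ((2 * p 0 - 1) * (K - p 0) - p 0 * (p 0 - 1))) := by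
  have hprofile : HasDerivAt (fun t : ℝ => c * (t * (t - 1) * (K - t)))
      (c * ((2 * p 0 - 1) * (K - p 0) - p 0 * (p 0 - 1))) (p 0) := by
    have hid := hasDerivAt_id' (p 0)
    exact (((hid.fun_mul (hid.sub_const 1)).fun_mul (hid.const_sub K)).const_mul c).congr_deriv
      (by ring)
  have haxis : DifferentiableAt ℝ (axisDistSq (n := n)) p :=
    contDiff_axisDistSq.differentiable (by simp) p
  rw [← pd_comp_apply hprofile, pd, pd, pd, ← _root_.sub_apply,
    ← fderiv_fun_sub haxis (by fun_prop)]
  rfl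

-- If the differential vanishes, then `p` lies on the axis, where only the heights `1` and `K` are
-- possible; these are simple zeros of the profile `t (t - 1) (K - t)`.
theorem fderiv_slimDefining_ne_zero (hc : 0 < c) (hK : 1 < K) (hp : 0 < p 0)
    (hzero : slimDefining c K p = 0) : fderiv ℝ (slimDefining c K) p ≠ 0 := by
  intro hcrit
  have hpd : ∀ i, pd i (slimDefining c K) p = 0 := fun i => by rw [pd, hcrit]; rfl
  have haxis : axisDistSq p = 0 := axisDistSq_eq_zero_of_pd_eq_zero fun i hi => by
    simpa [pd_slimDefining, Matrix.one_apply, hi] using hpd i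
  have hprofile : (p 0 - 1) * (K - p 0) = 0 := by
    simpa [slimDefining, haxis, hc.ne', hp.ne'] using hzero
  have hderiv : (2 * p 0 - 1) * (K - p 0) - p 0 * (p 0 - 1) = 0 := by
    simpa [pd_slimDefining, pd_axisDistSq, hc.ne'] using hpd 0
  rcases mul_eq_zero.1 hprofile with h | h
  · rw [sub_eq_zero.1 h] at hderiv
    linarith
  · rw [← sub_eq_zero.1 h] at hderiv
    nlinarith

theorem slimDefining_eq_zero_of_mem_frontier (hp : 0 < p 0)
    (hfrontier : p ∈ frontier (slimDomain n c K)) : slimDefining c K p = 0 := by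
  have hclosure : closure (slimDomain n c K) ⊆ {x | slimDefining c K x ≤ 0} :=
    closure_minimal (fun x hx => hx.2.le)
      (isClosed_le contDiff_slimDefining.continuous continuous_const)
  refine le_antisymm (hclosure hfrontier.1) (not_lt.1 fun hlt => hfrontier.2 ?_)
  rw [isOpen_slimDomain.interior_eq]
  exact ⟨hp, hlt⟩

theorem hasC1Boundary_slimDomain (hn : 2 ≤ n) (hc : 0 < c) (hK : 1 < K) :
    HasC1Boundary (slimDomain n c K) := by
  intro p hfrontier
  have hp : 0 < p 0 := (isStripDomain_slimDomain hn hc hK).closure_subset hfrontier.1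
  exact ⟨halfSpace n, isOpen_halfSpace, hp, slimDefining c K,
    (contDiff_slimDefining.of_le (by simp)).contDiffOn,
    fderiv_slimDefining_ne_zero hc hK hp (slimDefining_eq_zero_of_mem_frontier hp hfrontier),
    Set.inter_eq_left.2 fun _ hx => hx.1⟩

end Boundary

/-! ### The volume of slim domains -/

section SolidOfRevolution

variable {m : ℕ}

/-- The volume of the Euclidean unit ball of `ℝᵐ`. -/
def unitBallVolume (m : ℕ) : ℝ := √Real.pi ^ m / Real.Gamma (m / 2 + 1)

theorem unitBallVolume_pos (m : ℕ) : 0 < unitBallVolume m :=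
  div_pos (by positivity) (Real.Gamma_pos_of_pos (by positivity))

theorem volume_sum_sq_lt [NeZero m] (s : ℝ) :
    volume {y : Fin m → ℝ | ∑ i, y i ^ 2 < s} =
      ENNReal.ofReal (√s ^ m) * ENNReal.ofReal (unitBallVolume m) := by
  have hball : {y : Fin m → ℝ | ∑ i, y i ^ 2 < s} =
      WithLp.toLp 2 ⁻¹' Metric.ball (0 : EuclideanSpace ℝ (Fin m)) √s := by
    ext y
    rw [Set.mem_preimage, mem_ball_zero_iff, EuclideanSpace.norm_eq,
      Real.sqrt_lt_sqrt_iff (Finset.sum_nonneg fun _ _ => sq_nonneg _)]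
    simp
  rw [hball, (PiLp.volume_preserving_toLp (Fin m)).measure_preimage
    measurableSet_ball.nullMeasurableSet, EuclideanSpace.volume_ball, Fintype.card_fin,
    ENNReal.ofReal_pow (Real.sqrt_nonneg s), unitBallVolume]

theorem axisDistSq_eq_sum_succ (x : Fin (m + 1) → ℝ) :
    axisDistSq x = ∑ i : Fin m, x i.succ ^ 2 := by
  have hsum := Finset.add_sum_erase Finset.univ (fun i => x i ^ 2) (Finset.mem_univ 0)
  rw [Fin.sum_univ_succ] at hsum
  exact add_left_cancel hsum

theorem setLIntegral_solidOfRevolution [NeZero m] {A : Set ℝ} (hA : MeasurableSet A) {r : ℝ → ℝ}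
    (hr : Measurable r) {f : ℝ → ENNReal} (hf : Measurable f) :
    ∫⁻ x in {x : Fin (m + 1) → ℝ | x 0 ∈ A ∧ axisDistSq x < r (x 0)}, f (x 0) =
      ENNReal.ofReal (unitBallVolume m) * ∫⁻ t in A, f t * ENNReal.ofReal (√(r t) ^ m) := by
  let T : Set (ℝ × (Fin m → ℝ)) := {q | q.1 ∈ A ∧ ∑ i, q.2 i ^ 2 < r q.1}
  have hradius : MeasurableSet {q : ℝ × (Fin m → ℝ) | ∑ i, q.2 i ^ 2 < r q.1} :=
    measurableSet_lt (by fun_prop) (by fun_prop)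
  have hT : MeasurableSet T := (measurable_fst hA).inter hradius
  have hsplit : {x : Fin (m + 1) → ℝ | x 0 ∈ A ∧ axisDistSq x < r (x 0)} =
      MeasurableEquiv.piFinSuccAbove (fun _ => ℝ) 0 ⁻¹' T := by
    ext x
    simp [T, axisDistSq_eq_sum_succ, Fin.tail]
  have hslice : ∀ t, ∫⁻ y, T.indicator (fun q => f q.1) (t, y) =
      A.indicator (fun t => ENNReal.ofReal (unitBallVolume m) *
        (f t * ENNReal.ofReal (√(r t) ^ m))) t := fun t => by
    by_cases ht : t ∈ A
    · have hsection : ∀ y : Fin m → ℝ, T.indicator (fun q => f q.1) (t, y) =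
          {y : Fin m → ℝ | ∑ i, y i ^ 2 < r t}.indicator (fun _ => f t) y := fun y => by
        by_cases hy : ∑ i, y i ^ 2 < r t <;> simp [T, ht, hy]
      simp_rw [hsection]
      rw [Set.indicator_of_mem ht,
        lintegral_indicator_const (measurableSet_lt (by fun_prop) (by fun_prop)), volume_sum_sq_lt]
      ring
    · simp [T, ht]
  calc _ = ∫⁻ q in T, f q.1 := by
        rw [hsplit]
        exact (volume_preserving_piFinSuccAbove (fun _ => ℝ) 0).setLIntegral_comp_preimage hT
          (by fun_prop : Measurable fun q : ℝ × (Fin m → ℝ) => f q.1)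
    _ = ∫⁻ t, ∫⁻ y, T.indicator (fun q => f q.1) (t, y) := by
        rw [← lintegral_indicator hT]
        exact lintegral_prod _
          ((by fun_prop : Measurable fun q : ℝ × (Fin m → ℝ) => f q.1).indicator hT).aemeasurable
    _ = _ := by
        simp_rw [hslice]
        rw [lintegral_indicator hA, lintegral_const_mul' _ _ ENNReal.ofReal_ne_top]

end SolidOfRevolution

section HeightDensity

variable {m : ℕ} {K t a b : ℝ}

/-- The density of the volume of `slimDomain (m + 1) (d ^ 2 / K) K` with respect to the height `t`,
up to the factor `unitBallVolume m * d ^ m`. -/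
def heightDensity (m : ℕ) (K t : ℝ) : ℝ :=
  (t ^ (m + 1))⁻¹ * √(t * (t - 1) * (K - t) / K) ^ m

theorem heightDensity_le (ht : t ∈ Set.Ioo 1 K) : heightDensity m K t ≤ t⁻¹ := by
  obtain ⟨hlow, hhigh⟩ := ht
  have ht0 : 0 < t := by linarith
  have hsqrt : √(t * (t - 1) * (K - t) / K) ≤ t := by
    rw [Real.sqrt_le_left ht0.le, div_le_iff₀ (by linarith), sq]
    gcongr <;> linarith
  calc heightDensity m K t ≤ (t ^ (m + 1))⁻¹ * t ^ m := by
        rw [heightDensity]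
        gcongr
    _ = t⁻¹ := by
        rw [pow_succ]
        field_simp

theorem le_heightDensity (ht : 2 ≤ t) (htK : t ≤ K / 2) :
    (2 ^ m)⁻¹ * t⁻¹ ≤ heightDensity m K t := by
  have ht0 : 0 < t := by linarith
  have hsqrt : t / 2 ≤ √(t * (t - 1) * (K - t) / K) := by
    apply Real.le_sqrt_of_sq_le
    rw [le_div_iff₀ (by linarith)]
    calc (t / 2) ^ 2 * K = t * (t / 2) * (K / 2) := by ring
      _ ≤ t * (t - 1) * (K - t) := by
          have : 0 ≤ t * (t - 1) := mul_nonneg ht0.le (by linarith)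
          gcongr <;> linarith
  calc (2 ^ m)⁻¹ * t⁻¹ = (t ^ (m + 1))⁻¹ * (t / 2) ^ m := by
        rw [pow_succ, div_pow]
        field_simp
    _ ≤ heightDensity m K t := by
        rw [heightDensity]
        gcongr

theorem lintegral_Ioo_inv (ha : 0 < a) (hab : a ≤ b) :
    ∫⁻ t in Set.Ioo a b, ENNReal.ofReal t⁻¹ = ENNReal.ofReal (Real.log (b / a)) := by
  have hinv : IntervalIntegrable (fun t : ℝ => t⁻¹) volume a b := by
    refine ContinuousOn.intervalIntegrable (continuousOn_inv₀.mono fun t ht => ?_)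
    rw [Set.uIcc_of_le hab] at ht
    exact (ha.trans_le ht.1).ne'
  rw [← integral_inv_of_pos ha (ha.trans_le hab), intervalIntegral.integral_of_le hab,
    integral_Ioc_eq_integral_Ioo, ofReal_integral_eq_lintegral_ofReal]
  · exact (intervalIntegrable_iff_integrableOn_Ioo_of_le hab).1 hinv
  · filter_upwards [ae_restrict_mem measurableSet_Ioo] with t ht
    exact (inv_pos.2 (ha.trans ht.1)).le

theorem lintegral_heightDensity_le (ha : 1 ≤ a) (hab : a ≤ b) (hb : b ≤ K) :
    ∫⁻ t in Set.Ioo a b, ENNReal.ofReal (heightDensity m K t) ≤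
      ENNReal.ofReal (Real.log (b / a)) := by
  rw [← lintegral_Ioo_inv (by linarith) hab]
  exact setLIntegral_mono' measurableSet_Ioo fun t ht => ENNReal.ofReal_le_ofReal
    (heightDensity_le (Set.Ioo_subset_Ioo ha hb ht))

theorem le_lintegral_heightDensity (ha : 2 ≤ a) (hab : a ≤ b) (hb : b ≤ K / 2) :
    ENNReal.ofReal ((2 ^ m)⁻¹ * Real.log (b / a)) ≤
      ∫⁻ t in Set.Ioo a b, ENNReal.ofReal (heightDensity m K t) := by
  rw [ENNReal.ofReal_mul (by positivity), ← lintegral_Ioo_inv (by linarith) hab,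
    ← lintegral_const_mul' _ _ ENNReal.ofReal_ne_top]
  refine setLIntegral_mono' measurableSet_Ioo fun t ht => ?_
  rw [← ENNReal.ofReal_mul (by positivity)]
  exact ENNReal.ofReal_le_ofReal (le_heightDensity (ha.trans ht.1.le) (ht.2.le.trans hb))

end HeightDensity

section SlimVolume

/-- The part of space between the heights `a` and `b`. -/
def heightSlab (n : ℕ) [NeZero n] (a b : ℝ) : Set (Fin n → ℝ) := {x | x 0 ∈ Set.Ioo a b}

theorem measurableSet_heightSlab {n : ℕ} [NeZero n] (a b : ℝ) :
    MeasurableSet (heightSlab n a b) :=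
  measurable_pi_apply 0 measurableSet_Ioo

variable {m : ℕ} [NeZero m] {d K a b : ℝ}

theorem riemVolume_slimDomain_inter_heightSlab (hd : 0 ≤ d) (ha : 0 ≤ a) :
    riemVolume (hyperbolicMetric (m + 1))
        (slimDomain (m + 1) (d ^ 2 / K) K ∩ heightSlab (m + 1) a b) =
      ENNReal.ofReal (unitBallVolume m * d ^ m) *
        ∫⁻ t in Set.Ioo a b, ENNReal.ofReal (heightDensity m K t) := by
  have hset : slimDomain (m + 1) (d ^ 2 / K) K ∩ heightSlab (m + 1) a b =
      {x | x 0 ∈ Set.Ioo a b ∧ axisDistSq x < d ^ 2 / K * (x 0 * (x 0 - 1) * (K - x 0))} := by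
    ext x
    rw [Set.mem_inter_iff, mem_slimDomain]
    exact ⟨fun h => ⟨h.2, h.1.2⟩, fun h => ⟨⟨ha.trans_lt h.1.1, h.2⟩, h.1⟩⟩
  have hwidth : ∀ t : ℝ, √(d ^ 2 / K * (t * (t - 1) * (K - t))) =
      d * √(t * (t - 1) * (K - t) / K) := fun t => by
    rw [div_mul_eq_mul_div, mul_div_assoc, Real.sqrt_mul (sq_nonneg d), Real.sqrt_sq hd]
  have hmeas : MeasurableSet
      (slimDomain (m + 1) (d ^ 2 / K) K ∩ heightSlab (m + 1) a b) :=
    isOpen_slimDomain.measurableSet.inter (measurableSet_heightSlab a b)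
  calc _ = ∫⁻ x in slimDomain (m + 1) (d ^ 2 / K) K ∩ heightSlab (m + 1) a b,
          ENNReal.ofReal ((x 0 ^ (m + 1))⁻¹) := by
        rw [riemVolume, withDensity_apply _ hmeas]
        refine setLIntegral_congr_fun hmeas fun x hx => ?_
        rw [sqrt_det_hyperbolicMetric hx.1.1]
    _ = ENNReal.ofReal (unitBallVolume m) * ∫⁻ t in Set.Ioo a b,
          ENNReal.ofReal ((t ^ (m + 1))⁻¹) *
            ENNReal.ofReal (√(d ^ 2 / K * (t * (t - 1) * (K - t))) ^ m) := by
        rw [hset]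
        exact setLIntegral_solidOfRevolution measurableSet_Ioo
          (r := fun t => d ^ 2 / K * (t * (t - 1) * (K - t))) (by fun_prop)
          (f := fun t => ENNReal.ofReal ((t ^ (m + 1))⁻¹)) (by fun_prop)
    _ = _ := by
        rw [ENNReal.ofReal_mul (unitBallVolume_pos m).le, mul_assoc,
          ← lintegral_const_mul' (ENNReal.ofReal (d ^ m)) _ ENNReal.ofReal_ne_top]
        refine congrArg _ (setLIntegral_congr_fun measurableSet_Ioo fun t ht => ?_)
        have ht0 : 0 < t := ha.trans_lt ht.1
        rw [hwidth, ← ENNReal.ofReal_mul (by positivity), ← ENNReal.ofReal_mul (by positivity),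
          heightDensity]
        congr 1
        ring

theorem hypMeasure_heightSlab_le (hd : 0 ≤ d) (ha : 1 ≤ a) (hab : a ≤ b) (hb : b ≤ K) :
    hypMeasure (slimDomain (m + 1) (d ^ 2 / K) K) (heightSlab (m + 1) a b) ≤
      ENNReal.ofReal (unitBallVolume m * d ^ m * Real.log (b / a)) := by
  have := unitBallVolume_pos m
  rw [hypMeasure, Measure.restrict_apply (measurableSet_heightSlab a b), Set.inter_comm,
    riemVolume_slimDomain_inter_heightSlab hd (by linarith),
    ENNReal.ofReal_mul (p := unitBallVolume m * d ^ m) (by positivity)]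
  gcongr
  exact lintegral_heightDensity_le ha hab hb

theorem le_hypMeasure_heightSlab (hd : 0 ≤ d) (ha : 2 ≤ a) (hab : a ≤ b) (hb : b ≤ K / 2) :
    ENNReal.ofReal (unitBallVolume m * d ^ m * ((2 ^ m)⁻¹ * Real.log (b / a))) ≤
      hypMeasure (slimDomain (m + 1) (d ^ 2 / K) K) (heightSlab (m + 1) a b) := by
  have := unitBallVolume_pos m
  rw [hypMeasure, Measure.restrict_apply (measurableSet_heightSlab a b), Set.inter_comm,
    riemVolume_slimDomain_inter_heightSlab hd (by linarith),
    ENNReal.ofReal_mul (p := unitBallVolume m * d ^ m) (by positivity)]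
  gcongr
  exact le_lintegral_heightDensity ha hab hb

theorem hypMeasure_heightSlab_doubling {s l : ℝ} (hd : 0 ≤ d) (hl : 0 ≤ l)
    (hlow : 2 ≤ Real.exp (s - l)) (hhigh : Real.exp (s + l) ≤ K / 2) :
    hypMeasure (slimDomain (m + 1) (d ^ 2 / K) K)
        (heightSlab (m + 1) (Real.exp (s - l)) (Real.exp (s + l))) ≤
      2 ^ (m + 1) * hypMeasure (slimDomain (m + 1) (d ^ 2 / K) K)
        (heightSlab (m + 1) (Real.exp (s - l / 2)) (Real.exp (s + l / 2))) := by
  have hinner : ENNReal.ofReal (unitBallVolume m * d ^ m * ((2 ^ m)⁻¹ * l)) ≤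
      hypMeasure (slimDomain (m + 1) (d ^ 2 / K) K)
        (heightSlab (m + 1) (Real.exp (s - l / 2)) (Real.exp (s + l / 2))) := by
    have hle := le_hypMeasure_heightSlab (m := m) (K := K) hd
      (hlow.trans (Real.exp_le_exp.2 (by linarith : s - l ≤ s - l / 2)))
      (Real.exp_le_exp.2 (by linarith : s - l / 2 ≤ s + l / 2))
      ((Real.exp_le_exp.2 (by linarith : s + l / 2 ≤ s + l)).trans hhigh)
    rwa [← Real.exp_sub, Real.log_exp, show s + l / 2 - (s - l / 2) = l by ring] at hle
  calc _ ≤ ENNReal.ofReal (unitBallVolume m * d ^ m * (2 * l)) := by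
        have hle := hypMeasure_heightSlab_le (m := m) (K := K) hd (by linarith)
          (Real.exp_le_exp.2 (by linarith : s - l ≤ s + l))
          (by linarith [Real.exp_pos (s + l)])
        rwa [← Real.exp_sub, Real.log_exp, show s + l - (s - l) = 2 * l by ring] at hle
    _ = 2 ^ (m + 1) * ENNReal.ofReal (unitBallVolume m * d ^ m * ((2 ^ m)⁻¹ * l)) := by
        rw [← ENNReal.ofReal_ofNat, ← ENNReal.ofReal_pow zero_le_two,
          ← ENNReal.ofReal_mul (by positivity)]
        congr 1
        field_simp
        ring
    _ ≤ _ := by gcongr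

theorem eventually_exists_riemVolume_slimDomain_eq_one {η : ℝ} (hη : 0 < η) :
    ∀ᶠ K in atTop, ∃ d, 0 < d ∧ d ≤ η ∧
      riemVolume (hyperbolicMetric (m + 1)) (slimDomain (m + 1) (d ^ 2 / K) K) = 1 := by
  set β := unitBallVolume m with hβ_def
  have hβ : 0 < β := unitBallVolume_pos m
  have hlarge : Tendsto (fun K : ℝ => β * η ^ m * ((2 ^ m)⁻¹ * Real.log (K / 2 / 2)))
      atTop atTop :=
    ((Real.tendsto_log_atTop.comp ((tendsto_id.atTop_div_const two_pos).atTop_div_const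
      two_pos)).const_mul_atTop (by positivity)).const_mul_atTop (by positivity)
  filter_upwards [hlarge.eventually_ge_atTop 1, eventually_ge_atTop 4] with K hlog hK
  set I := ∫⁻ t in Set.Ioo 1 K, ENNReal.ofReal (heightDensity m K t) with hI
  have hI_top : I ≠ ⊤ := ne_top_of_le_ne_top ENNReal.ofReal_ne_top
    (lintegral_heightDensity_le le_rfl (by linarith) le_rfl)
  have hI_ge : (2 ^ m)⁻¹ * Real.log (K / 2 / 2) ≤ I.toReal :=
    (ENNReal.ofReal_le_iff_le_toReal hI_top).1 <|
      (le_lintegral_heightDensity le_rfl (by linarith) le_rfl).trans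
        (lintegral_mono_set (Set.Ioo_subset_Ioo one_le_two (by linarith)))
  have hone : 1 ≤ β * η ^ m * I.toReal := hlog.trans (by gcongr)
  have hI_pos : 0 < I.toReal :=
    pos_of_mul_pos_right (one_pos.trans_le hone) (by positivity)
  obtain ⟨d, hd, hdm⟩ : ∃ d : ℝ, 0 < d ∧ d ^ m = (β * I.toReal)⁻¹ :=
    ⟨((β * I.toReal)⁻¹) ^ ((m : ℝ)⁻¹), by positivity,
      Real.rpow_inv_natCast_pow (by positivity) (NeZero.ne m)⟩
  refine ⟨d, hd, le_of_pow_le_pow_left₀ (NeZero.ne m) hη.le ?_, ?_⟩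
  · rw [hdm, inv_le_iff_one_le_mul₀ (by positivity)]
    linarith
  · have hfull : slimDomain (m + 1) (d ^ 2 / K) K ∩ heightSlab (m + 1) 1 K =
        slimDomain (m + 1) (d ^ 2 / K) K := Set.inter_eq_left.2 fun x hx =>
      mem_Ioo_of_mem_slimDomain (by positivity) (by linarith) hx
    rw [← hfull, riemVolume_slimDomain_inter_heightSlab hd.le zero_le_one, ← hI,
      ← ENNReal.ofReal_toReal hI_top, ← ENNReal.ofReal_mul (by positivity), hdm,
      ← ENNReal.ofReal_one]
    congr 1
    rw [← hβ_def]
    field_simp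

end SlimVolume

/-! ### Trial functions odd across a totally geodesic hyperplane -/

section TrialFunction

variable {n : ℕ} [NeZero n] {k : Fin n} {x : Fin n → ℝ}

theorem jetOf_eq_zero_of_eventuallyEq_zero {f : (Fin n → ℝ) → ℝ} (hf : f =ᶠ[𝓝 x] 0)
    (a : JetIndex n) : jetOf f a x = 0 := by
  have hzero : ∀ i, pd i (0 : (Fin n → ℝ) → ℝ) = 0 := fun i => by
    ext y
    simp [pd]
  have hpd : ∀ i, pd i f =ᶠ[𝓝 x] 0 := fun i => by
    filter_upwards [hf.eventuallyEq_nhds] with y hy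
    rw [pd_congr hy, hzero]
  have hpdpd : ∀ i j, pd i (pd j f) x = 0 := fun i j => by
    rw [pd_congr (hpd j), hzero, Pi.zero_apply]
  rcases a with _ | i | ⟨i, j⟩
  · simp [jetOf, jetComp, hf.eq_of_nhds]
  · simp [jetOf, jetComp, differential, (hpd i).eq_of_nhds]
  · simp [jetOf, jetComp, hessian, hpdpd, (hpd _).eq_of_nhds]

theorem neumannDensity_eq_zero_of_eventuallyEq_zero {f : (Fin n → ℝ) → ℝ} (hf : f =ᶠ[𝓝 x] 0) :
    neumannDensity f x = 0 := by
  simp [neumannDensity, jetOf_eq_zero_of_eventuallyEq_zero hf]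

section Profile

variable {ψ ψ₁ ψ₂ : ℝ → ℝ}

theorem pd_coord_mul_profile {f' : ℝ} (hψ : HasDerivAt ψ f' (x 0)) (i : Fin n) :
    pd i (fun y => y k * ψ (y 0)) x =
      (if i = 0 then x k * f' else 0) + (if i = k then ψ (x 0) else 0) := by
  have hdiff : DifferentiableAt ℝ (fun y : Fin n → ℝ => ψ (y 0)) x :=
    hψ.differentiableAt.comp x (differentiableAt_apply 0 x)
  rw [pd_coord_mul hdiff, pd_comp_apply hψ, Matrix.one_apply, Matrix.one_apply]
  split_ifs <;> ring

theorem pd_pd_coord_mul_profile (h₁ : ∀ t, 0 < t → HasDerivAt ψ (ψ₁ t) t)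
    (h₂ : ∀ t, 0 < t → HasDerivAt ψ₁ (ψ₂ t) t) (hk : k ≠ 0) (hx : 0 < x 0) (i j : Fin n) :
    pd i (pd j fun y => y k * ψ (y 0)) x =
      (if j = 0 then (if i = 0 then x k * ψ₂ (x 0) else 0) + (if i = k then ψ₁ (x 0) else 0)
        else 0) + (if j = k then if i = 0 then ψ₁ (x 0) else 0 else 0) := by
  have hfirst : pd j (fun y : Fin n → ℝ => y k * ψ (y 0)) =ᶠ[𝓝 x] fun y =>
      (if j = 0 then y k * ψ₁ (y 0) else 0) + (if j = k then ψ (y 0) else 0) := by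
    filter_upwards [isOpen_halfSpace.mem_nhds hx] with y hy
    exact pd_coord_mul_profile (h₁ _ hy) j
  rw [pd_congr hfirst]
  by_cases hj : j = 0
  · subst hj
    simp only [if_true, if_neg hk.symm, add_zero]
    exact pd_coord_mul_profile (h₂ _ hx) i
  · by_cases hjk : j = k
    · simp only [if_neg hj, if_pos hjk, zero_add]
      rw [pd_comp_apply (h₁ _ hx), Matrix.one_apply, ite_mul, one_mul, zero_mul]
    · simp [hj, hjk, pd]

theorem hessian_coord_mul_profile (h₁ : ∀ t, 0 < t → HasDerivAt ψ (ψ₁ t) t)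
    (h₂ : ∀ t, 0 < t → HasDerivAt ψ₁ (ψ₂ t) t) (hk : k ≠ 0) (hx : 0 < x 0) (i j : Fin n) :
    hessian (hyperbolicMetric n) (fun y => y k * ψ (y 0)) x i j =
      (if i = 0 then if j = 0 then x k * (ψ₂ (x 0) + (x 0)⁻¹ * ψ₁ (x 0)) else 0 else 0) +
      (if i = 0 then if j = k then ψ₁ (x 0) + (x 0)⁻¹ * ψ (x 0) else 0 else 0) +
      (if i = k then if j = 0 then ψ₁ (x 0) + (x 0)⁻¹ * ψ (x 0) else 0 else 0) +
      (if i = j then if i = 0 then 0 else -(x k * (x 0)⁻¹ * ψ₁ (x 0)) else 0) := by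
  rw [hessian_hyperbolicMetric hx.ne', pd_pd_coord_mul_profile h₁ h₂ hk hx]
  simp only [pd_coord_mul_profile (h₁ _ hx), Matrix.one_apply]
  by_cases hi : i = 0 <;> by_cases hj : j = 0 <;> by_cases hik : i = k <;> by_cases hjk : j = k <;>
    by_cases hij : i = j <;> grind

theorem sum_sq_gradJet_coord_mul_profile {f' : ℝ} (hψ : HasDerivAt ψ f' (x 0)) (hk : k ≠ 0) :
    ∑ i, jetOf (fun y => y k * ψ (y 0)) (.inr (.inl i)) x ^ 2 =
      x 0 ^ 2 * ((x k * f') ^ 2 + ψ (x 0) ^ 2) := by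
  have hterm : ∀ i, jetOf (fun y => y k * ψ (y 0)) (.inr (.inl i)) x ^ 2 =
      x 0 ^ 2 * ((if i = 0 then (x k * f') ^ 2 else 0) + (if i = k then ψ (x 0) ^ 2 else 0)) :=
    fun i => by
      simp only [jetOf, jetComp, differential, pd_coord_mul_profile hψ]
      grind
  simp_rw [hterm, ← Finset.mul_sum, Finset.sum_add_distrib, Finset.sum_ite_eq', Finset.mem_univ,
    if_true]

theorem sum_sq_hessJet_coord_mul_profile (h₁ : ∀ t, 0 < t → HasDerivAt ψ (ψ₁ t) t)
    (h₂ : ∀ t, 0 < t → HasDerivAt ψ₁ (ψ₂ t) t) (hk : k ≠ 0) (hx : 0 < x 0) :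
    ∑ ij, jetOf (fun y => y k * ψ (y 0)) (.inr (.inr ij)) x ^ 2 =
      x 0 ^ 4 * ((x k * (ψ₂ (x 0) + (x 0)⁻¹ * ψ₁ (x 0))) ^ 2 +
        2 * (ψ₁ (x 0) + (x 0)⁻¹ * ψ (x 0)) ^ 2 +
        ((n : ℝ) - 1) * (x k * (x 0)⁻¹ * ψ₁ (x 0)) ^ 2) := by
  set A := x k * (ψ₂ (x 0) + (x 0)⁻¹ * ψ₁ (x 0)) with hA
  set B := ψ₁ (x 0) + (x 0)⁻¹ * ψ (x 0) with hB
  set C := x k * (x 0)⁻¹ * ψ₁ (x 0) with hC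
  have hterm : ∀ i j, jetOf (fun y => y k * ψ (y 0)) (.inr (.inr (i, j))) x ^ 2 =
      x 0 ^ 4 * ((if i = 0 then if j = 0 then A ^ 2 else 0 else 0) +
        (if i = 0 then if j = k then B ^ 2 else 0 else 0) +
        (if i = k then if j = 0 then B ^ 2 else 0 else 0) +
        (if i = j then C ^ 2 - (if i = 0 then C ^ 2 else 0) else 0)) := fun i j => by
    simp only [jetOf, jetComp, hessian_coord_mul_profile h₁ h₂ hk hx, ← hA, ← hB, ← hC]
    by_cases hi : i = 0 <;> by_cases hj : j = 0 <;> by_cases hik : i = k <;>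
      by_cases hjk : j = k <;> by_cases hij : i = j <;> grind
  rw [Fintype.sum_prod_type]
  simp_rw [hterm, ← Finset.mul_sum, Finset.sum_add_distrib, Finset.sum_ite_irrel,
    Finset.sum_const_zero, Finset.sum_ite_eq', Finset.sum_ite_eq, Finset.mem_univ, if_true,
    Finset.sum_sub_distrib, Finset.sum_ite_eq', Finset.mem_univ, if_true, Finset.sum_const,
    Finset.card_univ, Fintype.card_fin, nsmul_eq_mul]
  ring

-- The gradient term `(x k * ψ₁) ^ 2` is cancelled by the diagonal of the Hessian.
theorem neumannDensity_coord_mul_profile (h₁ : ∀ t, 0 < t → HasDerivAt ψ (ψ₁ t) t)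
    (h₂ : ∀ t, 0 < t → HasDerivAt ψ₁ (ψ₂ t) t) (hk : k ≠ 0) (hx : 0 < x 0) :
    neumannDensity (fun y => y k * ψ (y 0)) x =
      x 0 ^ 4 * ((x k * (ψ₂ (x 0) + (x 0)⁻¹ * ψ₁ (x 0))) ^ 2 +
        2 * (ψ₁ (x 0) + (x 0)⁻¹ * ψ (x 0)) ^ 2) - ((n : ℝ) - 1) * (x 0 ^ 2 * ψ (x 0) ^ 2) := by
  rw [neumannDensity, sum_sq_hessJet_coord_mul_profile h₁ h₂ hk hx,
    sum_sq_gradJet_coord_mul_profile (h₁ _ hx) hk]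
  field_simp
  ring

end Profile

section LogTrial

variable {φ φ₁ φ₂ : ℝ → ℝ}

/-- The trial function `y_k / y₀ * φ (log y₀)`. The factor `y_k / y₀` vanishes on the totally
geodesic hyperplane `y_k = 0` and has unit gradient and zero Hessian along the geodesic on which
all coordinates but `y₀` vanish; `φ` cuts it off in the arc length `log y₀` of that geodesic. -/
def logTrial (k : Fin n) (φ : ℝ → ℝ) (y : Fin n → ℝ) : ℝ := y k * (φ (Real.log (y 0)) / y 0)

theorem contDiffOn_logTrial (hφ : ContDiff ℝ ∞ φ) :
    ContDiffOn ℝ ∞ (logTrial k φ) (halfSpace n) := by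
  have hne : ∀ y ∈ halfSpace n, y 0 ≠ 0 := fun y hy => ne_of_gt hy
  have hheight : ContDiffOn ℝ ∞ (fun y : Fin n → ℝ => y 0) (halfSpace n) := by fun_prop
  have hcoord : ContDiffOn ℝ ∞ (fun y : Fin n → ℝ => y k) (halfSpace n) := by fun_prop
  exact hcoord.mul ((hφ.comp_contDiffOn (hheight.log hne)).div hheight hne)

theorem hasDerivAt_comp_log_div_pow {φ' t : ℝ} (hφ : HasDerivAt φ φ' (Real.log t)) (ht : 0 < t)
    (p : ℕ) : HasDerivAt (fun t => φ (Real.log t) / t ^ p)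
      ((φ' - p * φ (Real.log t)) / t ^ (p + 1)) t := by
  have hpow : HasDerivAt (fun t : ℝ => t ^ p) (p * t ^ p / t) t := by
    refine (hasDerivAt_pow p t).congr_deriv ?_
    cases p <;> simp [pow_succ, ht.ne', mul_div_assoc]
  refine ((hφ.comp t (Real.hasDerivAt_log ht.ne')).fun_div hpow (by positivity)).congr_deriv ?_
  simp only [Function.comp_apply]
  field_simp
  ring

theorem neumannDensity_logTrial (h₁ : ∀ σ, HasDerivAt φ (φ₁ σ) σ)
    (h₂ : ∀ σ, HasDerivAt φ₁ (φ₂ σ) σ) (hk : k ≠ 0) (hx : 0 < x 0) :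
    neumannDensity (logTrial k φ) x =
      (x k / x 0) ^ 2 * (φ₂ (Real.log (x 0)) - 2 * φ₁ (Real.log (x 0)) + φ (Real.log (x 0))) ^ 2 +
        2 * φ₁ (Real.log (x 0)) ^ 2 - ((n : ℝ) - 1) * φ (Real.log (x 0)) ^ 2 := by
  have hψ₁ : ∀ t : ℝ, 0 < t → HasDerivAt (fun t => φ (Real.log t) / t)
      ((φ₁ (Real.log t) - φ (Real.log t)) / t ^ 2) t := fun t ht => by
    simpa using hasDerivAt_comp_log_div_pow (h₁ _) ht 1
  have hψ₂ : ∀ t : ℝ, 0 < t → HasDerivAt (fun t => (φ₁ (Real.log t) - φ (Real.log t)) / t ^ 2)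
      ((φ₂ (Real.log t) - φ₁ (Real.log t) - 2 * (φ₁ (Real.log t) - φ (Real.log t))) / t ^ 3) t :=
    fun t ht => by
      simpa using hasDerivAt_comp_log_div_pow ((h₂ _).fun_sub (h₁ _)) ht 2
  refine (neumannDensity_coord_mul_profile hψ₁ hψ₂ hk hx).trans ?_
  field_simp
  ring

theorem logTrial_eventuallyEq_zero {a b : ℝ} (hφ : tsupport φ ⊆ Set.Ioo a b) (hx : 0 < x 0)
    (hout : x ∉ heightSlab n (Real.exp a) (Real.exp b)) : logTrial k φ =ᶠ[𝓝 x] 0 := by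
  have hlog : Real.log (x 0) ∉ tsupport φ := fun hmem => hout <| by
    obtain ⟨ha, hb⟩ := hφ hmem
    exact ⟨(Real.lt_log_iff_exp_lt hx).1 ha, (Real.log_lt_iff_lt_exp hx).1 hb⟩
  have hcont : ContinuousAt (fun y : Fin n → ℝ => Real.log (y 0)) x :=
    (continuousAt_apply 0 x).log hx.ne'
  filter_upwards [hcont.eventually (notMem_tsupport_iff_eventuallyEq.1 hlog)] with y hy
  simp [logTrial, hy]

end LogTrial

end TrialFunction

section Cutoff

/-- `φ` is a smooth cutoff of the interval of radius `l` about `s`: it is supported in this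
interval, equals `1` on the concentric interval of half the length, and its derivatives of order
`i = 0, 1, 2` are at most `B / l ^ i`. -/
structure IsCutoff (B s l : ℝ) (φ : ℝ → ℝ) : Prop where
  contDiff : ContDiff ℝ ∞ φ
  eq_one : ∀ σ ∈ Set.Icc (s - l / 2) (s + l / 2), φ σ = 1
  tsupport_subset : tsupport φ ⊆ Set.Ioo (s - l) (s + l)
  abs_apply_le : ∀ σ, |φ σ| ≤ B
  abs_deriv_le : ∀ σ, |deriv φ σ| ≤ B / l
  abs_deriv_deriv_le : ∀ σ, |deriv (deriv φ) σ| ≤ B / l ^ 2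

theorem exists_isCutoff_zero_one : ∃ (B : ℝ) (χ : ℝ → ℝ), IsCutoff B 0 1 χ := by
  let χ : ContDiffBump (0 : ℝ) := ⟨1 / 2, 3 / 4, by norm_num, by norm_num⟩
  have hsmooth : ContDiff ℝ ∞ χ := χ.contDiff
  have hcompact : HasCompactSupport χ := χ.hasCompactSupport
  obtain ⟨B₀, hB₀⟩ := hsmooth.continuous.bounded_above_of_compact_support hcompact
  obtain ⟨B₁, hB₁⟩ :=
    (hsmooth.iterate_deriv 1).continuous.bounded_above_of_compact_support hcompact.deriv
  obtain ⟨B₂, hB₂⟩ :=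
    (hsmooth.iterate_deriv 2).continuous.bounded_above_of_compact_support hcompact.deriv.deriv
  refine ⟨max B₀ (max B₁ B₂), χ, hsmooth, fun σ hσ => χ.one_of_mem_closedBall ?_, ?_,
    fun σ => (hB₀ σ).trans (by simp), fun σ => (hB₁ σ).trans (by simp),
    fun σ => (hB₂ σ).trans (by simp)⟩
  · rw [Real.closedBall_eq_Icc]
    exact hσ
  · rw [χ.tsupport_eq, Real.closedBall_eq_Icc]
    exact Set.Icc_subset_Ioo (by norm_num [χ]) (by norm_num [χ])

variable {B l : ℝ} {χ : ℝ → ℝ}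

theorem IsCutoff.rescale (hχ : IsCutoff B 0 1 χ) (s : ℝ) (hl : 0 < l) :
    IsCutoff B s l fun σ => χ (l⁻¹ * (σ - s)) := by
  have hderiv : ∀ (c : ℝ) (f : ℝ → ℝ), deriv (fun σ => c * f (l⁻¹ * (σ - s))) =
      fun σ => c * l⁻¹ * deriv f (l⁻¹ * (σ - s)) := fun c f => by
    ext σ
    rw [deriv_const_mul_field', mul_assoc]
    exact congrArg (c * ·) ((deriv_comp_sub_const (fun τ => f (l⁻¹ * τ)) s σ).trans
      (deriv_comp_mul_left l⁻¹ f (σ - s)))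
  have hderiv_one : deriv (fun σ => χ (l⁻¹ * (σ - s))) =
      fun σ => l⁻¹ * deriv χ (l⁻¹ * (σ - s)) := by simpa using hderiv 1 χ
  refine ⟨hχ.contDiff.comp (by fun_prop), fun σ hσ => hχ.eq_one _ ?_, fun σ hσ => ?_,
    fun σ => hχ.abs_apply_le _, fun σ => ?_, fun σ => ?_⟩
  · rw [Set.mem_Icc, le_inv_mul_iff₀ hl, inv_mul_le_iff₀ hl]
    constructor <;> linarith [hσ.1, hσ.2]
  · have hcont : Continuous fun σ => l⁻¹ * (σ - s) := by fun_prop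
    have hmem := hχ.tsupport_subset (tsupport_comp_subset_preimage χ hcont hσ)
    rw [Set.mem_Ioo, lt_inv_mul_iff₀ hl, inv_mul_lt_iff₀ hl] at hmem
    constructor <;> linarith [hmem.1, hmem.2]
  · rw [hderiv_one, abs_mul, abs_of_pos (inv_pos.2 hl), div_eq_inv_mul]
    gcongr
    simpa using hχ.abs_deriv_le _
  · rw [hderiv_one, hderiv, ← sq, abs_mul, abs_of_pos (by positivity), inv_pow, div_eq_inv_mul]
    gcongr
    simpa using hχ.abs_deriv_deriv_le _

theorem exists_isCutoff : ∃ B, 1 ≤ B ∧ ∀ s l : ℝ, 0 < l → ∃ φ, IsCutoff B s l φ := by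
  obtain ⟨B, χ, hχ⟩ := exists_isCutoff_zero_one
  refine ⟨B, ?_, fun s l hl => ⟨_, hχ.rescale s hl⟩⟩
  have hle := hχ.abs_apply_le 0
  rwa [hχ.eq_one 0 (by norm_num), abs_one] at hle

end Cutoff

/-! ### Trial functions on slim domains -/

section RayleighQuotient

variable {n : ℕ} [NeZero n] {k : Fin n} {x : Fin n → ℝ} {Ω : Set (Fin n → ℝ)}
  {B K M d l s : ℝ} {φ : ℝ → ℝ}

theorem IsStripDomain.integral_sq_ne_zero (hΩ : IsStripDomain Ω K) {f : (Fin n → ℝ) → ℝ}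
    (hf : ContinuousOn f (halfSpace n)) (hx : x ∈ Ω) (hne : f x ≠ 0) :
    ∫ y, f y ^ 2 ∂hypMeasure Ω ≠ 0 := fun hzero => by
  have hae : (fun y => f y ^ 2) =ᵐ[hypMeasure Ω] 0 :=
    (integral_eq_zero_iff_of_nonneg (fun y => sq_nonneg (f y)) (hΩ.memLp hf).integrable_sq).1 hzero
  have hsq : f x ^ 2 = 0 :=
    hΩ.eqOn_of_ae_eq hae ((hf.mono hΩ.pos).pow 2) continuousOn_const hx
  exact hne (sq_eq_zero_iff.1 hsq)

theorem IsCutoff.neumannDensity_logTrial_add_le (hφ : IsCutoff B s l φ) (hl : 1 ≤ l) (hM : 0 ≤ M)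
    (hk : k ≠ 0) (hx : 0 < x 0) (hxk : x k ^ 2 ≤ d ^ 2 * x 0 ^ 2) :
    neumannDensity (logTrial k φ) x + M * logTrial k φ x ^ 2 ≤
      d ^ 2 * B ^ 2 * (16 + M) + 2 * B ^ 2 / l ^ 2 - φ (Real.log (x 0)) ^ 2 := by
  have hderiv : ∀ σ, HasDerivAt φ (deriv φ σ) σ := fun σ =>
    (hφ.contDiff.differentiable (by simp) σ).hasDerivAt
  have hderiv_deriv : ∀ σ, HasDerivAt (deriv φ) (deriv (deriv φ) σ) σ := fun σ =>
    ((hφ.contDiff.iterate_deriv 1).differentiable (by simp) σ).hasDerivAt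
  rw [neumannDensity_logTrial hderiv hderiv_deriv hk hx, logTrial]
  set σ := Real.log (x 0)
  have hn : (2 : ℝ) ≤ n := by exact_mod_cast Fin.nontrivial_iff_two_le.1 ⟨k, 0, hk⟩
  have hB : 0 ≤ B := (abs_nonneg _).trans (hφ.abs_apply_le σ)
  have hφ₁ := (hφ.abs_deriv_le σ).trans (div_le_self hB hl)
  have hφ₂ := (hφ.abs_deriv_deriv_le σ).trans (div_le_self hB (one_le_pow₀ hl))
  have hratio : (x k / x 0) ^ 2 ≤ d ^ 2 := by rwa [div_pow, div_le_iff₀ (by positivity)]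
  have hsq : φ σ ^ 2 ≤ B ^ 2 := sq_le_sq.2 ((hφ.abs_apply_le σ).trans (le_abs_self B))
  have hderiv_sq : deriv φ σ ^ 2 ≤ B ^ 2 / l ^ 2 := by
    rw [← div_pow, sq_le_sq, abs_of_nonneg (by positivity : 0 ≤ B / l)]
    exact hφ.abs_deriv_le σ
  have hcombination : (deriv (deriv φ) σ - 2 * deriv φ σ + φ σ) ^ 2 ≤ 16 * B ^ 2 := by
    have := abs_le.1 (hφ.abs_apply_le σ)
    have := abs_le.1 hφ₁
    have := abs_le.1 hφ₂
    calc _ ≤ (4 * B) ^ 2 := sq_le_sq' (by linarith) (by linarith)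
      _ = 16 * B ^ 2 := by ring
  calc _ = (x k / x 0) ^ 2 * ((deriv (deriv φ) σ - 2 * deriv φ σ + φ σ) ^ 2 + M * φ σ ^ 2) +
        2 * deriv φ σ ^ 2 - ((n : ℝ) - 1) * φ σ ^ 2 := by ring
    _ ≤ d ^ 2 * (16 * B ^ 2 + M * B ^ 2) + 2 * (B ^ 2 / l ^ 2) - 1 * φ σ ^ 2 := by
        gcongr
        linarith
    _ = _ := by ring

theorem IsCutoff.neumannDensity_logTrial_add_le_indicator (hφ : IsCutoff B s l φ) (hl : 1 ≤ l)
    (hM : 0 ≤ M) (hk : k ≠ 0) (hx : 0 < x 0) (hxk : x k ^ 2 ≤ d ^ 2 * x 0 ^ 2) :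
    neumannDensity (logTrial k φ) x + M * logTrial k φ x ^ 2 ≤
      (heightSlab n (Real.exp (s - l)) (Real.exp (s + l))).indicator
          (fun _ => d ^ 2 * B ^ 2 * (16 + M) + 2 * B ^ 2 / l ^ 2) x -
        (heightSlab n (Real.exp (s - l / 2)) (Real.exp (s + l / 2))).indicator 1 x := by
  by_cases hout : x ∈ heightSlab n (Real.exp (s - l)) (Real.exp (s + l))
  · rw [Set.indicator_of_mem hout]
    refine (hφ.neumannDensity_logTrial_add_le hl hM hk hx hxk).trans (sub_le_sub_left ?_ _)
    refine Set.indicator_apply_le' (fun hin => ?_) fun _ => sq_nonneg _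
    rw [hφ.eq_one _ ⟨((Real.lt_log_iff_exp_lt hx).2 hin.1).le,
      ((Real.log_lt_iff_lt_exp hx).2 hin.2).le⟩, one_pow, Pi.one_apply]
  · have hzero : logTrial k φ =ᶠ[𝓝 x] 0 := logTrial_eventuallyEq_zero hφ.tsupport_subset hx hout
    have hin : x ∉ heightSlab n (Real.exp (s - l / 2)) (Real.exp (s + l / 2)) := fun hin =>
      hout <| Set.Ioo_subset_Ioo (Real.exp_le_exp.2 (by linarith))
        (Real.exp_le_exp.2 (by linarith)) hin
    simp [neumannDensity_eq_zero_of_eventuallyEq_zero hzero, hzero.eq_of_nhds, hout, hin]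

theorem IsCutoff.integral_neumannDensity_logTrial_le (hφ : IsCutoff B s l φ)
    (hΩ : IsStripDomain Ω K) (hl : 1 ≤ l) (hM : 0 ≤ M) (hk : k ≠ 0)
    (hwidth : ∀ x ∈ Ω, x k ^ 2 ≤ d ^ 2 * x 0 ^ 2)
    (hslabs : (d ^ 2 * B ^ 2 * (16 + M) + 2 * B ^ 2 / l ^ 2) *
        (hypMeasure Ω).real (heightSlab n (Real.exp (s - l)) (Real.exp (s + l))) ≤
      (hypMeasure Ω).real (heightSlab n (Real.exp (s - l / 2)) (Real.exp (s + l / 2)))) :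
    ∫ x, neumannDensity (logTrial k φ) x ∂hypMeasure Ω ≤
      -M * ∫ x, logTrial k φ x ^ 2 ∂hypMeasure Ω := by
  have := hΩ.isFiniteMeasure
  have hsmooth := contDiffOn_logTrial (k := k) hφ.contDiff
  have hdensity := integrable_neumannDensity hΩ hsmooth
  have hsq := (hΩ.memLp hsmooth.continuousOn).integrable_sq.const_mul M
  set O := heightSlab n (Real.exp (s - l)) (Real.exp (s + l))
  set I := heightSlab n (Real.exp (s - l / 2)) (Real.exp (s + l / 2))
  set κ := d ^ 2 * B ^ 2 * (16 + M) + 2 * B ^ 2 / l ^ 2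
  have hO : MeasurableSet O := measurableSet_heightSlab _ _
  have hI : MeasurableSet I := measurableSet_heightSlab _ _
  have hO_int : Integrable (O.indicator fun _ => κ) (hypMeasure Ω) :=
    (integrable_const κ).indicator hO
  have hI_int : Integrable (I.indicator (1 : (Fin n → ℝ) → ℝ)) (hypMeasure Ω) :=
    (integrable_const 1).indicator hI
  have hsum : ∫ x, (neumannDensity (logTrial k φ) x + M * logTrial k φ x ^ 2) ∂hypMeasure Ω ≤ 0 :=
    calc _ ≤ ∫ x, (O.indicator (fun _ => κ) x - I.indicator 1 x) ∂hypMeasure Ω := by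
          refine integral_mono_ae (hdensity.add hsq) (hO_int.sub hI_int) ?_
          filter_upwards [hΩ.ae_mem] with x hx
          exact hφ.neumannDensity_logTrial_add_le_indicator hl hM hk (hΩ.pos x hx) (hwidth x hx)
      _ = (hypMeasure Ω).real O * κ - (hypMeasure Ω).real I := by
          rw [integral_sub hO_int hI_int, integral_indicator_const _ hO, integral_indicator_one hI,
            smul_eq_mul]
      _ ≤ 0 := by linarith
  rw [integral_add hdensity hsq, integral_const_mul] at hsum
  linarith

theorem jetOf_logTrial_mul_jetOf_logTrial {a b a' b' : ℝ} {φ' : ℝ → ℝ}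
    (hφ : tsupport φ ⊆ Set.Ioo a b) (hφ' : tsupport φ' ⊆ Set.Ioo a' b')
    (hdisj : Disjoint (Set.Ioo a b) (Set.Ioo a' b')) (hx : 0 < x 0) (c : JetIndex n) :
    jetOf (logTrial k φ) c x * jetOf (logTrial k φ') c x = 0 := by
  by_cases hslab : x ∈ heightSlab n (Real.exp a) (Real.exp b)
  · have hslab' : x ∉ heightSlab n (Real.exp a') (Real.exp b') := fun hslab' =>
      Set.disjoint_left.1 hdisj
        (⟨(Real.lt_log_iff_exp_lt hx).2 hslab.1, (Real.log_lt_iff_lt_exp hx).2 hslab.2⟩ :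
          Real.log (x 0) ∈ Set.Ioo a b)
        ⟨(Real.lt_log_iff_exp_lt hx).2 hslab'.1, (Real.log_lt_iff_lt_exp hx).2 hslab'.2⟩
    rw [jetOf_eq_zero_of_eventuallyEq_zero (logTrial_eventuallyEq_zero hφ' hx hslab'), mul_zero]
  · rw [jetOf_eq_zero_of_eventuallyEq_zero (logTrial_eventuallyEq_zero hφ hx hslab), zero_mul]

end RayleighQuotient

section SlimSpectrum

variable {m : ℕ} [NeZero m] {B K M d l s : ℝ} {φ : ℝ → ℝ}

theorem IsCutoff.integral_neumannDensity_logTrial_slimDomain_le (hφ : IsCutoff B s l φ)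
    (hl : 1 ≤ l) (hM : 0 ≤ M) (hd : 0 < d) {k : Fin (m + 1)} (hk : k ≠ 0)
    (hsmall : d ^ 2 * B ^ 2 * (16 + M) + 2 * B ^ 2 / l ^ 2 ≤ (2 ^ (m + 1))⁻¹)
    (hlow : 2 ≤ Real.exp (s - l)) (hhigh : Real.exp (s + l) ≤ K / 2) :
    ∫ x, neumannDensity (logTrial k φ) x ∂hypMeasure (slimDomain (m + 1) (d ^ 2 / K) K) ≤
      -M * ∫ x, logTrial k φ x ^ 2 ∂hypMeasure (slimDomain (m + 1) (d ^ 2 / K) K) := by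
  have hK : 1 < K := by linarith [Real.exp_le_exp.2 (by linarith : s - l ≤ s + l)]
  have hc : 0 < d ^ 2 / K := by positivity
  have hΩ := isStripDomain_slimDomain (n := m + 1) (by have := NeZero.one_le (n := m); omega) hc hK
  have := hΩ.isFiniteMeasure
  refine hφ.integral_neumannDensity_logTrial_le (d := d) hΩ hl hM hk (fun x hx => ?_) ?_
  · have hdist := (sq_le_axisDistSq x hk).trans (axisDistSq_le_of_mem_slimDomain hc hK hx)
    rwa [div_mul_cancel₀ _ (by positivity)] at hdist
  · have hdoubling := ENNReal.toReal_mono (by finiteness)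
      (hypMeasure_heightSlab_doubling (m := m) hd.le (by linarith) hlow hhigh)
    rw [ENNReal.toReal_mul, ENNReal.toReal_pow, ENNReal.toReal_ofNat] at hdoubling
    refine (mul_le_mul_of_nonneg_right hsmall measureReal_nonneg).trans ?_
    rwa [inv_mul_le_iff₀ (by positivity)]

theorem IsCutoff.integral_logTrial_sq_slimDomain_ne_zero (hφ : IsCutoff B s l φ) (hl : 0 ≤ l)
    (hd : 0 < d) {k : Fin (m + 1)} (hk : k ≠ 0) (hlow : 2 ≤ Real.exp (s - l))
    (hhigh : Real.exp (s + l) ≤ K / 2) :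
    ∫ x, logTrial k φ x ^ 2 ∂hypMeasure (slimDomain (m + 1) (d ^ 2 / K) K) ≠ 0 := by
  have hleft : Real.exp (s - l) ≤ Real.exp s := Real.exp_le_exp.2 (by linarith)
  have hright : Real.exp s ≤ Real.exp (s + l) := Real.exp_le_exp.2 (by linarith)
  have hK : 1 < K := by linarith
  have hc : 0 < d ^ 2 / K := by positivity
  have hΩ := isStripDomain_slimDomain (n := m + 1) (by have := NeZero.one_le (n := m); omega) hc hK
  obtain ⟨x, hx, hx0, hxk⟩ := exists_mem_slimDomain hc (t := Real.exp s) (K := K)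
    ⟨by linarith, by linarith⟩ hk
  refine hΩ.integral_sq_ne_zero (contDiffOn_logTrial hφ.contDiff).continuousOn hx ?_
  rw [logTrial, hx0, Real.log_exp, hφ.eq_one _ ⟨by linarith, by linarith⟩]
  exact mul_ne_zero hxk (by positivity)

/-- The midpoint of the `j`-th of the consecutive intervals of length `2 * l` starting at `log 2`,
in which the cutoff of the `j`-th trial function is supported. -/
def slotCenter (l : ℝ) (j : ℕ) : ℝ := Real.log 2 + j * (2 * l) + l

theorem two_le_exp_slotCenter_sub (hl : 0 ≤ l) (j : ℕ) : 2 ≤ Real.exp (slotCenter l j - l) := by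
  rw [← Real.log_le_iff_le_exp two_pos, slotCenter]
  linarith [(by positivity : (0 : ℝ) ≤ j * (2 * l))]

theorem exp_slotCenter_add_le {N j : ℕ} (hl : 0 ≤ l) (hj : j < N) :
    Real.exp (slotCenter l j + l) ≤ 2 * Real.exp (N * (2 * l)) := by
  have hj' : (j : ℝ) + 1 ≤ N := by exact_mod_cast hj
  calc Real.exp (slotCenter l j + l) = Real.exp (Real.log 2 + (j + 1) * (2 * l)) := by
        rw [slotCenter]
        ring_nf
    _ = 2 * Real.exp ((j + 1) * (2 * l)) := by rw [Real.exp_add, Real.exp_log two_pos]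
    _ ≤ 2 * Real.exp (N * (2 * l)) := by gcongr

theorem pairwise_disjoint_slots (hl : 0 ≤ l) :
    Pairwise (Function.onFun Disjoint fun j : ℕ =>
      Set.Ioo (slotCenter l j - l) (slotCenter l j + l)) := by
  refine (pairwise_disjoint_on _).2 fun i j hij => ?_
  have hij' : (i : ℝ) + 1 ≤ j := by exact_mod_cast hij
  have hends : slotCenter l i + l ≤ slotCenter l j - l := by
    have := mul_le_mul_of_nonneg_right hij' (by linarith : 0 ≤ 2 * l)
    simp only [slotCenter]
    linarith
  exact Set.disjoint_left.2 fun σ hi hj => (hi.2.trans_le hends).not_gt hj.1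

theorem exists_isNeumannSpectrum_slimDomain_le {N : ℕ} (hcut : ∀ s, ∃ φ, IsCutoff B s l φ)
    (hl : 1 ≤ l) (hM : 0 ≤ M) (hd : 0 < d)
    (hsmall : d ^ 2 * B ^ 2 * (16 + M) + 2 * B ^ 2 / l ^ 2 ≤ (2 ^ (m + 1))⁻¹)
    (hK : 4 * Real.exp (N * (2 * l)) ≤ K) :
    ∃ mu, IsNeumannSpectrum (hyperbolicMetric (m + 1)) (slimDomain (m + 1) (d ^ 2 / K) K) mu ∧
      ∀ j < N, mu j ≤ -M := by
  have hK1 : 1 < K := by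
    linarith [Real.one_le_exp (by positivity : (0 : ℝ) ≤ N * (2 * l))]
  have hc : 0 < d ^ 2 / K := by positivity
  have hΩ := isStripDomain_slimDomain (n := m + 1) (by have := NeZero.one_le (n := m); omega) hc hK1
  have hk : Fin.last m ≠ 0 := by simp [Fin.ext_iff, NeZero.ne m]
  have hl0 : 0 ≤ l := by linarith
  have hlow := two_le_exp_slotCenter_sub hl0
  have hhigh : ∀ j < N, Real.exp (slotCenter l j + l) ≤ K / 2 := fun j hj =>
    (exp_slotCenter_add_le hl0 hj).trans (by linarith)
  choose φ hφ using fun j => hcut (slotCenter l j)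
  have hnonzero : ∀ j < N, ∫ y, logTrial (Fin.last m) (φ j) y ^ 2
      ∂hypMeasure (slimDomain (m + 1) (d ^ 2 / K) K) ≠ 0 := fun j hj =>
    (hφ j).integral_logTrial_sq_slimDomain_ne_zero hl0 hd hk (hlow j) (hhigh j hj)
  have hspectrum := exists_isNeumannSpectrum_le hΩ (ι := Fin N) (κ := -M)
    (u := fun j => logTrial (Fin.last m) (φ j)) (fun j => contDiffOn_logTrial (hφ j).contDiff)
    (fun i j hij x hx => jetOf_logTrial_mul_jetOf_logTrial (hφ i).tsupport_subset
      (hφ j).tsupport_subset (pairwise_disjoint_slots hl0 (Fin.val_ne_of_ne hij)) (hΩ.pos x hx))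
    (fun j => hnonzero j j.2)
    (fun j => (hφ j).integral_neumannDensity_logTrial_slimDomain_le hl hM hd hk hsmall (hlow j)
      (hhigh j j.2))
  simpa only [Fintype.card_fin] using hspectrum

theorem exists_boundedDomain_neumannSpectrum_le (m : ℕ) [NeZero m] (N : ℕ) (hM : 0 ≤ M) :
    ∃ Ω : Set (Fin (m + 1) → ℝ),
      IsBoundedDomain (halfSpace (m + 1)) (hyperbolicMetric (m + 1)) Ω ∧ HasC1Boundary Ω ∧
      riemVolume (hyperbolicMetric (m + 1)) Ω = 1 ∧
      ∃ mu : ℕ → ℝ, IsNeumannSpectrum (hyperbolicMetric (m + 1)) Ω mu ∧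
        ∀ j : ℕ, j < N → mu j ≤ -M := by
  obtain ⟨B, hB, hcut⟩ := exists_isCutoff
  obtain ⟨l, hl, hl_small⟩ : ∃ l : ℝ, 1 ≤ l ∧ 2 * B ^ 2 / l ^ 2 ≤ (2 ^ (m + 1))⁻¹ / 2 :=
    ((eventually_ge_atTop 1).and ((tendsto_const_nhds.div_atTop
      (tendsto_pow_atTop two_ne_zero)).eventually_le_const (by positivity))).exists
  obtain ⟨η, hη, hη_small⟩ : ∃ η : ℝ, 0 < η ∧
      η ^ 2 * B ^ 2 * (16 + M) ≤ (2 ^ (m + 1))⁻¹ / 2 := by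
    refine ⟨√((2 ^ (m + 1))⁻¹ / 2 / (B ^ 2 * (16 + M))), by positivity, ?_⟩
    rw [Real.sq_sqrt (by positivity), mul_assoc, div_mul_cancel₀ _ (by positivity)]
  obtain ⟨K, ⟨d, hd, hdη, hvolume⟩, hK⟩ :=
    ((eventually_exists_riemVolume_slimDomain_eq_one (m := m) hη).and
      (eventually_ge_atTop (4 * Real.exp (N * (2 * l))))).exists
  have hK1 : 1 < K := by
    linarith [Real.one_le_exp (by positivity : (0 : ℝ) ≤ N * (2 * l))]
  have hn : 2 ≤ m + 1 := by have := NeZero.one_le (n := m); omega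
  have hc : 0 < d ^ 2 / K := by positivity
  refine ⟨slimDomain (m + 1) (d ^ 2 / K) K, (isStripDomain_slimDomain hn hc hK1).isBoundedDomain,
    hasC1Boundary_slimDomain hn hc hK1, hvolume,
    exists_isNeumannSpectrum_slimDomain_le (fun s => hcut s l (by linarith)) hl hM hd ?_ hK⟩
  calc d ^ 2 * B ^ 2 * (16 + M) + 2 * B ^ 2 / l ^ 2
      ≤ η ^ 2 * B ^ 2 * (16 + M) + 2 * B ^ 2 / l ^ 2 := by gcongr
    _ ≤ (2 ^ (m + 1))⁻¹ := by linarith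

end SlimSpectrum

end BiharmonicNeumann

end

theorem mainTheorem6 (n : ℕ) [NeZero n] (hn : 2 ≤ n) (N : ℕ) (M : ℝ) (hM : 0 < M) :
    ∃ Ω : Set (Fin n → ℝ),
      BiharmonicNeumann.IsBoundedDomain (BiharmonicNeumann.halfSpace n)
        (BiharmonicNeumann.hyperbolicMetric n) Ω ∧
      BiharmonicNeumann.HasC1Boundary Ω ∧
      BiharmonicNeumann.riemVolume (BiharmonicNeumann.hyperbolicMetric n) Ω = 1 ∧
      ∃ mu : ℕ → ℝ,
        BiharmonicNeumann.IsNeumannSpectrum (BiharmonicNeumann.hyperbolicMetric n) Ω mu ∧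
        ∀ j : ℕ, j < N → mu j ≤ -M := by
  obtain ⟨m, rfl⟩ : ∃ m, n = m + 1 := ⟨n - 1, by omega⟩
  have : NeZero m := ⟨by omega⟩
  exact BiharmonicNeumann.exists_boundedDomain_neumannSpectrum_le m N hM.le
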